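/- Consider the following scheduling problem. There are $m$ machines and $n$ jobs; machine $i$ has an arbitrary integral dedicated load $dl(i) \ge 0$. There are two integers $W > w > 0$. Every job is either heavy, with weight $W$ and one or two machines to which it can be assigned, or light, with weight $w$ and any positive number of machines to which it can be assigned. An assignment $\sigma$ maps every job to a machine to which it can be assigned; its makespan is the maximum over the machines $i$ of $dl(i)$ plus the total weight of the jobs $j$ with $\sigma(j) = i$, and $\mathrm{OPT}$ is the minimum makespan of an assignment. Suppose that $W \ge 2w$. Then a $\left(1 + \frac{\lfloor W/2 \rfloor}{W}\right)$-approximate solution can be found in polynomial time. That is, there is one algorithm that, given any such instance with $W \ge 2w$ (the numbers $W$, $w$ and $dl(i)$ being part of the input, written in binary), halts after a number of steps that is polynomial in the size of the input and returns an assignment of makespan at most $\left(1 + \frac{\lfloor W/2 \rfloor}{W}\right)\cdot \mathrm{OPT}$. For odd $W$ the ratio $1 + \frac{\lfloor W/2 \rfloor}{W}$ is strictly less than $1.5$. -/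

import Mathlib

/-! ### A random access machine with a step count

Programs work on scalar variables and on arrays of natural numbers. The primitive operations are
addition, truncated subtraction, halving and array access; there is no multiplication. Every
primitive operation, test and assignment that is executed costs one step. Since one step lengthens
the binary representation of the largest number in the memory by at most one bit and touches a
bounded number of memory cells, running time on this machine is polynomially related to running
time on a Turing machine. -/

namespace RAM

/-- The memory: scalar variables and two-index arrays, named by natural numbers. A program mentions
only finitely many names. A one-dimensional array is used with second index `0`. -/
@[ext]
structure Store where
  var : ℕ → ℕ
  arr : ℕ → ℕ → ℕ → ℕ

/-- Overwrite one variable. -/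
def Store.setVar (s : Store) (x v : ℕ) : Store where
  var := fun y => if y = x then v else s.var y
  arr := s.arr

/-- Overwrite one array cell. -/
def Store.setArr (s : Store) (a i j v : ℕ) : Store where
  var := s.var
  arr := fun b k l => if b = a ∧ k = i ∧ l = j then v else s.arr b k l

/-- Expressions. -/
inductive Expr where
  | const (n : ℕ)
  | var (x : ℕ)
  | arr (a : ℕ) (i j : Expr)
  | add (e₁ e₂ : Expr)
  | sub (e₁ e₂ : Expr)
  | half (e : Expr)

/-- The value of an expression. -/
def Expr.eval (s : Store) : Expr → ℕ
  | const n => n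
  | var x => s.var x
  | arr a i j => s.arr a (i.eval s) (j.eval s)
  | add e₁ e₂ => e₁.eval s + e₂.eval s
  | sub e₁ e₂ => e₁.eval s - e₂.eval s
  | half e => e.eval s / 2

/-- The number of primitive operations in the evaluation of an expression. -/
def Expr.cost : Expr → ℕ
  | const _ => 1
  | var _ => 1
  | arr _ i j => i.cost + j.cost + 1
  | add e₁ e₂ => e₁.cost + e₂.cost + 1
  | sub e₁ e₂ => e₁.cost + e₂.cost + 1
  | half e => e.cost + 1

/-- Programs. The tests of `ite` and `loop` succeed when the value of the expression is nonzero;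
`loop e c` repeats `c` as long as the test succeeds. -/
inductive Program where
  | skip
  | setVar (x : ℕ) (e : Expr)
  | setArr (a : ℕ) (i j e : Expr)
  | seq (c d : Program)
  | ite (e : Expr) (c d : Program)
  | loop (e : Expr) (c : Program)

/-- `Exec c s s' k`: started on memory `s`, the program `c` halts with memory `s'` after exactly
`k` steps. -/
inductive Exec : Program → Store → Store → ℕ → Prop where
  | skip (s : Store) : Exec .skip s s 1
  | setVar (x : ℕ) (e : Expr) (s : Store) :
      Exec (.setVar x e) s (s.setVar x (e.eval s)) (e.cost + 1)
  | setArr (a : ℕ) (i j e : Expr) (s : Store) :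
      Exec (.setArr a i j e) s (s.setArr a (i.eval s) (j.eval s) (e.eval s))
        (i.cost + j.cost + e.cost + 1)
  | seq {c d : Program} {s s' s'' : Store} {k l : ℕ} :
      Exec c s s' k → Exec d s' s'' l → Exec (.seq c d) s s'' (k + l)
  | ite_true {e : Expr} {c d : Program} {s s' : Store} {k : ℕ} :
      e.eval s ≠ 0 → Exec c s s' k → Exec (.ite e c d) s s' (e.cost + 1 + k)
  | ite_false {e : Expr} {c d : Program} {s s' : Store} {k : ℕ} :
      e.eval s = 0 → Exec d s s' k → Exec (.ite e c d) s s' (e.cost + 1 + k)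
  | loop_done {e : Expr} {c : Program} {s : Store} :
      e.eval s = 0 → Exec (.loop e c) s s (e.cost + 1)
  | loop_step {e : Expr} {c : Program} {s s' s'' : Store} {k l : ℕ} :
      e.eval s ≠ 0 → Exec c s s' k → Exec (.loop e c) s' s'' l →
        Exec (.loop e c) s s'' (e.cost + 1 + k + l)

end RAM

/-! ### Graph balancing with light hyper edges, two job sizes -/

/-- An instance: `machines` machines, each with an arbitrary dedicated load, and `jobs` jobs. A
heavy job has weight `W` and at most two eligible machines, a light job has weight `w` and any
positive number of eligible machines. -/
structure TwoSizeInstance where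
  machines : ℕ
  jobs : ℕ
  W : ℕ
  w : ℕ
  w_pos : 0 < w
  w_lt_W : w < W
  dedicated : Fin machines → ℕ
  heavy : Fin jobs → Bool
  eligible : Fin jobs → Finset (Fin machines)
  eligible_nonempty : ∀ j, (eligible j).Nonempty
  heavy_card_le : ∀ j, heavy j = true → (eligible j).card ≤ 2

namespace TwoSizeInstance

variable (I : TwoSizeInstance)

/-- The weight of a job. -/
def weight (j : Fin I.jobs) : ℕ := if I.heavy j then I.W else I.w

/-- Every job goes to a machine to which it can be assigned. -/
def IsAssignment (σ : Fin I.jobs → Fin I.machines) : Prop := ∀ j, σ j ∈ I.eligible j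

/-- The load of a machine: its dedicated load and the weights of the jobs assigned to it. -/
def load (σ : Fin I.jobs → Fin I.machines) (i : Fin I.machines) : ℕ :=
  I.dedicated i + ∑ j with σ j = i, I.weight j

/-- The largest load of a machine. -/
def makespan (σ : Fin I.jobs → Fin I.machines) : ℕ := Finset.univ.sup (I.load σ)

/-- The smallest makespan of an assignment. (Assignments exist, as no job is without an eligible
machine.) -/
noncomputable def opt : ℕ := sInf {t | ∃ σ, I.IsAssignment σ ∧ I.makespan σ = t}

/-- The size of the instance: the number of machines, the number of jobs, and the lengths of the
numbers in binary. (It does not count the at most `jobs * machines` pairs of a job and an eligible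
machine, hence is at most the length of a full description, and is polynomially related to it.) -/
def size : ℕ :=
  I.machines + I.jobs + I.W.size + I.w.size + ∑ i, (I.dedicated i).size

/-- The memory at the start. Variables `0`, `1`, `2`, `3` hold the number of machines, the number of
jobs, `W` and `w`. Array `0` holds the dedicated loads, array `1` tells which jobs are heavy, and
array `2` is the job-machine eligibility matrix. All else is `0`. -/
def input : RAM.Store where
  var := fun x =>
    if x = 0 then I.machines else if x = 1 then I.jobs else if x = 2 then I.W
    else if x = 3 then I.w else 0
  arr := fun a i j =>
    if a = 0 then
      if h : i < I.machines then (if j = 0 then I.dedicated ⟨i, h⟩ else 0) else 0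
    else if a = 1 then
      if h : i < I.jobs then (if j = 0 ∧ I.heavy ⟨i, h⟩ = true then 1 else 0) else 0
    else if a = 2 then
      if h : i < I.jobs ∧ j < I.machines then
        (if (⟨j, h.2⟩ : Fin I.machines) ∈ I.eligible ⟨i, h.1⟩ then 1 else 0) else 0
    else 0

/-- The memory describes the map `σ`: cell `j` of array `3` holds the machine of job `j`. -/
def IsOutput (s : RAM.Store) (σ : Fin I.jobs → Fin I.machines) : Prop :=
  ∀ j : Fin I.jobs, s.arr 3 j 0 = σ j

end TwoSizeInstance

/-! Fix a guess T and suppose that an assignment σ of makespan at most T exists. The basic tool is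
push and relabel: jobs on overloaded bins descend a labelling one level at a time. It can fail only
if there is a full set: a set of bins that its jobs cannot leave, each of load greater than its
capacity minus the largest weight, one of them overloaded. Every use is justified by a count against
σ that excludes full sets (`not_fullSet_of_two_mul_le`, `not_fullSet_light`, `not_fullSet_heavy`).

If T ≥ 2W, one run on all jobs gives loads of at most T + W - 1, which is good enough because W - 1
≤ 2⌊W/2⌋.

If T < 2W, then σ puts at most one heavy job on a machine, and only on an able one, where dl + W ≤
T. The heavy jobs are the edges of a graph on the machines. A component with fewer edges than able
machines is a tree of able machines, exactly one of which has no heavy job under σ; in all other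
components every able machine has one. Since the free machine of a tree is unknown, its surplus of
light jobs is taken by a pool. Let x = qw be the largest multiple of w up to ⌊W/2⌋ (with q cut off
at the number of jobs). An able machine is filled with light jobs only so far that W + x more still
fits below T + ⌊W/2⌋, and the pool of a tree has capacity 2x + w. Moving up to 2q + 1 light jobs
from the free machine to the pool shows that σ respects these capacities, since ⌊W/2⌋ < x + w unless
q was cut off.

Pooled jobs then go to arbitrary eligible machines of the component. A machine becomes too full for
a heavy job only by receiving more than q pooled jobs, which cannot happen twice in a tree. A tree
can spare any one of its machines, so a second run places the heavy jobs, at most one per machine,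
where room is left (`not_fullSet_heavy`). All loads are at most T + ⌊W/2⌋; on a spared machine this
uses 2w ≤ W. If T ≥ W, the excess is within the ratio, and if T < W there are no heavy jobs and no
able machines (`load_le_of_placed`).

The optimum has the form dl(v) + aW + bw with a, b at most the number of jobs, so all such values
are tried and the best assignment is kept. The step count thus depends on the numbers of machines
and jobs only, and `exec_compile` bounds it by recursion on a program with bounded loops. -/

namespace GraphBalancing

open RAM

/-! ### A language of bounded loops -/

/-- Bounds of loops, built from the numbers of machines and jobs. -/
inductive Bound where
  | machines
  | jobs
  | const (k : ℕ)
  | add (a b : Bound)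

namespace Bound

/-- The value of a bound. -/
def val (s : Store) : Bound → ℕ
  | machines => s.var 0
  | jobs => s.var 1
  | const k => k
  | add a b => a.val s + b.val s

/-- The expression that computes a bound. -/
def toExpr : Bound → Expr
  | machines => .var 0
  | jobs => .var 1
  | const k => .const k
  | add a b => .add a.toExpr b.toExpr

/-- A polynomial that dominates a bound. -/
noncomputable def poly : Bound → Polynomial ℕ
  | machines => .X
  | jobs => .X
  | const k => .C k
  | add a b => a.poly + b.poly

theorem eval_toExpr (s : Store) (b : Bound) : b.toExpr.eval s = b.val s := by
  induction b <;> simp_all [toExpr, Expr.eval, val]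

theorem val_congr {s t : Store} (h0 : s.var 0 = t.var 0) (h1 : s.var 1 = t.var 1) (b : Bound) :
    b.val s = b.val t := by
  induction b <;> simp_all [val]

theorem val_le_poly {s : Store} {N : ℕ} (h0 : s.var 0 ≤ N) (h1 : s.var 1 ≤ N) (b : Bound) :
    b.val s ≤ b.poly.eval N := by
  induction b with
  | add a b iha ihb => simpa [val, poly] using Nat.add_le_add iha ihb
  | _ => simp_all [val, poly]

end Bound

/-- Programs all of whose loops are bounded: `loop x b c` runs `c` for the values of the variable
`x` below `b`. -/
inductive Code where
  | assign (x : ℕ) (e : Expr)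
  | store (a : ℕ) (i j e : Expr)
  | seq (c d : Code)
  | ite (e : Expr) (c d : Code)
  | loop (x : ℕ) (b : Bound) (c : Code)
  | skip

namespace Code

/-- The effect of a program on the memory. -/
def den : Code → Store → Store
  | assign x e, s => s.setVar x (e.eval s)
  | store a i j e, s => s.setArr a (i.eval s) (j.eval s) (e.eval s)
  | seq c d, s => d.den (c.den s)
  | ite e c d, s => if e.eval s = 0 then d.den s else c.den s
  | loop x b c, s => (fun t => (c.den t).setVar x (t.var x + 1))^[b.val s] (s.setVar x 0)
  | skip, s => s

/-- The variables that a program may change. -/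
def setsVar : Code → ℕ → Bool
  | assign x _, y => x == y
  | store .., _ => false
  | seq c d, y => c.setsVar y || d.setsVar y
  | ite _ c d, y => c.setsVar y || d.setsVar y
  | loop x _ c, y => x == y || c.setsVar y
  | skip, _ => false

/-- The arrays that a program may change. -/
def setsArr : Code → ℕ → Bool
  | assign .., _ => false
  | store a .., b => a == b
  | seq c d, y => c.setsArr y || d.setsArr y
  | ite _ c d, y => c.setsArr y || d.setsArr y
  | loop _ _ c, y => c.setsArr y
  | skip, _ => false

/-- Loops do not change their counters, and nothing changes the numbers of machines and jobs. -/
def ok : Code → Bool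
  | assign x _ => x != 0 && x != 1
  | store .. => true
  | seq c d => c.ok && d.ok
  | ite _ c d => c.ok && d.ok
  | loop x _ c => x != 0 && x != 1 && !c.setsVar x && c.ok
  | skip => true

/-- Translation to the random access machine. -/
def compile : Code → Program
  | assign x e => .setVar x e
  | store a i j e => .setArr a i j e
  | seq c d => .seq c.compile d.compile
  | ite e c d => .ite e c.compile d.compile
  | loop x b c => .seq (.setVar x (.const 0))
      (.loop (.sub b.toExpr (.var x)) (.seq c.compile (.setVar x (.add (.var x) (.const 1)))))
  | skip => .skip

/-- A polynomial bound on the running time. -/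
noncomputable def poly : Code → Polynomial ℕ
  | assign _ e => .C (e.cost + 1)
  | store _ i j e => .C (i.cost + j.cost + e.cost + 1)
  | seq c d => c.poly + d.poly
  | ite e c d => .C (e.cost + 1) + c.poly + d.poly
  | loop _ b c => b.poly * (c.poly + .C (b.toExpr.cost + 7)) + .C (b.toExpr.cost + 5)
  | skip => .C 1

/-- `s'` agrees with `s` except where `c` may have changed it. -/
structure Frame (c : Code) (s s' : Store) : Prop where
  var : ∀ y, c.setsVar y = false → s'.var y = s.var y
  arr : ∀ a, c.setsArr a = false → s'.arr a = s.arr a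

theorem iterate_frame {x : ℕ} {c : Code} (hc : ∀ s, Frame c s (c.den s)) (k : ℕ) (s : Store) :
    (∀ y, x ≠ y → c.setsVar y = false →
      ((fun t => (c.den t).setVar x (t.var x + 1))^[k] s).var y = s.var y) ∧
    (∀ a, c.setsArr a = false →
      ((fun t => (c.den t).setVar x (t.var x + 1))^[k] s).arr a = s.arr a) := by
  induction k generalizing s with
  | zero => simp
  | succ k ih =>
    simp only [Function.iterate_succ, Function.comp]
    constructor
    · intro y hy hy'
      rw [(ih _).1 y hy hy']
      simp only [Store.setVar]
      rw [if_neg (Ne.symm hy), (hc s).var y hy']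
    · intro a ha
      rw [(ih _).2 a ha]
      simp only [Store.setVar]
      rw [(hc s).arr a ha]

theorem frame (c : Code) (s : Store) : Frame c s (c.den s) := by
  induction c generalizing s with
  | assign x e =>
    refine ⟨fun y hy => ?_, fun a _ => rfl⟩
    have : y ≠ x := by rintro rfl; simp [setsVar] at hy
    simp [den, Store.setVar, this]
  | store a i j e =>
    refine ⟨fun y hy => rfl, fun b hb => ?_⟩
    have : b ≠ a := by rintro rfl; simp [setsArr] at hb
    funext k l
    simp [den, Store.setArr, this]
  | seq c d ihc ihd =>
    refine ⟨fun y hy => ?_, fun a ha => ?_⟩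
    · simp only [setsVar, Bool.or_eq_false_iff] at hy
      simp only [den]
      rw [(ihd _).var y hy.2, (ihc _).var y hy.1]
    · simp only [setsArr, Bool.or_eq_false_iff] at ha
      simp only [den]
      rw [(ihd _).arr a ha.2, (ihc _).arr a ha.1]
  | ite e c d ihc ihd =>
    refine ⟨fun y hy => ?_, fun a ha => ?_⟩
    · simp only [setsVar, Bool.or_eq_false_iff] at hy
      simp only [den]
      split_ifs
      · exact (ihd _).var y hy.2
      · exact (ihc _).var y hy.1
    · simp only [setsArr, Bool.or_eq_false_iff] at ha
      simp only [den]
      split_ifs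
      · exact (ihd _).arr a ha.2
      · exact (ihc _).arr a ha.1
  | loop x b c ih =>
    refine ⟨fun y hy => ?_, fun a ha => ?_⟩
    · simp only [setsVar, Bool.or_eq_false_iff, beq_eq_false_iff_ne] at hy
      simp only [den]
      rw [(iterate_frame ih _ _).1 y hy.1 hy.2]
      simp [Store.setVar, Ne.symm hy.1]
    · simp only [setsArr] at ha
      simp only [den]
      rw [(iterate_frame ih _ _).2 a ha]
      rfl
  | skip => exact ⟨fun _ _ => rfl, fun _ _ => rfl⟩

/-- Bounds of loops are functions of variables `0` and `1`, so they stay constant while a loop runs.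
-/
theorem setsVar_of_ok {c : Code} (h : c.ok = true) : c.setsVar 0 = false ∧ c.setsVar 1 = false := by
  induction c <;> simp_all [ok, setsVar]

/-- Induction on the number `r` of rounds left. Besides the body, a round costs `b.toExpr.cost + 3`
for the test and 4 for the increment; the final failing test is the last summand. The machine
increments the counter from its value after the body, `den` from its value before; `hxc` makes the
two agree. -/
theorem exec_iterate {x : ℕ} {b : Bound} {c : Code} {N : ℕ}
    (hx0 : x ≠ 0) (hx1 : x ≠ 1) (hxc : c.setsVar x = false)
    (h0 : c.setsVar 0 = false) (h1 : c.setsVar 1 = false)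
    (hc : ∀ s : Store, s.var 0 ≤ N → s.var 1 ≤ N →
      ∃ k, Exec c.compile s (c.den s) k ∧ k ≤ c.poly.eval N) (r : ℕ) :
    ∀ s : Store, s.var 0 ≤ N → s.var 1 ≤ N → b.val s - s.var x = r →
      ∃ k, Exec (.loop (.sub b.toExpr (.var x))
          (.seq c.compile (.setVar x (.add (.var x) (.const 1))))) s
          ((fun t => (c.den t).setVar x (t.var x + 1))^[r] s) k ∧
        k ≤ r * (c.poly.eval N + (b.toExpr.cost + 7)) + (b.toExpr.cost + 3) := by
  induction r with
  | zero =>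
    intro s hs0 hs1 hr
    refine ⟨_, Exec.loop_done ?_, ?_⟩
    · simpa [Expr.eval, Bound.eval_toExpr] using hr
    · simp [Expr.cost]
  | succ r ih =>
    intro s hs0 hs1 hr
    obtain ⟨k, hk, hkN⟩ := hc s hs0 hs1
    set t : Store := (c.den s).setVar x (s.var x + 1) with ht
    have hf := c.frame s
    have e0 : t.var 0 = s.var 0 := by
      simp [ht, Store.setVar, Ne.symm hx0, hf.var 0 h0]
    have e1 : t.var 1 = s.var 1 := by
      simp [ht, Store.setVar, Ne.symm hx1, hf.var 1 h1]
    have ex : t.var x = s.var x + 1 := by simp [ht, Store.setVar]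
    obtain ⟨l, hl, hlN⟩ := ih t (e0 ▸ hs0) (e1 ▸ hs1) (by
      rw [Bound.val_congr e0 e1, ex]; omega)
    have hset := Exec.setVar x (.add (.var x) (.const 1)) (c.den s)
    have : (c.den s).setVar x ((Expr.add (.var x) (.const 1)).eval (c.den s)) = t := by
      simp [Expr.eval, ht, hf.var x hxc]
    rw [this] at hset
    refine ⟨_, Exec.loop_step ?_ (Exec.seq hk hset) hl, ?_⟩
    · simp only [Expr.eval, Bound.eval_toExpr]; omega
    · simp only [Expr.cost]
      have : (r + 1) * (c.poly.eval N + (b.toExpr.cost + 7)) =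
        r * (c.poly.eval N + (b.toExpr.cost + 7)) + (c.poly.eval N + (b.toExpr.cost + 7)) := by ring
      omega

/-- The translation runs in polynomial time and computes `den`. -/
theorem exec_compile {c : Code} (hc : c.ok = true) {N : ℕ} (s : Store)
    (h0 : s.var 0 ≤ N) (h1 : s.var 1 ≤ N) :
    ∃ k, Exec c.compile s (c.den s) k ∧ k ≤ c.poly.eval N := by
  induction c generalizing s with
  | assign x e => exact ⟨_, Exec.setVar x e s, by simp [poly]⟩
  | store a i j e => exact ⟨_, Exec.setArr a i j e s, by simp [poly]⟩
  | skip => exact ⟨_, Exec.skip s, by simp [poly]⟩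
  | seq c d ihc ihd =>
    simp only [ok, Bool.and_eq_true] at hc
    obtain ⟨k, hk, hkN⟩ := ihc hc.1 s h0 h1
    have hf := c.frame s
    have hv := setsVar_of_ok hc.1
    obtain ⟨l, hl, hlN⟩ := ihd hc.2 (c.den s) (by rwa [hf.var 0 hv.1]) (by rwa [hf.var 1 hv.2])
    exact ⟨_, Exec.seq hk hl, by simpa [poly] using Nat.add_le_add hkN hlN⟩
  | ite e c d ihc ihd =>
    simp only [ok, Bool.and_eq_true] at hc
    by_cases he : e.eval s = 0
    · obtain ⟨k, hk, hkN⟩ := ihd hc.2 s h0 h1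
      refine ⟨e.cost + 1 + k, ?_, ?_⟩
      · simpa [den, he, compile] using Exec.ite_false he hk
      · simp [poly]; omega
    · obtain ⟨k, hk, hkN⟩ := ihc hc.1 s h0 h1
      refine ⟨e.cost + 1 + k, ?_, ?_⟩
      · simpa [den, he, compile] using Exec.ite_true he hk
      · simp [poly]; omega
  | loop x b c ih =>
    simp only [ok, Bool.and_eq_true, bne_iff_ne, ne_eq, Bool.not_eq_true'] at hc
    obtain ⟨⟨⟨hx0, hx1⟩, hxc⟩, hok⟩ := hc
    have hv := setsVar_of_ok hok
    have e0 : (s.setVar x 0).var 0 = s.var 0 := by simp [Store.setVar, Ne.symm hx0]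
    have e1 : (s.setVar x 0).var 1 = s.var 1 := by simp [Store.setVar, Ne.symm hx1]
    obtain ⟨k, hk, hkN⟩ := exec_iterate (b := b) hx0 hx1 hxc hv.1 hv.2 (fun s h h' => ih hok s h h')
      (b.val s) (s.setVar x 0) (e0 ▸ h0) (e1 ▸ h1)
      (by rw [Bound.val_congr e0 e1]; simp [Store.setVar])
    -- Resetting the counter takes 2 steps, which turns the `+ 3` of the last test into the `+ 5` of
    -- `poly`.
    refine ⟨_, Exec.seq (Exec.setVar x (.const 0) s) hk, ?_⟩
    have := Nat.mul_le_mul_right (c.poly.eval N + (b.toExpr.cost + 7)) (Bound.val_le_poly h0 h1 b)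
    simp only [poly, Polynomial.eval_add, Polynomial.eval_mul, Polynomial.eval_C, Expr.cost]
    omega

/-- Reasoning about loops by an invariant. -/
theorem loop_induction {x : ℕ} {b : Bound} {c : Code} {s : Store} (P : ℕ → Store → Prop)
    (h0 : P 0 (s.setVar x 0))
    (hstep : ∀ i t, i < b.val s → t.var x = i → Frame (loop x b c) s t → P i t →
      P (i + 1) ((c.den t).setVar x (i + 1))) :
    P (b.val s) ((loop x b c).den s) := by
  have key : ∀ k, k ≤ b.val s →
      let t := (fun t => (c.den t).setVar x (t.var x + 1))^[k] (s.setVar x 0)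
      t.var x = k ∧ Frame (loop x b c) s t ∧ P k t := by
    intro k hk
    induction k with
    | zero =>
      refine ⟨by simp [Store.setVar], ⟨fun y hy => ?_, fun a _ => rfl⟩, h0⟩
      simp only [setsVar, Bool.or_eq_false_iff, beq_eq_false_iff_ne] at hy
      simp [Store.setVar, Ne.symm hy.1]
    | succ k ih =>
      obtain ⟨hxk, hf, hP⟩ := ih (by omega)
      simp only [Function.iterate_succ_apply']
      set t := (fun t => (c.den t).setVar x (t.var x + 1))^[k] (s.setVar x 0) with ht
      have hft := c.frame t
      refine ⟨by simp [Store.setVar, hxk], ⟨fun y hy => ?_, fun a ha => ?_⟩, ?_⟩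
      · have hy' := hy
        simp only [setsVar, Bool.or_eq_false_iff, beq_eq_false_iff_ne] at hy
        simp [Store.setVar, Ne.symm hy.1, hft.var y hy.2, hf.var y hy']
      · have ha' := ha
        simp only [setsArr] at ha
        simp [Store.setVar, hft.arr a ha, hf.arr a ha']
      · rw [hxk]; exact hstep k t (by omega) hxk hf hP
  exact (key _ le_rfl).2.2

end Code

end GraphBalancing

/-! ### Push and relabel, whose only obstruction is a full set -/

namespace GraphBalancing

open Finset

/-! ### Push and relabel for jobs and bins -/

/-- The weight of the jobs below `n` that `pos` puts into bin `b`. -/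
def binLoad (n : ℕ) (wt pos : ℕ → ℕ) (b : ℕ) : ℕ :=
  ∑ j ∈ range n, if pos j = b then wt j else 0

theorem binLoad_congr {n : ℕ} {wt wt' pos pos' : ℕ → ℕ} (hw : ∀ j < n, wt j = wt' j)
    (hp : ∀ j < n, pos j = pos' j) (b : ℕ) : binLoad n wt pos b = binLoad n wt' pos' b := by
  refine sum_congr rfl fun j hj => ?_
  rw [hw j (mem_range.1 hj), hp j (mem_range.1 hj)]

/-- A set of bins is full if no job leaves it and every bin is within `wmax` of exceeding its
capacity, with one bin that does exceed it. -/
structure FullSet (M n : ℕ) (E : ℕ → ℕ → Prop) (wt cap : ℕ → ℕ) (wmax : ℕ)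
    (pos : ℕ → ℕ) (S : Finset ℕ) : Prop where
  lt : ∀ b ∈ S, b < M
  mem : ∀ j < n, E j (pos j)
  closed : ∀ j < n, pos j ∈ S → ∀ u < M, E j u → u ∈ S
  full : ∀ b ∈ S, cap b < binLoad n wt pos b + wmax
  exceeds : ∃ b ∈ S, cap b < binLoad n wt pos b

/-- The invariant of push and relabel. -/
structure Labelled (M n : ℕ) (E : ℕ → ℕ → Prop) (wt cap : ℕ → ℕ) (wmax : ℕ)
    (pos lab : ℕ → ℕ) : Prop where
  lt : ∀ j < n, pos j < M
  mem : ∀ j < n, E j (pos j)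
  steep : ∀ j < n, ∀ u < M, E j u → lab (pos j) ≤ lab u + 1
  full : ∀ b < M, 0 < lab b → cap b < binLoad n wt pos b + wmax

/-- One step of push and relabel. -/
inductive PushRelabel (M n : ℕ) (E : ℕ → ℕ → Prop) (wt cap : ℕ → ℕ) (pos lab : ℕ → ℕ) :
    (ℕ → ℕ) → (ℕ → ℕ) → Prop where
  | done (h : ∀ b < M, binLoad n wt pos b ≤ cap b) : PushRelabel M n E wt cap pos lab pos lab
  | push {v j u : ℕ} (hv : v < M) (hover : cap v < binLoad n wt pos v) (hj : j < n)
      (hjv : pos j = v) (hu : u < M) (hE : E j u) (hlab : lab u + 1 = lab v) :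
      PushRelabel M n E wt cap pos lab (Function.update pos j u) lab
  | relabel {v : ℕ} (hv : v < M) (hover : cap v < binLoad n wt pos v)
      (h : ∀ j < n, pos j = v → ∀ u < M, E j u → lab u + 1 ≠ lab v) :
      PushRelabel M n E wt cap pos lab pos (Function.update lab v (lab v + 1))

section

variable {M n : ℕ} {E : ℕ → ℕ → Prop} {wt cap : ℕ → ℕ} {wmax : ℕ} {pos lab pos' lab' : ℕ → ℕ}

theorem binLoad_update_of_ne {j u b : ℕ} (hb : b ≠ pos j) :
    binLoad n wt pos b ≤ binLoad n wt (Function.update pos j u) b := by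
  refine sum_le_sum fun i _ => ?_
  by_cases hi : i = j
  · subst hi; simp [Ne.symm hb]
  · simp [Function.update_of_ne hi]

theorem binLoad_le_update {j u b : ℕ} (hj : wt j ≤ wmax) (hjn : j < n) :
    binLoad n wt pos b ≤ binLoad n wt (Function.update pos j u) b + wmax := by
  unfold binLoad
  rw [← add_sum_erase _ _ (mem_range.2 hjn), ← add_sum_erase _ _ (mem_range.2 hjn)]
  have : ∑ i ∈ (range n).erase j, (if Function.update pos j u i = b then wt i else 0) =
      ∑ i ∈ (range n).erase j, (if pos i = b then wt i else 0) := by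
    refine sum_congr rfl fun i hi => ?_
    rw [Function.update_of_ne (ne_of_mem_erase hi)]
  rw [this]
  split_ifs <;> omega

/-- A push goes exactly one level down, so the job stays within the steepness bound; the only bin
that loses load was overloaded and loses at most `wmax`, so it stays full. A raised bin is
overloaded, and none of its jobs has an eligible bin exactly one level lower, which leaves the slack
that steepness needs. -/
theorem Labelled.step (hwt : ∀ j < n, wt j ≤ wmax) (h : Labelled M n E wt cap wmax pos lab)
    (hs : PushRelabel M n E wt cap pos lab pos' lab') : Labelled M n E wt cap wmax pos' lab' := by
  cases hs with
  | done _ => exact h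
  | @push v j u hv hover hj hjv hu hE hlab =>
    refine ⟨fun i hi => ?_, fun i hi => ?_, fun i hi x hx hEx => ?_, fun b hb hl => ?_⟩
    · by_cases hij : i = j
      · subst hij; simpa using hu
      · simpa [Function.update_of_ne hij] using h.lt i hi
    · by_cases hij : i = j
      · subst hij; simpa using hE
      · simpa [Function.update_of_ne hij] using h.mem i hi
    · by_cases hij : i = j
      · subst hij
        have := h.steep i hi x hx hEx
        rw [hjv] at this
        simp only [Function.update_self]
        omega
      · simpa [Function.update_of_ne hij] using h.steep i hi x hx hEx
    · by_cases hbv : b = v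
      · subst hbv
        exact lt_of_lt_of_le hover (binLoad_le_update (hwt j hj) hj)
      · have := h.full b hb hl
        have := binLoad_update_of_ne (n := n) (wt := wt) (u := u) (hjv ▸ hbv)
        omega
  | @relabel v hv hover hno =>
    refine ⟨h.lt, h.mem, fun i hi x hx hEx => ?_, fun b hb hl => ?_⟩
    · have h1 := h.steep i hi x hx hEx
      by_cases hpv : pos i = v
      · have h2 := hno i hi hpv x hx hEx
        rw [hpv] at h1 ⊢
        simp only [Function.update_self]
        by_cases hxv : x = v
        · subst hxv; simp only [Function.update_self]; omega
        · rw [Function.update_of_ne hxv]; omega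
      · rw [Function.update_of_ne hpv]
        by_cases hxv : x = v
        · subst hxv; simp only [Function.update_self]; omega
        · rw [Function.update_of_ne hxv]; omega
    · by_cases hbv : b = v
      · subst hbv; omega
      · rw [Function.update_of_ne hbv] at hl; exact h.full b hb hl

/-- A gap in the labels yields a full set. -/
theorem exists_fullSet (h : Labelled M n E wt cap wmax pos lab) {v : ℕ} (hv : v < M)
    (hover : cap v < binLoad n wt pos v) (hlab : M ≤ lab v) :
    ∃ S, FullSet M n E wt cap wmax pos S := by
  -- The label of `v` is at least `M`, and the other `M - 1` bins cannot take all `M` values below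
  -- `M`, so some level `l` is empty.
  obtain ⟨l, hl, hgap⟩ : ∃ l < M, ∀ b < M, lab b ≠ l := by
    by_contra! hcon
    have hsub : range M ⊆ ((range M).erase v).image lab := by
      intro l hl
      obtain ⟨b, hb, hbl⟩ := hcon l (mem_range.1 hl)
      refine mem_image.2 ⟨b, mem_erase.2 ⟨?_, mem_range.2 hb⟩, hbl⟩
      rintro rfl
      have := mem_range.1 hl
      omega
    have h1 := card_le_card hsub
    have h2 := card_image_le (s := (range M).erase v) (f := lab)
    rw [card_erase_of_mem (mem_range.2 hv)] at h2
    simp only [card_range] at h1 h2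
    omega
  -- The bins above the gap: the eligible bins of a job lie at most one level below it, hence not
  -- beyond an empty level, and bins with positive labels are full.
  refine ⟨(range M).filter fun b => l < lab b, ?_, h.mem, ?_, ?_, ?_⟩
  · intro b hb; simpa using (mem_filter.1 hb).1
  · intro j hj hjS u hu hE
    have h1 := (mem_filter.1 hjS).2
    have h2 := h.steep j hj u hu hE
    have h3 := hgap u hu
    refine mem_filter.2 ⟨mem_range.2 hu, ?_⟩
    omega
  · intro b hb
    have := mem_filter.1 hb
    exact h.full b (mem_range.1 this.1) (by omega)
  · exact ⟨v, mem_filter.2 ⟨mem_range.2 hv, by omega⟩, hover⟩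

/-- What has been achieved after `t` steps. -/
structure Progress (M n : ℕ) (E : ℕ → ℕ → Prop) (wt cap : ℕ → ℕ) (wmax : ℕ)
    (pos lab : ℕ → ℕ) (t : ℕ) : Prop where
  labelled : Labelled M n E wt cap wmax pos lab
  le : (∀ p S, ¬ FullSet M n E wt cap wmax p S) → ∀ b < M, lab b ≤ M
  count : (∀ b < M, binLoad n wt pos b ≤ cap b) ∨
    t + ∑ j ∈ range n, lab (pos j) ≤ (n + 1) * ∑ b ∈ range M, lab b

/-- A potential argument. A push lowers the sum of `lab (pos j)` by one, which pays for the step. A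
relabelling raises the right-hand side by `n + 1`, which pays for the step and for the at most `n`
jobs on the raised bin. A label could pass `M` only by raising an overloaded bin of label at least
`M`, which would yield a full set. -/
theorem Progress.step (hwt : ∀ j < n, wt j ≤ wmax) {t : ℕ}
    (h : Progress M n E wt cap wmax pos lab t)
    (hs : PushRelabel M n E wt cap pos lab pos' lab') :
    Progress M n E wt cap wmax pos' lab' (t + 1) := by
  refine ⟨h.labelled.step hwt hs, fun hno => ?_, ?_⟩
  · cases hs with
    | done _ => exact h.le hno
    | push => exact h.le hno
    | @relabel v hv hover _ =>
      intro b hb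
      by_cases hbv : b = v
      · subst hbv
        by_contra! hcon
        rw [Function.update_self] at hcon
        obtain ⟨S, hS⟩ := exists_fullSet h.labelled hb hover (by omega)
        exact hno _ _ hS
      · rw [Function.update_of_ne hbv]; exact h.le hno b hb
  · cases hs with
    | done hd => exact Or.inl hd
    | @push v j u hv hover hj hjv hu hE hlab =>
      right
      obtain hd | hc := h.count
      · exact absurd (hd v hv) (by omega)
      rw [← add_sum_erase _ _ (mem_range.2 hj)] at hc ⊢
      have : ∑ i ∈ (range n).erase j, lab (Function.update pos j u i) =
          ∑ i ∈ (range n).erase j, lab (pos i) := by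
        refine sum_congr rfl fun i hi => ?_
        rw [Function.update_of_ne (ne_of_mem_erase hi)]
      rw [this, Function.update_self]
      rw [hjv] at hc
      omega
    | @relabel v hv hover hno =>
      right
      obtain hd | hc := h.count
      · exact absurd (hd v hv) (by omega)
      have h1 : ∑ b ∈ range M, Function.update lab v (lab v + 1) b =
          ∑ b ∈ range M, lab b + 1 := by
        rw [← add_sum_erase _ _ (mem_range.2 hv), ← add_sum_erase _ lab (mem_range.2 hv),
          Function.update_self]
        have : ∑ b ∈ (range M).erase v, Function.update lab v (lab v + 1) b =
            ∑ b ∈ (range M).erase v, lab b := by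
          refine sum_congr rfl fun i hi => ?_
          rw [Function.update_of_ne (ne_of_mem_erase hi)]
        omega
      have h2 : ∑ j ∈ range n, Function.update lab v (lab v + 1) (pos j) ≤
          ∑ j ∈ range n, lab (pos j) + n := by
        calc _ ≤ ∑ j ∈ range n, (lab (pos j) + 1) := by
              refine sum_le_sum fun j _ => ?_
              by_cases hpv : pos j = v
              · rw [hpv, Function.update_self]
              · rw [Function.update_of_ne hpv]; omega
          _ = _ := by simp [sum_add_distrib]
      rw [h1, mul_add]
      omega

/-- With all labels at most `M`, the right-hand side of `count` is at most `(n + 1) * M²`, which `M²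
* (n + 2)` steps exceed as soon as there is a bin. -/
theorem Progress.done {t : ℕ} (h : Progress M n E wt cap wmax pos lab t)
    (hno : ∀ p S, ¬ FullSet M n E wt cap wmax p S) (ht : M * (M * (n + 2)) ≤ t) :
    ∀ b < M, binLoad n wt pos b ≤ cap b := by
  obtain hd | hc := h.count
  · exact hd
  · intro b hb
    exfalso
    have h1 : ∑ b ∈ range M, lab b ≤ M * M := by
      simpa using sum_le_card_nsmul (range M) lab M fun b hb => h.le hno b (mem_range.1 hb)
    have h2 := Nat.mul_le_mul_left (n + 1) h1
    have h3 : M * (M * (n + 2)) = (n + 1) * (M * M) + M * M := by ring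
    have h4 : 0 < M * M := Nat.mul_pos (by omega) (by omega)
    omega

end

/-- The load of a set of bins under one placement is at most the load of another set of bins under
another placement if the latter set receives all the jobs concerned. -/
theorem sum_binLoad_le {n : ℕ} {wt pos σ : ℕ → ℕ} {S S' : Finset ℕ}
    (h : ∀ j < n, pos j ∈ S → wt j ≠ 0 → σ j ∈ S') :
    ∑ b ∈ S, binLoad n wt pos b ≤ ∑ b ∈ S', binLoad n wt σ b := by
  unfold binLoad
  rw [sum_comm, sum_comm (s := S')]
  refine sum_le_sum fun j hj => ?_
  simp only [sum_ite_eq]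
  by_cases hS : pos j ∈ S
  · by_cases hw : wt j = 0
    · simp [hw]
    · simp [hS, h j (mem_range.1 hj) hS hw]
  · simp [hS]

end GraphBalancing

/-! ### Comparison of placements with an assignment of makespan at most T -/

namespace GraphBalancing

open Finset
open scoped Classical

/-! ### Two job sizes -/

theorem binLoad_linear {n : ℕ} {wt f g pos : ℕ → ℕ} {a b : ℕ}
    (h : ∀ j < n, wt j = a * f j + b * g j) (v : ℕ) :
    binLoad n wt pos v = a * binLoad n f pos v + b * binLoad n g pos v := by
  unfold binLoad
  rw [mul_sum, mul_sum, ← sum_add_distrib]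
  refine sum_congr rfl fun j hj => ?_
  split_ifs
  · exact h j (mem_range.1 hj)
  · simp

theorem binLoad_mono {n : ℕ} {f g pos : ℕ → ℕ} (h : ∀ j < n, f j ≤ g j) (v : ℕ) :
    binLoad n f pos v ≤ binLoad n g pos v := by
  refine sum_le_sum fun j hj => ?_
  split_ifs
  · exact h j (mem_range.1 hj)
  · exact le_rfl

theorem sum_binLoad {n : ℕ} {wt pos : ℕ → ℕ} {S : Finset ℕ} :
    ∑ b ∈ S, binLoad n wt pos b = ∑ j ∈ range n, if pos j ∈ S then wt j else 0 := by
  unfold binLoad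
  rw [sum_comm]
  simp only [sum_ite_eq]

/-- An instance with jobs and machines named by natural numbers. -/
structure Sched where
  m : ℕ
  n : ℕ
  W : ℕ
  w : ℕ
  dl : ℕ → ℕ
  hv : ℕ → Prop
  el : ℕ → ℕ → Prop
  w_pos : 0 < w
  two_w : 2 * w ≤ W
  el_lt : ∀ j v, el j v → v < m
  card_le : ∀ j, hv j → ∀ a b c, el j a → el j b → el j c → a ≠ b → c = a ∨ c = b

namespace Sched

variable (I : Sched)

/-- The weight of a job. -/
noncomputable def wt (j : ℕ) : ℕ := if I.hv j then I.W else I.w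

/-- The indicator function of the light jobs. -/
noncomputable def light (j : ℕ) : ℕ := if I.hv j then 0 else 1

/-- The indicator function of the heavy jobs. -/
noncomputable def heavy (j : ℕ) : ℕ := if I.hv j then 1 else 0

/-- An assignment of makespan at most `T`. -/
structure Fits (T : ℕ) (σ : ℕ → ℕ) : Prop where
  el : ∀ j < I.n, I.el j (σ j)
  le : ∀ v < I.m, I.dl v + binLoad I.n I.wt σ v ≤ T

/-- `comp` names the components of the graph whose edges are the heavy jobs. -/
structure IsComp (comp : ℕ → ℕ) : Prop where
  lt : ∀ v < I.m, comp v < I.m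
  edge : ∀ j < I.n, I.hv j → ∀ u v, I.el j u → I.el j v → comp u = comp v
  conn : ∀ S : Set ℕ, (∀ j < I.n, I.hv j → ∀ u v, I.el j u → I.el j v → (u ∈ S ↔ v ∈ S)) →
    ∀ x < I.m, ∀ y < I.m, comp x = comp y → (x ∈ S ↔ y ∈ S)

theorem binLoad_wt (σ : ℕ → ℕ) (v : ℕ) :
    binLoad I.n I.wt σ v = I.w * binLoad I.n I.light σ v + I.W * binLoad I.n I.heavy σ v :=
  binLoad_linear (fun j _ => by unfold wt light heavy; split_ifs <;> simp) v

variable {I} {T : ℕ} {σ comp : ℕ → ℕ}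

theorem Fits.le' (h : I.Fits T σ) {v : ℕ} (hv : v < I.m) :
    I.dl v + (I.w * binLoad I.n I.light σ v + I.W * binLoad I.n I.heavy σ v) ≤ T := by
  rw [← binLoad_wt]; exact h.le v hv

/-- Push and relabel succeeds if heavy jobs are small in comparison with the makespan. -/
theorem not_fullSet_of_two_mul_le (h : I.Fits T σ) {E : ℕ → ℕ → Prop}
    (hE : ∀ j < I.n, ∀ b < 2 * I.m, (E j b ↔ I.el j b)) {cap wt' : ℕ → ℕ}
    (hcap : ∀ v < I.m, cap v = T + I.W - 1 - I.dl v) (hwt : ∀ j < I.n, wt' j = I.wt j)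
    (pos : ℕ → ℕ) (S : Finset ℕ) : ¬ FullSet (2 * I.m) I.n E wt' cap I.W pos S := by
  intro hS
  have hload : ∀ b, binLoad I.n wt' pos b = binLoad I.n I.wt pos b :=
    binLoad_congr hwt fun _ _ => rfl
  -- Push and relabel always works with `2 * m` bins. Here no job is eligible for the upper half,
  -- which is therefore discarded.
  set S' := S.filter (· < I.m) with hS'
  have hsum : ∑ b ∈ S, binLoad I.n I.wt pos b ≤ ∑ b ∈ S', binLoad I.n I.wt σ b := by
    refine sum_binLoad_le fun j hj hjS _ => ?_
    have h1 := h.el j hj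
    have h2 := I.el_lt _ _ h1
    exact mem_filter.2 ⟨hS.closed j hj hjS _ (by omega) ((hE j hj _ (by omega)).2 h1), h2⟩
  have hsub : ∑ b ∈ S', binLoad I.n I.wt pos b ≤ ∑ b ∈ S, binLoad I.n I.wt pos b :=
    sum_le_sum_of_subset (filter_subset _ _)
  have hWpos : 0 < I.W := by have := I.w_pos; have := I.two_w; omega
  -- Being full means load at least `T - dl` on a machine, which `σ` does not exceed; the overloaded
  -- bin makes the inequality strict.
  have hlt : ∑ b ∈ S', binLoad I.n I.wt σ b < ∑ b ∈ S', binLoad I.n I.wt pos b := by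
    refine sum_lt_sum (fun v hv => ?_) ?_
    · obtain ⟨hvS, hvm⟩ := mem_filter.1 hv
      have h1 := hS.full v hvS
      have h2 := h.le v hvm
      rw [hcap v hvm, hload] at h1
      omega
    · obtain ⟨b, hb, hover⟩ := hS.exceeds
      have hbm : b < I.m := by
        by_contra hbm
        have : binLoad I.n wt' pos b = 0 := by
          refine sum_eq_zero fun j hj => ?_
          rw [if_neg]
          rintro rfl
          have hj' := mem_range.1 hj
          exact hbm (I.el_lt _ _ ((hE j hj' _ (hS.lt _ hb)).1 (hS.mem j hj')))
        omega
      refine ⟨b, mem_filter.2 ⟨hb, hbm⟩, ?_⟩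
      have h2 := h.le b hbm
      rw [hcap b hbm, hload] at hover
      omega
  omega

/-! #### Components of the heavy graph -/

/-- The machines that can take a heavy job. -/
def Able (I : Sched) (T v : ℕ) : Prop := I.dl v + I.W ≤ T

/-- The machines of a component. -/
noncomputable def part (I : Sched) (comp : ℕ → ℕ) (r : ℕ) : Finset ℕ :=
  (range I.m).filter fun v => comp v = r

/-- The heavy jobs of a component. -/
noncomputable def edges (I : Sched) (comp : ℕ → ℕ) (r : ℕ) : Finset ℕ :=
  (range I.n).filter fun j => I.hv j ∧ ∃ v, I.el j v ∧ comp v = r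

/-- The machines of a component that can take a heavy job. -/
noncomputable def ablePart (I : Sched) (T : ℕ) (comp : ℕ → ℕ) (r : ℕ) : Finset ℕ :=
  (I.part comp r).filter fun v => I.Able T v

/-- Grow `S` from `x` by one machine at a time. Connectivity supplies a heavy job with one end
inside and the other end outside; once the outer end is added, this job no longer reaches outside,
as it has at most two machines. So every missing machine accounts for a job of its own. The case `S
= {x}` is the usual bound for connected graphs; the general case serves to spare a machine of a
tree. -/
theorem IsComp.card_sdiff_le (hc : I.IsComp comp) {r x : ℕ} (hx : x ∈ I.part comp r) :
    ∀ S : Finset ℕ, x ∈ S → (I.part comp r \ S).card ≤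
      ((I.edges comp r).filter fun j => ∃ v, I.el j v ∧ v ∉ S).card := by
  suffices H : ∀ k, ∀ S : Finset ℕ, x ∈ S → (I.part comp r \ S).card = k → k ≤
      ((I.edges comp r).filter fun j => ∃ v, I.el j v ∧ v ∉ S).card from
    fun S hS => H _ S hS rfl
  intro k
  induction k with
  | zero => intro S _ _; exact Nat.zero_le _
  | succ k ih =>
    intro S hxS hk
    obtain ⟨hxm, hxr⟩ := mem_filter.1 hx
    obtain ⟨y, hy⟩ := card_pos.1 (show 0 < (I.part comp r \ S).card by omega)
    obtain ⟨hyK, hyS⟩ := mem_sdiff.1 hy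
    obtain ⟨hym, hyr⟩ := mem_filter.1 hyK
    -- Otherwise the part of `S` in this component would respect all heavy jobs, and `conn` would
    -- carry membership from `x` to `y`.
    obtain ⟨j, hj, hjh, u, v, hu, hv, huS, huK, hvS⟩ : ∃ j < I.n, I.hv j ∧ ∃ u v, I.el j u ∧
        I.el j v ∧ u ∈ S ∧ u ∈ I.part comp r ∧ v ∉ S := by
      by_contra! hcon
      have key : ∀ j < I.n, I.hv j → ∀ u v, I.el j u → I.el j v →
          u ∈ S ∧ u ∈ I.part comp r → v ∈ S ∧ v ∈ I.part comp r := by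
        intro j hj hjh u v hu hv hu'
        refine ⟨hcon j hj hjh u v hu hv hu'.1 hu'.2, ?_⟩
        have := hc.edge j hj hjh u v hu hv
        exact mem_filter.2 ⟨mem_range.2 (I.el_lt _ _ hv), this ▸ (mem_filter.1 hu'.2).2⟩
      have := (hc.conn {u | u ∈ S ∧ u ∈ I.part comp r}
        (fun j hj hjh u v hu hv => ⟨key j hj hjh u v hu hv, key j hj hjh v u hv hu⟩) x
        (mem_range.1 hxm) y (mem_range.1 hym) (hxr.trans hyr.symm)).1 ⟨hxS, hx⟩
      exact hyS this.1
    have hvr : comp v = r := by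
      rw [← hc.edge j hj hjh u v hu hv]; exact (mem_filter.1 huK).2
    have hvK : v ∈ I.part comp r := mem_filter.2 ⟨mem_range.2 (I.el_lt _ _ hv), hvr⟩
    have h1 : (I.part comp r \ insert v S).card = k := by
      have : I.part comp r \ insert v S = (I.part comp r \ S).erase v := by
        ext a; simp only [mem_sdiff, mem_insert, mem_erase]; tauto
      rw [this, card_erase_of_mem (mem_sdiff.2 ⟨hvK, hvS⟩), hk]; rfl
    have h2 := ih (insert v S) (mem_insert_of_mem hxS) h1
    have huv : u ≠ v := by rintro rfl; exact hvS huS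
    refine lt_of_le_of_lt h2 (card_lt_card ?_)
    refine (ssubset_iff_of_subset ?_).2 ⟨j, ?_, ?_⟩
    · intro i hi
      obtain ⟨hi1, a, ha, haS⟩ := mem_filter.1 hi
      exact mem_filter.2 ⟨hi1, a, ha, fun h => haS (mem_insert_of_mem h)⟩
    · exact mem_filter.2 ⟨mem_filter.2 ⟨mem_range.2 hj, hjh, v, hv, hvr⟩, v, hv, hvS⟩
    · intro hmem
      obtain ⟨-, a, ha, haS⟩ := mem_filter.1 hmem
      obtain rfl | rfl := I.card_le j hjh u v a hu hv ha huv
      · exact haS (mem_insert_of_mem huS)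
      · exact haS (mem_insert_self _ _)

theorem IsComp.card_part_le (hc : I.IsComp comp) {r x : ℕ} (hx : x ∈ I.part comp r) :
    (I.part comp r).card ≤ (I.edges comp r).card + 1 := by
  have h1 := hc.card_sdiff_le hx {x} (mem_singleton_self x)
  have h2 := card_filter_le (I.edges comp r) fun j => ∃ v, I.el j v ∧ v ∉ ({x} : Finset ℕ)
  rw [card_sdiff_of_subset (singleton_subset_iff.2 hx), card_singleton] at h1
  omega

/-- Two heavy jobs weigh `2 * W > T`, and on a machine that is not able even one is too much. -/
theorem heavy_le_one (h : I.Fits T σ) (hT : T < 2 * I.W) {v : ℕ} (hv : v < I.m) :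
    binLoad I.n I.heavy σ v ≤ if I.Able T v then 1 else 0 := by
  have h1 := h.le' hv
  have h2 : I.W * binLoad I.n I.heavy σ v ≤ T := by omega
  have h3 : binLoad I.n I.heavy σ v < 2 := by
    by_contra! hcon
    have := Nat.mul_le_mul_left I.W hcon
    omega
  split_ifs with hA
  · omega
  · by_contra! hcon
    have h4 : binLoad I.n I.heavy σ v = 1 := by omega
    rw [h4] at h1
    exact hA (by unfold Able; omega)

/-- All machines of a heavy job lie in the same component, so the choice among them does not affect
the count. -/
theorem IsComp.sum_heavy (hc : I.IsComp comp) (h : ∀ j < I.n, I.hv j → I.el j (σ j)) (r : ℕ) :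
    ∑ v ∈ I.part comp r, binLoad I.n I.heavy σ v = (I.edges comp r).card := by
  rw [sum_binLoad, edges, card_filter]
  refine sum_congr rfl fun j hj => ?_
  have hj' := mem_range.1 hj
  unfold heavy
  by_cases hjh : I.hv j
  · have he := h j hj' hjh
    have : σ j ∈ I.part comp r ↔ ∃ v, I.el j v ∧ comp v = r := by
      constructor
      · intro hm; exact ⟨_, he, (mem_filter.1 hm).2⟩
      · rintro ⟨v, hv, hvr⟩
        exact mem_filter.2 ⟨mem_range.2 (I.el_lt _ _ he), hc.edge j hj' hjh _ _ he hv ▸ hvr⟩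
    simp [hjh, this]
  · simp [hjh]

theorem card_ablePart (I : Sched) (T : ℕ) (comp : ℕ → ℕ) (r : ℕ) :
    (I.ablePart T comp r).card = ∑ v ∈ I.part comp r, if I.Able T v then 1 else 0 := by
  rw [ablePart, card_filter]

/-- Able machines take at most one edge each, the others none; an able machine without an edge makes
the count strict. Thus a free able machine of `σ` certifies that its component has a pool. -/
theorem IsComp.card_edges_lt (hc : I.IsComp comp) (h : I.Fits T σ) (hT : T < 2 * I.W) {v : ℕ}
    (hv : v < I.m) (hA : I.Able T v) (h0 : binLoad I.n I.heavy σ v = 0) :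
    (I.edges comp (comp v)).card < (I.ablePart T comp (comp v)).card := by
  rw [← hc.sum_heavy (fun j hj _ => h.el j hj), card_ablePart]
  refine sum_lt_sum (fun u hu => heavy_le_one h hT (mem_range.1 (mem_filter.1 hu).1)) ?_
  exact ⟨v, mem_filter.2 ⟨mem_range.2 hv, rfl⟩, by simp [h0, hA]⟩

/-- Connectivity squeezes the number of able machines: it exceeds the number of edges, which is at
least the number of all machines minus one. -/
theorem IsComp.able_of_card_lt (hc : I.IsComp comp) {r : ℕ}
    (hlt : (I.edges comp r).card < (I.ablePart T comp r).card) {v : ℕ}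
    (hv : v ∈ I.part comp r) : I.Able T v := by
  have h1 := hc.card_part_le hv
  have h2 : I.ablePart T comp r = I.part comp r :=
    eq_of_subset_of_card_le (filter_subset _ _) (by omega)
  rw [← h2] at hv
  exact (mem_filter.1 hv).2

/-- With two free machines, the component would have at least two fewer edges than machines and
could not be connected. This is why one pool need only serve one machine. -/
theorem IsComp.free_unique (hc : I.IsComp comp) (h : I.Fits T σ) (hT : T < 2 * I.W) {u v : ℕ}
    (hu : u < I.m) (hv : v < I.m) (huv : comp u = comp v)
    (hu0 : binLoad I.n I.heavy σ u = 0) (hv0 : binLoad I.n I.heavy σ v = 0) : u = v := by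
  by_contra hne
  have hvK : v ∈ I.part comp (comp v) := mem_filter.2 ⟨mem_range.2 hv, rfl⟩
  have huK : u ∈ (I.part comp (comp v)).erase v :=
    mem_erase.2 ⟨hne, mem_filter.2 ⟨mem_range.2 hu, huv⟩⟩
  have h1 := hc.card_part_le hvK
  have h2 := hc.sum_heavy (fun j hj _ => h.el j hj) (comp v)
  rw [← add_sum_erase _ _ hvK, ← add_sum_erase _ _ huK, hu0, hv0] at h2
  have h3 : ∑ x ∈ ((I.part comp (comp v)).erase v).erase u, binLoad I.n I.heavy σ x ≤
      ∑ x ∈ ((I.part comp (comp v)).erase v).erase u, 1 := by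
    refine sum_le_sum fun x hx => ?_
    have := heavy_le_one h hT (v := x)
      (mem_range.1 (mem_filter.1 (mem_of_mem_erase (mem_of_mem_erase hx))).1)
    split_ifs at this <;> omega
  have h4 := card_erase_of_mem huK
  have h5 := card_erase_of_mem hvK
  have h6 : 0 < ((I.part comp (comp v)).erase v).card := card_pos.2 ⟨u, huK⟩
  rw [sum_const, smul_eq_mul, mul_one] at h3
  omega

/-! #### Light jobs -/

/-- The bins of light jobs are the machines and, for every component, a pool. -/
def PoolEl (I : Sched) (comp : ℕ → ℕ) (j b : ℕ) : Prop :=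
  I.el j b ∨ ∃ v, I.el j v ∧ I.m + comp v = b

/-- The capacities of the machines and pools for light jobs. -/
structure PoolCap (I : Sched) (T : ℕ) (comp : ℕ → ℕ) (q x : ℕ) (cap : ℕ → ℕ) : Prop where
  x_eq : x = q * I.w
  x_le : x ≤ I.W / 2
  x_max : I.W / 2 < x + I.w ∨ q = I.n
  able : ∀ v < I.m, I.Able T v → cap v = T + I.W / 2 - (I.dl v + I.W + x)
  not_able : ∀ v < I.m, ¬ I.Able T v → cap v = T - I.dl v
  pool : ∀ r < I.m, (I.edges comp r).card < (I.ablePart T comp r).card →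
    cap (I.m + r) = x + x + I.w
  no_pool : ∀ r < I.m, ¬ (I.edges comp r).card < (I.ablePart T comp r).card →
    cap (I.m + r) = 0

theorem light_le (I : Sched) (pos : ℕ → ℕ) (b : ℕ) : binLoad I.n I.light pos b ≤ I.n := by
  calc binLoad I.n I.light pos b ≤ ∑ j ∈ range I.n, 1 := by
        refine sum_le_sum fun j _ => ?_
        unfold light; split_ifs <;> simp
    _ = I.n := by simp

/-- The count that explains the capacities. From `σ` a target `g` is formed: the light jobs of `σ`
stay on the machines of `S'`, except that up to `2 * q + 1` of them move from each machine in `F` to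
the pool of its component. The target respects all capacities. All weights being multiples of `w`,
fullness gives `g ≤ N` on `S`, strictly somewhere, whereas closedness of `S` gives the opposite
inequality for the sums. -/
theorem not_fullSet_light (hc : I.IsComp comp) (h : I.Fits T σ) (hT : T < 2 * I.W)
    {E : ℕ → ℕ → Prop} (hE : ∀ j < I.n, ∀ b < 2 * I.m, (E j b ↔ I.PoolEl comp j b))
    {cap wt' : ℕ → ℕ} {q x : ℕ} (hcap : I.PoolCap T comp q x cap)
    (hwt : ∀ j < I.n, wt' j = I.w * I.light j)
    (pos : ℕ → ℕ) (S : Finset ℕ) : ¬ FullSet (2 * I.m) I.n E wt' cap I.w pos S := by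
  intro hS
  set N := binLoad I.n I.light pos
  set N' := binLoad I.n I.light σ
  have hload : ∀ b, binLoad I.n wt' pos b = N b * I.w := fun b => by
    rw [binLoad_linear (f := I.light) (g := I.light) (a := I.w) (b := 0)
      (fun j hj => by rw [hwt j hj]; simp)]
    simp only [N]; ring
  -- Where `σ` puts the light jobs of `S`: by closedness both the machine `σ j` and the pool of its
  -- component lie in `S`.
  set S' := S.filter fun v => v < I.m ∧ I.m + comp v ∈ S with hS'
  set F := S'.filter fun v => I.Able T v ∧ binLoad I.n I.heavy σ v = 0 with hF
  set P := F.image fun v => I.m + comp v with hP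
  have hsum : ∑ b ∈ S, N b ≤ ∑ b ∈ S', N' b := by
    refine sum_binLoad_le fun j hj hjS _ => ?_
    have h1 := h.el j hj
    have h2 := I.el_lt _ _ h1
    have h3 := hc.lt _ h2
    exact mem_filter.2 ⟨hS.closed j hj hjS _ (by omega) ((hE j hj _ (by omega)).2 (Or.inl h1)), h2,
      hS.closed j hj hjS _ (by omega) ((hE j hj _ (by omega)).2 (Or.inr ⟨_, h1, rfl⟩))⟩
  -- The subtraction truncates if a machine has fewer than `2 * q + 1` light jobs, but its pool is
  -- charged in full, so the total never decreases.
  let g : ℕ → ℕ := fun b => (if b ∈ S' then N' b - (if b ∈ F then 2 * q + 1 else 0) else 0) +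
    (if b ∈ P then 2 * q + 1 else 0)
  have hS'm : ∀ v ∈ S', v < I.m := fun v hv => (mem_filter.1 hv).2.1
  have hPS : P ⊆ S := by
    intro b hb
    obtain ⟨v, hv, rfl⟩ := mem_image.1 hb
    exact (mem_filter.1 (mem_filter.1 hv).1).2.2
  -- No two machines of `F` share a component, so no pool is charged twice.
  have hinj : Set.InjOn (fun v => I.m + comp v) F := by
    intro u hu v hv huv
    obtain ⟨hu1, -, hu0⟩ := mem_filter.1 (mem_coe.1 hu)
    obtain ⟨hv1, -, hv0⟩ := mem_filter.1 (mem_coe.1 hv)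
    exact hc.free_unique h hT (hS'm u hu1) (hS'm v hv1) (Nat.add_left_cancel huv) hu0 hv0
  have hgsum : ∑ b ∈ S', N' b ≤ ∑ b ∈ S, g b := by
    have hS'S : S' ⊆ S := filter_subset _ _
    have hFS' : F ⊆ S' := filter_subset _ _
    simp only [g]
    rw [sum_add_distrib, sum_ite_mem, sum_ite_mem, inter_eq_right.2 hS'S, inter_eq_right.2 hPS]
    have h1 : ∑ b ∈ P, (2 * q + 1) = ∑ b ∈ S', if b ∈ F then 2 * q + 1 else 0 := by
      rw [sum_ite_mem, inter_eq_right.2 hFS', sum_const, sum_const, hP, card_image_of_injOn hinj]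
    rw [h1, ← sum_add_distrib]
    exact sum_le_sum fun b _ => by omega
  have hgcap : ∀ b ∈ S, g b * I.w ≤ cap b := by
    intro b hb
    have hxq := hcap.x_eq
    have hxl := hcap.x_le
    have hexp : (2 * q + 1) * I.w = x + x + I.w := by rw [hxq]; ring
    by_cases hbm : b < I.m
    · have hbP : b ∉ P := by
        intro hbP
        obtain ⟨v, -, rfl⟩ := mem_image.1 hbP
        omega
      have h1 := h.le' hbm
      simp only [g, hbP, if_false, add_zero]
      split_ifs with hbS' hbF
      · obtain ⟨-, hA, h0⟩ := mem_filter.1 hbF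
        rw [hcap.able b hbm hA]
        unfold Able at hA
        -- More than `2 * q + 1` jobs exclude `q = n`, so `W / 2 < x + w`. Hence removing weight `2
        -- * x + w` is enough: `W + x ≤ W / 2 + (2 * x + w)`.
        by_cases hle : N' b ≤ 2 * q + 1
        · simp [Nat.sub_eq_zero_of_le hle]
        · have hq : I.W / 2 < x + I.w := by
            refine hcap.x_max.resolve_right fun hqn => hle ?_
            have := light_le I σ b
            change N' b ≤ I.n at this
            omega
          rw [Nat.sub_mul, hexp]
          have h2 : N' b * I.w = I.w * N' b := mul_comm _ _
          change I.dl b + (I.w * N' b + _) ≤ T at h1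
          omega
      · have h2 : N' b * I.w = I.w * N' b := mul_comm _ _
        change I.dl b + (I.w * N' b + _) ≤ T at h1
        rw [Nat.sub_zero]
        by_cases hA : I.Able T b
        -- Outside `F` an able machine has a heavy job under `σ`, so its light jobs weigh at most `T
        -- - dl - W`, which is within the capacity as `x ≤ W / 2`.
        · have h0 : binLoad I.n I.heavy σ b ≠ 0 := fun h0 => hbF (mem_filter.2 ⟨hbS', hA, h0⟩)
          have h3 := Nat.mul_le_mul_left I.W (Nat.one_le_iff_ne_zero.2 h0)
          rw [hcap.able b hbm hA]
          omega
        · rw [hcap.not_able b hbm hA]; omega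
      · simp
    · have hbS' : b ∉ S' := fun hbS' => hbm (hS'm b hbS')
      simp only [g, hbS', if_false, zero_add]
      split_ifs with hbP
      · obtain ⟨v, hv, rfl⟩ := mem_image.1 hbP
        obtain ⟨hv1, hA, h0⟩ := mem_filter.1 hv
        rw [hcap.pool _ (hc.lt v (hS'm v hv1)) (hc.card_edges_lt h hT (hS'm v hv1) hA h0), hexp]
      · simp
  have hlt : ∑ b ∈ S, g b < ∑ b ∈ S, N b := by
    refine sum_lt_sum (fun b hb => ?_) ?_
    · have h1 := hS.full b hb
      rw [hload] at h1
      have h2 := hgcap b hb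
      have h3 : g b * I.w < (N b + 1) * I.w := by
        have : (N b + 1) * I.w = N b * I.w + I.w := by ring
        omega
      exact Nat.lt_succ_iff.1 (Nat.lt_of_mul_lt_mul_right h3)
    · obtain ⟨b, hb, hover⟩ := hS.exceeds
      rw [hload] at hover
      exact ⟨b, hb, Nat.lt_of_mul_lt_mul_right (lt_of_le_of_lt (hgcap b hb) hover)⟩
  omega

/-- The light jobs have been placed into machines and pools, and those in pools are moved on to
machines. -/
structure LightPlaced (I : Sched) (cap comp pos sol : ℕ → ℕ) : Prop where
  le : ∀ b < 2 * I.m, I.w * binLoad I.n I.light pos b ≤ cap b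
  lt : ∀ j < I.n, sol j < I.m
  eq : ∀ j < I.n, pos j = sol j ∨ pos j = I.m + comp (sol j)

/-- The indicator function of the light jobs in pools. -/
noncomputable def pooled (I : Sched) (comp pos sol : ℕ → ℕ) (j : ℕ) : ℕ :=
  if I.hv j then 0 else if pos j = I.m + comp (sol j) then 1 else 0

section

variable {cap pos sol : ℕ → ℕ} {q x : ℕ}

theorem LightPlaced.light_le (hp : I.LightPlaced cap comp pos sol) (v : ℕ) :
    binLoad I.n I.light sol v ≤
      binLoad I.n I.light pos v + binLoad I.n (I.pooled comp pos sol) sol v := by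
  unfold binLoad
  rw [← sum_add_distrib]
  refine sum_le_sum fun j hj => ?_
  unfold light pooled
  have := hp.eq j (mem_range.1 hj)
  by_cases h1 : sol j = v
  · by_cases h2 : I.hv j
    · simp [h2]
    · obtain h3 | h3 := this
      · simp [h1, h2, h3]
      · simp [h1, h2, h3]
  · simp [h1]

/-- A pooled job stays in the component of its pool, so all pooled jobs on `K` come from pool `r`.
-/
theorem LightPlaced.sum_pooled_le (hp : I.LightPlaced cap comp pos sol) {r : ℕ}
    (hr : r < I.m) (K : Finset ℕ) (hK : K ⊆ I.part comp r) :
    I.w * ∑ v ∈ K, binLoad I.n (I.pooled comp pos sol) sol v ≤ cap (I.m + r) := by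
  refine le_trans (Nat.mul_le_mul_left _ ?_) (hp.le (I.m + r) (by omega))
  calc _ ≤ ∑ b ∈ {I.m + r}, binLoad I.n (I.pooled comp pos sol) pos b := by
        refine sum_binLoad_le fun j hj hjK hj0 => ?_
        have h1 := (mem_filter.1 (hK hjK)).2
        unfold pooled at hj0
        split_ifs at hj0 with h2 h3
        · exact absurd rfl hj0
        · rw [mem_singleton, h3, h1]
        · exact absurd rfl hj0
    _ ≤ _ := by
        rw [sum_singleton]
        refine binLoad_mono (fun j _ => ?_) _
        unfold pooled light
        split_ifs <;> simp

/-- A machine that could take a heavy job if it had fewer light jobs. -/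
def Rich (I : Sched) (T : ℕ) (sol : ℕ → ℕ) (v : ℕ) : Prop :=
  I.Able T v ∧ T + I.W / 2 < I.dl v + I.w * binLoad I.n I.light sol v + I.W

/-- The machine's own capacity keeps `W + x` free below `T + W / 2`, so being rich takes more than
`x = q * w` of pooled weight. -/
theorem LightPlaced.lt_pooled (hcap : I.PoolCap T comp q x cap)
    (hp : I.LightPlaced cap comp pos sol) {v : ℕ} (hv : v < I.m) (hr : I.Rich T sol v) :
    q < binLoad I.n (I.pooled comp pos sol) sol v := by
  obtain ⟨hA, hr⟩ := hr
  have h1 := hp.le v (by omega)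
  rw [hcap.able v hv hA] at h1
  have h2 := Nat.mul_le_mul_left I.w (hp.light_le v)
  rw [mul_add] at h2
  have h3 := hcap.x_eq
  have h4 := hcap.x_le
  unfold Able at hA
  have h5 : I.w * q < I.w * binLoad I.n (I.pooled comp pos sol) sol v := by
    rw [mul_comm I.w q]; omega
  exact Nat.lt_of_mul_lt_mul_left h5

/-- Otherwise the pool has capacity `0` and cannot hold a job of weight `w > 0`. -/
theorem LightPlaced.pool_of_pooled (hc : I.IsComp comp) (hcap : I.PoolCap T comp q x cap)
    (hp : I.LightPlaced cap comp pos sol) {v : ℕ} (hv : v < I.m)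
    (h0 : 0 < binLoad I.n (I.pooled comp pos sol) sol v) :
    (I.edges comp (comp v)).card < (I.ablePart T comp (comp v)).card := by
  by_contra hno
  have h1 := hp.sum_pooled_le (hc.lt v hv) {v}
    (singleton_subset_iff.2 (mem_filter.2 ⟨mem_range.2 hv, rfl⟩))
  rw [hcap.no_pool _ (hc.lt v hv) hno, sum_singleton] at h1
  have := Nat.mul_pos I.w_pos h0
  omega

/-- Two rich machines need at least `2 * q + 2` pooled jobs, and the pool holds at most `2 * q + 1`.
-/
theorem LightPlaced.rich_unique (hc : I.IsComp comp) (hcap : I.PoolCap T comp q x cap)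
    (hp : I.LightPlaced cap comp pos sol) {u v : ℕ} (hu : u < I.m) (hv : v < I.m)
    (huv : comp u = comp v) (hru : I.Rich T sol u) (hrv : I.Rich T sol v) : u = v := by
  by_contra hne
  have h1 := hp.lt_pooled hcap hu hru
  have h2 := hp.lt_pooled hcap hv hrv
  have h3 := hp.sum_pooled_le (hc.lt v hv) {u, v} (by
    intro a ha
    rw [mem_insert, mem_singleton] at ha
    obtain rfl | rfl := ha
    · exact mem_filter.2 ⟨mem_range.2 hu, huv⟩
    · exact mem_filter.2 ⟨mem_range.2 hv, rfl⟩)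
  rw [sum_pair hne, hcap.pool _ (hc.lt v hv) (hp.pool_of_pooled hc hcap hv (by omega)),
    hcap.x_eq] at h3
  have h4 := Nat.mul_le_mul_left I.w (Nat.add_le_add h1 h2)
  have h5 : I.w * (q.succ + q.succ) = q * I.w + q * I.w + I.w + I.w := by
    simp only [Nat.succ_eq_add_one]; ring
  have := I.w_pos
  omega

/-! #### Heavy jobs -/

/-- With unit weights, full means that the capacity `0` or `1` is reached. A contradiction is found
inside the component of an overloaded machine. If no machine of `S` there is rich, the heavy jobs of
`σ` respect the capacities and can be compared. If `ρ` is rich, the component has a pool, and the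
jobs confined to `S` are few enough for the machines other than `ρ`. -/
theorem not_fullSet_heavy (hc : I.IsComp comp) (h : I.Fits T σ) (hT : T < 2 * I.W)
    (hcap : I.PoolCap T comp q x cap) (hp : I.LightPlaced cap comp pos sol)
    {E : ℕ → ℕ → Prop} (hE : ∀ j < I.n, ∀ b < 2 * I.m, (E j b ↔ I.el j b)) {cap2 wt' : ℕ → ℕ}
    (hcap2 : ∀ v < I.m, cap2 v =
      if I.dl v + I.w * binLoad I.n I.light sol v + I.W ≤ T + I.W / 2 then 1 else 0)
    (hwt : ∀ j < I.n, wt' j = I.heavy j)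
    (pos2 : ℕ → ℕ) (S : Finset ℕ) : ¬ FullSet (2 * I.m) I.n E wt' cap2 1 pos2 S := by
  intro hS
  have hload : ∀ b, binLoad I.n wt' pos2 b = binLoad I.n I.heavy pos2 b :=
    binLoad_congr hwt fun _ _ => rfl
  have hcap2' : ∀ v < I.m, I.Able T v → ¬ I.Rich T sol v → cap2 v = 1 := by
    intro v hv hA hr
    rw [hcap2 v hv, if_pos]
    by_contra hcon
    exact hr ⟨hA, by omega⟩
  obtain ⟨b, hb, hover⟩ := hS.exceeds
  have hbm : b < I.m := by
    by_contra hbm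
    have : binLoad I.n wt' pos2 b = 0 := by
      refine sum_eq_zero fun j hj => ?_
      rw [if_neg]
      rintro rfl
      have hj' := mem_range.1 hj
      exact hbm (I.el_lt _ _ ((hE j hj' _ (hS.lt _ hb)).1 (hS.mem j hj')))
    omega
  set r := comp b with hr
  set K := I.part comp r with hK
  set Sr := S ∩ K with hSr
  have hbSr : b ∈ Sr := mem_inter.2 ⟨hb, mem_filter.2 ⟨mem_range.2 hbm, rfl⟩⟩
  have hSrm : ∀ v ∈ Sr, v < I.m ∧ comp v = r := fun v hv => by
    obtain ⟨h1, h2⟩ := mem_filter.1 (mem_inter.1 hv).2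
    exact ⟨mem_range.1 h1, h2⟩
  have hlt : ∑ v ∈ Sr, cap2 v < ∑ v ∈ Sr, binLoad I.n I.heavy pos2 v := by
    refine sum_lt_sum (fun v hv => ?_) ⟨b, hbSr, hload b ▸ hover⟩
    have := hS.full v (mem_inter.1 hv).1
    rw [hload] at this
    omega
  have hel : ∀ j < I.n, pos2 j ∈ S → I.el j (pos2 j) := fun j hj hjS =>
    (hE j hj _ (hS.lt _ hjS)).1 (hS.mem j hj)
  have hclosed : ∀ j < I.n, pos2 j ∈ S → ∀ v, I.el j v → v ∈ S := fun j hj hjS v hv => by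
    have := I.el_lt _ _ hv
    exact hS.closed j hj hjS v (by omega) ((hE j hj v (by omega)).2 hv)
  by_cases hrich : ∃ ρ ∈ Sr, I.Rich T sol ρ
  · obtain ⟨ρ, hρ, hρr⟩ := hrich
    obtain ⟨hρm, hρc⟩ := hSrm ρ hρ
    have hpool := hp.pool_of_pooled hc hcap hρm (by have := hp.lt_pooled hcap hρm hρr; omega)
    rw [hρc] at hpool
    have hρK : ρ ∈ K := (mem_inter.1 hρ).2
    -- Jobs on `Sr` have all their machines in `S`. At least `|K \ S|` edges reach outside, and
    -- there are fewer than `|K|` edges in all, so fewer than `|Sr|` are confined to `S`.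
    have h1 := hc.card_sdiff_le hρK S (mem_inter.1 hρ).1
    rw [← hK] at h1
    have h2 : ∑ v ∈ Sr, binLoad I.n I.heavy pos2 v ≤
        ((I.edges comp r).filter fun j => ¬ ∃ v, I.el j v ∧ v ∉ S).card := by
      rw [sum_binLoad]
      have : ∀ j ∈ range I.n, (if pos2 j ∈ Sr then I.heavy j else 0) =
          if pos2 j ∈ Sr ∧ I.hv j then 1 else 0 := by
        intro j _
        unfold heavy
        by_cases h1 : pos2 j ∈ Sr <;> by_cases h2 : I.hv j <;> simp [h1, h2]
      rw [sum_congr rfl this, ← card_filter]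
      refine card_le_card fun j hj => ?_
      obtain ⟨hj1, hj2, hj3⟩ := mem_filter.1 hj
      have hj' := mem_range.1 hj1
      have hjS := (mem_inter.1 hj2).1
      refine mem_filter.2 ⟨mem_filter.2 ⟨hj1, hj3, _, hel j hj' hjS, (hSrm _ hj2).2⟩, ?_⟩
      rintro ⟨v, hv, hvS⟩
      exact hvS (hclosed j hj' hjS v hv)
    have h3 := card_filter_add_card_filter_not (s := I.edges comp r) fun j => ∃ v, I.el j v ∧ v ∉ S
    have h4 : (I.ablePart T comp r).card ≤ K.card := card_filter_le _ _
    have h5 : (K \ S).card + Sr.card = K.card := by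
      rw [hSr, inter_comm]; exact card_sdiff_add_card_inter K S
    -- All machines of a component with a pool are able, and none but `ρ` is rich, so all others
    -- have capacity one.
    have h6 : Sr.card ≤ ∑ v ∈ Sr, cap2 v + 1 := by
      rw [← add_sum_erase _ _ hρ]
      have : ∑ v ∈ Sr.erase ρ, cap2 v = ∑ v ∈ Sr.erase ρ, 1 := by
        refine sum_congr rfl fun v hv => ?_
        obtain ⟨hne, hv⟩ := mem_erase.1 hv
        obtain ⟨hvm, hvc⟩ := hSrm v hv
        refine hcap2' v hvm (hc.able_of_card_lt hpool (mem_inter.1 hv).2) fun hvr => hne ?_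
        exact hp.rich_unique hc hcap hvm hρm (hvc.trans hρc.symm) hvr hρr
      rw [this, sum_const, smul_eq_mul, mul_one, card_erase_of_mem hρ]
      omega
    omega
  · push Not at hrich
    have h1 : ∑ v ∈ Sr, binLoad I.n I.heavy pos2 v ≤ ∑ v ∈ Sr, binLoad I.n I.heavy σ v := by
      refine sum_binLoad_le fun j hj hjS hj0 => ?_
      have hjh : I.hv j := by
        by_contra hjh
        exact hj0 (by simp [heavy, hjh])
      have hjS' := (mem_inter.1 hjS).1
      have he := h.el j hj
      refine mem_inter.2 ⟨hclosed j hj hjS' _ he, mem_filter.2 ⟨mem_range.2 (I.el_lt _ _ he), ?_⟩⟩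
      rw [hc.edge j hj hjh _ _ he (hel j hj hjS')]
      exact (hSrm _ hjS).2
    have h2 : ∑ v ∈ Sr, binLoad I.n I.heavy σ v ≤ ∑ v ∈ Sr, cap2 v := by
      refine sum_le_sum fun v hv => ?_
      have h3 := heavy_le_one h hT (hSrm v hv).1
      split_ifs at h3 with hA
      · rw [hcap2' v (hSrm v hv).1 hA (hrich v hv)]; exact h3
      · omega
    omega

/-- The two placements together are short. -/
theorem load_le_of_placed (hc : I.IsComp comp) (h : I.Fits T σ)
    (hcap : I.PoolCap T comp q x cap) (hp : I.LightPlaced cap comp pos sol)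
    {pos2 : ℕ → ℕ} {v : ℕ} (hv : v < I.m)
    (hle : binLoad I.n I.heavy pos2 v ≤
      if I.dl v + I.w * binLoad I.n I.light sol v + I.W ≤ T + I.W / 2 then 1 else 0) :
    I.W * (I.dl v + (I.w * binLoad I.n I.light sol v + I.W * binLoad I.n I.heavy pos2 v)) ≤
      (I.W + I.W / 2) * T := by
  have hfit := h.le' hv
  have h1 := hp.le v (by omega)
  have h2 := Nat.mul_le_mul_left I.w (hp.light_le v)
  rw [mul_add] at h2
  -- Components with pools consist of able machines, so a machine that is not able has received no
  -- pooled jobs.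
  have hnot : ¬ I.Able T v → I.dl v + I.w * binLoad I.n I.light sol v ≤ T := by
    intro hA
    have h0 : binLoad I.n (I.pooled comp pos sol) sol v = 0 := by
      by_contra h0
      exact hA (hc.able_of_card_lt (hp.pool_of_pooled hc hcap hv (Nat.pos_of_ne_zero h0))
        (mem_filter.2 ⟨mem_range.2 hv, rfl⟩))
    rw [hcap.not_able v hv hA] at h1
    rw [h0] at h2
    omega
  -- If `T < W`, then `σ` shows that there are no heavy jobs, and no machine is able. Otherwise an
  -- excess of `W / 2` is allowed because `W ≤ T`.
  by_cases hTW : T < I.W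
  · have hA : ¬ I.Able T v := by unfold Able; omega
    have h0 : binLoad I.n I.heavy pos2 v = 0 := by
      refine sum_eq_zero fun j hj => ?_
      have hj' := mem_range.1 hj
      have hjh : ¬ I.hv j := by
        intro hjh
        have h3 := h.el j hj'
        have h4 := h.le' (I.el_lt _ _ h3)
        have h5 : 1 ≤ binLoad I.n I.heavy σ (σ j) := by
          have := single_le_sum (f := fun i => if σ i = σ j then I.heavy i else 0)
            (fun _ _ => Nat.zero_le _) hj
          simpa [binLoad, heavy, hjh] using this
        have h6 := Nat.mul_le_mul_left I.W h5
        omega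
      simp [heavy, hjh]
    rw [h0]
    calc _ ≤ I.W * T := Nat.mul_le_mul_left _ (by have := hnot hA; omega)
      _ ≤ _ := Nat.mul_le_mul_right _ (by omega)
  · have key : I.dl v + (I.w * binLoad I.n I.light sol v + I.W * binLoad I.n I.heavy pos2 v) ≤
        T + I.W / 2 := by
      split_ifs at hle with hpoor
      · have := Nat.mul_le_mul_left I.W hle
        omega
      · have h0 : binLoad I.n I.heavy pos2 v = 0 := by omega
        rw [h0]
        by_cases hA : I.Able T v
        -- A spared machine gets no heavy job. Even with the whole pool its load is at most `T + W /
        -- 2 - W - x + (2 * x + w)`, and `x + w ≤ W` by `x ≤ W / 2` and `2 * w ≤ W`.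
        · have hr : I.Rich T sol v := ⟨hA, by omega⟩
          have h3 := hp.lt_pooled hcap hv hr
          have h4 := hp.pool_of_pooled hc hcap hv (by omega)
          have h5 := hp.sum_pooled_le (hc.lt v hv) {v}
            (singleton_subset_iff.2 (mem_filter.2 ⟨mem_range.2 hv, rfl⟩))
          rw [hcap.pool _ (hc.lt v hv) h4, sum_singleton] at h5
          rw [hcap.able v hv hA] at h1
          have := I.two_w
          have := hcap.x_le
          unfold Able at hA
          omega
        · have := hnot hA
          omega
    calc _ ≤ I.W * (T + I.W / 2) := Nat.mul_le_mul_left _ key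
      _ = I.W * T + I.W / 2 * I.W := by ring
      _ ≤ I.W * T + I.W / 2 * T := by gcongr; omega
      _ = _ := by ring

/-- Integrality matters: `W - 1 ≤ 2 * (W / 2)` also for odd `W`, and the factor 2 is absorbed by `2
* W ≤ T`. -/
theorem load_le_of_two_mul_le (hT : 2 * I.W ≤ T) {a : ℕ} (ha : a ≤ T + I.W - 1) :
    I.W * a ≤ (I.W + I.W / 2) * T := by
  have hW : 0 < I.W := by have := I.w_pos; have := I.two_w; omega
  calc I.W * a ≤ I.W * (T + (I.W - 1)) := Nat.mul_le_mul_left _ (by omega)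
    _ = I.W * T + I.W * (I.W - 1) := by ring
    _ ≤ I.W * T + I.W * (2 * (I.W / 2)) := by gcongr; omega
    _ = I.W * T + I.W / 2 * (2 * I.W) := by ring
    _ ≤ I.W * T + I.W / 2 * T := by gcongr
    _ = _ := by ring

end

end Sched

end GraphBalancing

/-! ### Subroutines with bounded loops and their specifications -/

namespace GraphBalancing

open RAM Finset

/-! ### Building blocks of programs -/

/-- The test whether two expressions have the same value. -/
def eqTest (a b : Expr) : Expr := .sub (.const 1) (.add (.sub a b) (.sub b a))

/-- The test whether one expression has at most the value of another one. -/
def leTest (a b : Expr) : Expr := .sub (.add b (.const 1)) a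

theorem eqTest_eval (a b : Expr) (s : Store) :
    (eqTest a b).eval s = 0 ↔ a.eval s ≠ b.eval s := by
  simp only [eqTest, Expr.eval]; omega

theorem leTest_eval (a b : Expr) (s : Store) :
    (leTest a b).eval s = 0 ↔ ¬ a.eval s ≤ b.eval s := by
  simp only [leTest, Expr.eval]; omega

/-- Entry of a one-dimensional array. -/
abbrev entry (a : ℕ) (i : Expr) : Expr := .arr a i (.const 0)

/-- Assignment to an entry of a one-dimensional array. -/
abbrev setEntry (a : ℕ) (i e : Expr) : Code := .store a i (.const 0) e

/-- The number of bins, two for every machine. -/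
abbrev bins : Bound := .add .machines .machines

namespace Code

/-- A loop that fills the entries `g i` of an array. -/
theorem loop_fill {x a : ℕ} {b : Bound} {c : Code} {s : Store} {f g : ℕ → ℕ}
    (hg : Function.Injective g)
    (h : ∀ i t, i < b.val s → t.var x = i → Frame (loop x b c) s t →
      (c.den t).arr a (g i) 0 = f i ∧ ∀ k, k ≠ g i → (c.den t).arr a k 0 = t.arr a k 0) :
    (∀ i < b.val s, ((loop x b c).den s).arr a (g i) 0 = f i) ∧
    ∀ k, (∀ i < b.val s, k ≠ g i) → ((loop x b c).den s).arr a k 0 = s.arr a k 0 := by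
  have key := loop_induction (x := x) (b := b) (c := c) (s := s)
    (P := fun r t => r ≤ b.val s → (∀ i < r, t.arr a (g i) 0 = f i) ∧
      ∀ k, (∀ i < r, k ≠ g i) → t.arr a k 0 = s.arr a k 0) ?_ ?_
  · exact key le_rfl
  · intro _
    exact ⟨fun i hi => absurd hi (by omega), fun k _ => rfl⟩
  · intro i t hi hx hf hP hr
    obtain ⟨h1, h2⟩ := hP (by omega)
    obtain ⟨h3, h4⟩ := h i t hi hx hf
    refine ⟨fun k hk => ?_, fun k hk => ?_⟩
    · by_cases hki : k = i
      · subst hki; exact h3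
      · have : g k ≠ g i := fun h => hki (hg h)
        exact (h4 _ this).trans (h1 k (by omega))
    · exact (h4 k (hk i (by omega))).trans (h2 k fun l hl => hk l (by omega))

end Code

open Code

/-! #### Searching and counting -/

/-- The conjunction of two tests. -/
def andTest (a b : Expr) : Expr :=
  .sub (.const 1) (.add (.sub (.const 1) a) (.sub (.const 1) b))

theorem andTest_eval (a b : Expr) (s : Store) :
    (andTest a b).eval s ≠ 0 ↔ a.eval s ≠ 0 ∧ b.eval s ≠ 0 := by
  simp only [andTest, Expr.eval]; omega

theorem eqTest_ne (a b : Expr) (s : Store) :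
    (eqTest a b).eval s ≠ 0 ↔ a.eval s = b.eval s := by
  rw [Ne, eqTest_eval, not_not]

theorem leTest_ne (a b : Expr) (s : Store) :
    (leTest a b).eval s ≠ 0 ↔ a.eval s ≤ b.eval s := by
  rw [Ne, leTest_eval, not_not]

/-- Array `p` receives the last number below `b` that passes the test for a job. -/
def lastMatch (p : ℕ) (b : Bound) (e : Expr) : Code :=
  .loop 10 .jobs (.loop 11 b (.ite e (setEntry p (.var 10) (.var 11)) .skip))

/-- Later matches overwrite earlier ones, and some match exists by `hex`. The test needs to express
`f` only on memories that differ from `s` in what the loops change: the two counters and array `p`.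
-/
theorem lastMatch_spec {p : ℕ} {b : Bound} {e : Expr} (s : Store) {f : ℕ → ℕ → Prop}
    (hf : ∀ t : Store, (∀ y, y ≠ 10 → y ≠ 11 → t.var y = s.var y) →
      (∀ a, a ≠ p → t.arr a = s.arr a) → (e.eval t ≠ 0 ↔ f (t.var 10) (t.var 11))) {j : ℕ}
    (hj : j < s.var 1) (hex : ∃ u < b.val s, f j u) :
    ((lastMatch p b e).den s).arr p j 0 < b.val s ∧
      f j (((lastMatch p b e).den s).arr p j 0) := by
  have key := loop_induction (x := 10) (b := .jobs)
    (c := .loop 11 b (.ite e (setEntry p (.var 10) (.var 11)) .skip)) (s := s)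
    (P := fun r t => j < r → t.arr p j 0 < b.val s ∧ f j (t.arr p j 0)) ?_ ?_
  · exact key hj
  · intro h; exact absurd h (by omega)
  · intro i t _ hxi hft hP
    have hb : b.val t = b.val s := Bound.val_congr (hft.var 0 rfl) (hft.var 1 rfl) b
    have inner := loop_induction (x := 11) (b := b)
      (c := .ite e (setEntry p (.var 10) (.var 11)) .skip) (s := t)
      (P := fun r t' => (j ≠ i → t'.arr p j 0 = t.arr p j 0) ∧
        (j = i → (∃ u < r, f j u) → t'.arr p j 0 < b.val s ∧ f j (t'.arr p j 0))) ?_ ?_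
    · intro hji
      simp only [Store.setVar]
      by_cases hne : j = i
      · exact inner.2 hne (hb ▸ hex)
      · rw [inner.1 hne]; exact hP (by omega)
    · refine ⟨fun _ => rfl, ?_⟩
      rintro _ ⟨u, hu, _⟩; omega
    · intro l t' hl hxl hf' hP'
      have h10 : t'.var 10 = i := by rw [hf'.var 10 rfl, hxi]
      have he := hf t'
        (fun y h10 h11 => by
          have h1 : (10 == y) = false := by simpa using Ne.symm h10
          have h2 : (11 == y) = false := by simpa using Ne.symm h11
          rw [hf'.var y (by simp [setsVar, h2]), hft.var y (by simp [setsVar, h1, h2])])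
        (fun a ha => by
          have h : (p == a) = false := by simpa using Ne.symm ha
          rw [hf'.arr a (by simp [setsArr, h]), hft.arr a (by simp [setsArr, h])])
      rw [h10, hxl] at he
      simp only [den, Expr.eval, h10, hxl, Store.setVar]
      split_ifs with hz
      · refine ⟨hP'.1, fun hji ⟨u, hu, hue⟩ => hP'.2 hji ⟨u, ?_, hue⟩⟩
        rcases Nat.lt_succ_iff_lt_or_eq.1 hu with h | h
        · exact h
        · subst h; subst hji; exact absurd hz (he.2 hue)
      · refine ⟨fun hji => ?_, fun hji _ => ?_⟩
        · simp [Store.setArr, hji, hP'.1 hji]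
        · subst hji
          simp only [Store.setArr, and_self, if_true]
          exact ⟨by omega, he.1 hz⟩

/-- Count in the variable `z` how often a test succeeds. -/
def count (z x : ℕ) (b : Bound) (e : Expr) : Code :=
  .loop x b (.ite e (.assign z (.add (.var z) (.const 1))) .skip)

theorem count_spec {z x : ℕ} {b : Bound} {e : Expr} (hzx : z ≠ x) (s : Store) {f : ℕ → Prop}
    [DecidablePred f]
    (hf : ∀ t : Store, (∀ y, y ≠ x → y ≠ z → t.var y = s.var y) → t.arr = s.arr →
      t.var x < b.val s → (e.eval t ≠ 0 ↔ f (t.var x))) :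
    ((count z x b e).den s).var z = s.var z + ((range (b.val s)).filter f).card := by
  refine loop_induction (P := fun r t => t.var z = s.var z + ((range r).filter f).card) ?_ ?_
  · simp [Store.setVar, hzx]
  · intro i t hi hx hft hP
    have he := hf t
      (fun y h10 h11 => by
        have h1 : (x == y) = false := by simpa using Ne.symm h10
        have h2 : (z == y) = false := by simpa using Ne.symm h11
        rw [hft.var y (by simp [setsVar, h1, h2])])
      (funext fun a => hft.arr a rfl) (hx ▸ hi)
    rw [hx] at he
    rw [range_add_one, filter_insert]
    simp only [den, Expr.eval]
    split_ifs with hz hfi hfi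
    · exact absurd hz (he.2 hfi)
    · simpa [Store.setVar, hzx] using hP
    · rw [card_insert_of_notMem (by simp)]
      simp [Store.setVar, hzx, hP]
      omega
    · exact absurd (he.1 hz) hfi

/-- A loop that collects facts. -/
theorem loop_collect {α : Type*} {x : ℕ} {b : Bound} {c : Code} {s : Store}
    {G : Set α → Store → Prop} {F : ℕ → Set α} {D : Set α}
    (hset : ∀ D t v, G D t → G D (t.setVar x v))
    (hstep : ∀ i t D, i < b.val s → t.var x = i → Frame (loop x b c) s t → G D t →
      G (D ∪ F i) (c.den t)) (h : G D s) :
    G (D ∪ {p | ∃ i < b.val s, p ∈ F i}) ((loop x b c).den s) := by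
  refine loop_induction (P := fun r t => G (D ∪ {p | ∃ i < r, p ∈ F i}) t) ?_ ?_
  · have : (D ∪ {p | ∃ i < 0, p ∈ F i}) = D := by ext; simp
    rw [this]; exact hset _ _ _ h
  · intro i t hi hx hf hG
    have : (D ∪ {p | ∃ k < i + 1, p ∈ F k}) = (D ∪ {p | ∃ k < i, p ∈ F k}) ∪ F i := by
      ext p
      simp only [Set.mem_union, Set.mem_ofPred_eq, Nat.lt_succ_iff_lt_or_eq]
      constructor
      · rintro (h | ⟨k, hk | rfl, hp⟩)
        · exact Or.inl (Or.inl h)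
        · exact Or.inl (Or.inr ⟨k, hk, hp⟩)
        · exact Or.inr hp
      · rintro ((h | ⟨k, hk, hp⟩) | h)
        · exact Or.inl h
        · exact Or.inr ⟨k, Or.inl hk, hp⟩
        · exact Or.inr ⟨i, Or.inr rfl, h⟩
    rw [this]
    exact hset _ _ _ (hstep i t _ hi hx hf hG)

/-! #### Loads -/

/-- Array `l` receives the loads of the bins under the placement in array `p` of jobs with the
weights in array `w`. -/
def loads (p w l : ℕ) : Code :=
  .seq (.loop 12 bins (setEntry l (.var 12) (.const 0)))
    (.loop 13 .jobs (setEntry l (entry p (.var 13))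
      (.add (entry l (entry p (.var 13))) (entry w (.var 13)))))

theorem loads_spec {p w l : ℕ} (hp : p ≠ l) (hw : w ≠ l) (s : Store) {b : ℕ}
    (hb : b < 2 * s.var 0) :
    ((loads p w l).den s).arr l b 0 =
      binLoad (s.var 1) (fun j => s.arr w j 0) (fun j => s.arr p j 0) b := by
  set t := (Code.loop 12 bins (setEntry l (.var 12) (.const 0))).den s with ht
  have hf : Frame (.loop 12 bins (setEntry l (.var 12) (.const 0))) s t := Code.frame _ s
  have h0 : ∀ i < bins.val s, t.arr l i 0 = 0 := (loop_fill (g := id) (f := fun _ => 0)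
    Function.injective_id (fun i t hi hx hf => by
      simp only [den, Expr.eval, hx, id, Store.setArr]
      simp +contextual)).1
  have h1 : t.var 1 = s.var 1 := hf.var 1 rfl
  have key := loop_induction (x := 13) (b := .jobs)
    (c := setEntry l (entry p (.var 13))
      (.add (entry l (entry p (.var 13))) (entry w (.var 13)))) (s := t)
    (P := fun r t' => t'.arr l b 0 =
      ∑ j ∈ range r, if s.arr p j 0 = b then s.arr w j 0 else 0) ?_ ?_
  · rw [show Bound.jobs.val t = s.var 1 from h1] at key
    exact key
  · simpa [Store.setVar] using h0 b (by simp [Bound.val]; omega)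
  · intro i t' _ hx hf' hP
    have ep : t'.arr p = s.arr p := by
      rw [hf'.arr p (by simp [setsArr, Ne.symm hp]), hf.arr p (by simp [setsArr, Ne.symm hp])]
    have ew : t'.arr w = s.arr w := by
      rw [hf'.arr w (by simp [setsArr, Ne.symm hw]), hf.arr w (by simp [setsArr, Ne.symm hw])]
    rw [sum_range_succ, ← hP]
    simp only [den, Expr.eval, hx, Store.setVar, Store.setArr, ep, ew]
    by_cases hi : s.arr p i 0 = b
    · simp [hi]
    · simp [hi, Ne.symm hi]

/-! #### Push and relabel

Array `5` holds the eligibility matrix, array `6` the weights of the jobs, array `7` the capacities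
of the bins, array `8` the labels, array `9` the bins of the jobs and array `10` the loads. -/

/-- Find an overloaded bin. -/
def findBin : Code :=
  .seq (.assign 20 (.add (.var 0) (.var 0)))
    (.loop 14 bins (.ite (.sub (entry 10 (.var 14)) (entry 7 (.var 14)))
      (.assign 20 (.var 14)) .skip))

/-- The value `2 * m`, which names no bin, signals that no bin is overloaded. -/
theorem findBin_spec (s : Store) :
    ((findBin.den s).var 20 < 2 * s.var 0 ∧
        s.arr 7 ((findBin.den s).var 20) 0 < s.arr 10 ((findBin.den s).var 20) 0) ∨
      ((findBin.den s).var 20 = 2 * s.var 0 ∧ ∀ b < 2 * s.var 0, s.arr 10 b 0 ≤ s.arr 7 b 0) := by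
  set t := (Code.assign 20 (.add (.var 0) (.var 0))).den s with ht
  have htv : t.var 20 = 2 * s.var 0 := by simp [ht, den, Store.setVar, Expr.eval]; omega
  have ht0 : t.var 0 = s.var 0 := by simp [ht, den, Store.setVar]
  have hta : t.arr = s.arr := rfl
  have key := loop_induction (x := 14) (b := bins)
    (c := .ite (.sub (entry 10 (.var 14)) (entry 7 (.var 14))) (.assign 20 (.var 14)) .skip)
    (s := t)
    (P := fun r t' => (t'.var 20 < 2 * s.var 0 ∧ s.arr 7 (t'.var 20) 0 < s.arr 10 (t'.var 20) 0) ∨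
      (t'.var 20 = 2 * s.var 0 ∧ ∀ b < r, s.arr 10 b 0 ≤ s.arr 7 b 0)) ?_ ?_
  · have : bins.val t = 2 * s.var 0 := by simp [Bound.val, ht0]; omega
    rwa [this] at key
  · right
    exact ⟨by simpa [Store.setVar] using htv, fun b hb => absurd hb (by omega)⟩
  · intro i t' hi hx hf hP
    have e7 : t'.arr 7 = s.arr 7 := by rw [hf.arr 7 rfl, hta]
    have e10 : t'.arr 10 = s.arr 10 := by rw [hf.arr 10 rfl, hta]
    have hi' : i < 2 * s.var 0 := by simp [Bound.val, ht0] at hi; omega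
    simp only [den, Expr.eval, hx, e7, e10]
    split_ifs with hz
    · simp only [Store.setVar]
      refine hP.imp id fun ⟨h1, h2⟩ => ⟨h1, fun b hb => ?_⟩
      rcases Nat.lt_succ_iff_lt_or_eq.1 hb with h | h
      · exact h2 b h
      · subst h; omega
    · left
      simp only [Store.setVar]
      simp
      omega

/-- Find a job on this bin and a bin to which it can be pushed. -/
def findPush : Code :=
  .seq (.assign 21 (.var 1))
    (.loop 15 .jobs (.ite (eqTest (entry 9 (.var 15)) (.var 20))
      (.loop 16 bins (.ite (.arr 5 (.var 15) (.var 16))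
        (.ite (eqTest (.add (entry 8 (.var 16)) (.const 1)) (entry 8 (.var 20)))
          (.seq (.assign 21 (.var 15)) (.assign 22 (.var 16))) .skip) .skip)) .skip))

/-- Variable `21` keeps the value `n`, which names no job, if no push is possible; variable `22` is
meaningful only in the other case. -/
theorem findPush_spec (s : Store) :
    let j := (findPush.den s).var 21
    let u := (findPush.den s).var 22
    (j < s.var 1 ∧ s.arr 9 j 0 = s.var 20 ∧ u < 2 * s.var 0 ∧ s.arr 5 j u ≠ 0 ∧
        s.arr 8 u 0 + 1 = s.arr 8 (s.var 20) 0) ∨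
      (j = s.var 1 ∧ ∀ j < s.var 1, s.arr 9 j 0 = s.var 20 → ∀ u < 2 * s.var 0, s.arr 5 j u ≠ 0 →
        s.arr 8 u 0 + 1 ≠ s.arr 8 (s.var 20) 0) := by
  set t := (Code.assign 21 (.var 1)).den s with ht
  have htv : t.var 21 = s.var 1 := by simp [ht, den, Store.setVar, Expr.eval]
  have ht0 : t.var 0 = s.var 0 := by simp [ht, den, Store.setVar]
  have ht1 : t.var 1 = s.var 1 := by simp [ht, den, Store.setVar]
  have ht20 : t.var 20 = s.var 20 := by simp [ht, den, Store.setVar]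
  have hta : t.arr = s.arr := rfl
  let Found : Store → Prop := fun t' => t'.var 21 < s.var 1 ∧ s.arr 9 (t'.var 21) 0 = s.var 20 ∧
    t'.var 22 < 2 * s.var 0 ∧ s.arr 5 (t'.var 21) (t'.var 22) ≠ 0 ∧
    s.arr 8 (t'.var 22) 0 + 1 = s.arr 8 (s.var 20) 0
  have key := loop_induction (x := 15) (b := .jobs)
    (c := .ite (eqTest (entry 9 (.var 15)) (.var 20))
      (.loop 16 bins (.ite (.arr 5 (.var 15) (.var 16))
        (.ite (eqTest (.add (entry 8 (.var 16)) (.const 1)) (entry 8 (.var 20)))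
          (.seq (.assign 21 (.var 15)) (.assign 22 (.var 16))) .skip) .skip)) .skip) (s := t)
    (P := fun r t' => Found t' ∨ (t'.var 21 = s.var 1 ∧ ∀ j < r, s.arr 9 j 0 = s.var 20 →
      ∀ u < 2 * s.var 0, s.arr 5 j u ≠ 0 → s.arr 8 u 0 + 1 ≠ s.arr 8 (s.var 20) 0)) ?_ ?_
  · have : Bound.jobs.val t = s.var 1 := by simp [Bound.val, ht1]
    rwa [this] at key
  · right
    exact ⟨by simpa [Store.setVar] using htv, fun b hb => absurd hb (by omega)⟩
  · intro i t' hi hx hf hP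
    have e9 : t'.arr 9 = s.arr 9 := by rw [hf.arr 9 rfl, hta]
    have e5 : t'.arr 5 = s.arr 5 := by rw [hf.arr 5 rfl, hta]
    have e8 : t'.arr 8 = s.arr 8 := by rw [hf.arr 8 rfl, hta]
    have e20 : t'.var 20 = s.var 20 := by rw [hf.var 20 rfl, ht20]
    have e0 : t'.var 0 = s.var 0 := by rw [hf.var 0 rfl, ht0]
    have hi' : i < s.var 1 := by simpa [Bound.val, ht1] using hi
    have hsucc : ∀ {Q : ℕ → Prop}, (∀ j < i, Q j) → Q i → ∀ j < i + 1, Q j := by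
      intro Q h1 h2 j hj
      rcases Nat.lt_succ_iff_lt_or_eq.1 hj with h | h
      · exact h1 j h
      · exact h ▸ h2
    rw [den]
    split_ifs with hz
    · rw [eqTest_eval] at hz
      simp only [Expr.eval, hx, e9, e20] at hz
      simp only [den, Store.setVar, Found]
      exact hP.imp id fun ⟨h1, h2⟩ => ⟨h1, hsucc h2 fun h => absurd h hz⟩
    · have hz' : s.arr 9 i 0 = s.var 20 := by
        by_contra hcon
        exact hz ((eqTest_eval _ _ _).2 (by simpa only [Expr.eval, hx, e9, e20] using hcon))
      have inner := loop_induction (x := 16) (b := bins)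
        (c := .ite (.arr 5 (.var 15) (.var 16))
        (.ite (eqTest (.add (entry 8 (.var 16)) (.const 1)) (entry 8 (.var 20)))
          (.seq (.assign 21 (.var 15)) (.assign 22 (.var 16))) .skip) .skip) (s := t')
        (P := fun r t'' => Found t'' ∨ (t''.var 21 = s.var 1 ∧ (∀ j < i, s.arr 9 j 0 = s.var 20 →
          ∀ u < 2 * s.var 0, s.arr 5 j u ≠ 0 → s.arr 8 u 0 + 1 ≠ s.arr 8 (s.var 20) 0) ∧
          ∀ u < r, s.arr 5 i u ≠ 0 → s.arr 8 u 0 + 1 ≠ s.arr 8 (s.var 20) 0)) ?_ ?_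
      · have : bins.val t' = 2 * s.var 0 := by simp [Bound.val, e0]; omega
        rw [this] at inner
        simp only [Store.setVar, Found]
        exact inner.imp id fun ⟨h1, h2, h3⟩ => ⟨h1, hsucc h2 fun _ => h3⟩
      · simp only [Store.setVar, Found]
        exact hP.imp id fun ⟨h1, h2⟩ => ⟨h1, h2, fun b hb => absurd hb (by omega)⟩
      · intro l t'' hl hxl hf' hP'
        have e5' : t''.arr 5 = s.arr 5 := by rw [hf'.arr 5 rfl, e5]
        have e8' : t''.arr 8 = s.arr 8 := by rw [hf'.arr 8 rfl, e8]
        have e20' : t''.var 20 = s.var 20 := by rw [hf'.var 20 rfl, e20]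
        have e15' : t''.var 15 = i := by rw [hf'.var 15 rfl, hx]
        have hl' : l < 2 * s.var 0 := by simp [Bound.val, e0] at hl; omega
        have hsucc' : ∀ {Q : ℕ → Prop}, (∀ j < l, Q j) → Q l → ∀ j < l + 1, Q j := by
          intro Q h1 h2 j hj
          rcases Nat.lt_succ_iff_lt_or_eq.1 hj with h | h
          · exact h1 j h
          · exact h ▸ h2
        rw [den]
        split_ifs with h5
        · simp only [Expr.eval, e15', hxl, e5'] at h5
          simp only [den, Store.setVar, Found]
          exact hP'.imp id fun ⟨h1, h2, h3⟩ => ⟨h1, h2, hsucc' h3 fun h => absurd h5 h⟩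
        · rw [den]
          simp only [Expr.eval, e15', hxl, e5'] at h5
          split_ifs with h8
          · rw [eqTest_eval] at h8
            simp only [Expr.eval, hxl, e8', e20'] at h8
            simp only [den, Store.setVar, Found]
            exact hP'.imp id fun ⟨h1, h2, h3⟩ => ⟨h1, h2, hsucc' h3 fun _ => h8⟩
          · have h8' : s.arr 8 l 0 + 1 = s.arr 8 (s.var 20) 0 := by
              by_contra hcon
              exact h8 ((eqTest_eval _ _ _).2 (by
                simpa only [Expr.eval, hxl, e8', e20'] using hcon))
            left
            simp [den, Store.setVar, Expr.eval, Found, e15', hxl]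
            exact ⟨hi', hz', hl', h5, h8'⟩

/-- One step of push and relabel. -/
def pushStep : Code :=
  .seq (loads 9 6 10) (.seq findBin (.seq findPush
    (.ite (.sub (.add (.var 0) (.var 0)) (.var 20))
      (.ite (.sub (.var 1) (.var 21))
        (setEntry 9 (.var 21) (.var 22))
        (setEntry 8 (.var 20) (.add (entry 8 (.var 20)) (.const 1)))) .skip)))

/-- Column `0` of an array. -/
abbrev col (s : Store) (a : ℕ) (i : ℕ) : ℕ := s.arr a i 0

/-- The relation that a matrix stores. -/
abbrev rel (s : Store) (a : ℕ) (i j : ℕ) : Prop := s.arr a i j ≠ 0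

theorem pushStep_spec (s : Store) :
    PushRelabel (2 * s.var 0) (s.var 1) (rel s 5) (col s 6) (col s 7) (col s 9) (col s 8)
      (col (pushStep.den s) 9) (col (pushStep.den s) 8) := by
  set s1 := (loads 9 6 10).den s with hs1
  have hf1 : Frame (loads 9 6 10) s s1 := Code.frame _ s
  set s2 := findBin.den s1 with hs2
  have hf2 : Frame findBin s1 s2 := Code.frame _ s1
  set s3 := findPush.den s2 with hs3
  have hf3 : Frame findPush s2 s3 := Code.frame _ s2
  have hload : ∀ b < 2 * s.var 0, s1.arr 10 b 0 =
      binLoad (s.var 1) (col s 6) (col s 9) b := fun b hb =>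
    loads_spec (by decide) (by decide) s hb
  have hbin := findBin_spec s1
  have hpush := findPush_spec s2
  simp only [← hs2, ← hs3] at hbin hpush
  have v10 : s1.var 0 = s.var 0 := hf1.var 0 rfl
  have v20 : s2.var 0 = s.var 0 := (hf2.var 0 rfl).trans v10
  have v30 : s3.var 0 = s.var 0 := (hf3.var 0 rfl).trans v20
  have v21 : s2.var 1 = s.var 1 := (hf2.var 1 rfl).trans (hf1.var 1 rfl)
  have v31 : s3.var 1 = s.var 1 := (hf3.var 1 rfl).trans v21
  have v3b : s3.var 20 = s2.var 20 := hf3.var 20 rfl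
  have a7 : s1.arr 7 = s.arr 7 := hf1.arr 7 rfl
  have a5 : s2.arr 5 = s.arr 5 := (hf2.arr 5 rfl).trans (hf1.arr 5 rfl)
  have a8 : s2.arr 8 = s.arr 8 := (hf2.arr 8 rfl).trans (hf1.arr 8 rfl)
  have a9 : s2.arr 9 = s.arr 9 := (hf2.arr 9 rfl).trans (hf1.arr 9 rfl)
  have b8 : s3.arr 8 = s.arr 8 := (hf3.arr 8 rfl).trans a8
  have b9 : s3.arr 9 = s.arr 9 := (hf3.arr 9 rfl).trans a9
  rw [v10, a7] at hbin
  rw [v20, v21, a5, a8, a9] at hpush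
  have hden : pushStep.den s = (Code.ite (.sub (.add (.var 0) (.var 0)) (.var 20))
      (.ite (.sub (.var 1) (.var 21))
        (setEntry 9 (.var 21) (.var 22))
        (setEntry 8 (.var 20) (.add (entry 8 (.var 20)) (.const 1)))) .skip).den s3 := rfl
  rcases hbin with ⟨hb, hover⟩ | ⟨hb, hdone⟩
  · rw [hload _ hb] at hover
    have hne : ¬ s.var 0 + s.var 0 - s2.var 20 = 0 := by omega
    rcases hpush with ⟨hj, hjv, hu, hE, hlab⟩ | ⟨hj, hno⟩
    · have hne' : ¬ s.var 1 - s3.var 21 = 0 := by omega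
      have e9 : col (pushStep.den s) 9 = Function.update (col s 9) (s3.var 21) (s3.var 22) := by
        funext k
        simp only [hden, den, Expr.eval, v30, v31, v3b, if_neg hne, if_neg hne', Store.setArr, b9,
          Function.update_apply, col]
        simp
      have e8 : col (pushStep.den s) 8 = col s 8 := by
        funext k
        simp [hden, den, Expr.eval, v30, v31, v3b, if_neg hne, if_neg hne', Store.setArr, b8, col]
      rw [e9, e8]
      exact .push hb hover hj hjv hu hE hlab
    · have hne' : s.var 1 - s3.var 21 = 0 := by omega
      have e8 : col (pushStep.den s) 8 =
          Function.update (col s 8) (s2.var 20) (col s 8 (s2.var 20) + 1) := by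
        funext k
        simp only [hden, den, Expr.eval, v30, v31, v3b, if_neg hne, if_pos hne', Store.setArr, b8,
          Function.update_apply, col]
        simp
      have e9 : col (pushStep.den s) 9 = col s 9 := by
        funext k
        simp [hden, den, Expr.eval, v30, v31, v3b, if_neg hne, if_pos hne', Store.setArr, b9, col]
      rw [e9, e8]
      exact .relabel hb hover hno
  · have hne : s.var 0 + s.var 0 - s2.var 20 = 0 := by omega
    have hd : pushStep.den s = s3 := by
      simp only [hden, den, Expr.eval, v30, v3b, if_pos hne]
    rw [hd, show col s3 9 = col s 9 by funext k; rw [col, b9],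
      show col s3 8 = col s 8 by funext k; rw [col, b8]]
    exact .done fun b hb => hload b hb ▸ hdone b hb

/-- The whole of push and relabel. -/
def pushRelabel : Code :=
  .seq (lastMatch 9 bins (.arr 5 (.var 10) (.var 11)))
    (.seq (.loop 12 bins (setEntry 8 (.var 12) (.const 0)))
    (.loop 17 bins (.loop 18 bins (.loop 19 (.add .jobs (.const 2)) pushStep))))

/-- A loop that repeats a step. -/
theorem loop_repeat {x : ℕ} {b : Bound} {c : Code} {s : Store} {Q : ℕ → Store → Prop} {d r : ℕ}
    (hset : ∀ k t v, Q k t → Q k (t.setVar x v))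
    (hstep : ∀ k t, Frame (loop x b c) s t → Q k t → Q (k + d) (c.den t)) (h : Q r s) :
    Q (r + b.val s * d) ((loop x b c).den s) := by
  refine loop_induction (P := fun i t => Q (r + i * d) t) ?_ ?_
  · simpa using hset _ _ _ h
  · intro i t _ _ hf hQ
    have := hset _ _ (i + 1) (hstep _ t hf hQ)
    rwa [add_assoc, ← Nat.succ_mul] at this

/-- The three loops run `2m * (2m * (n + 2))` steps, exactly what `Progress.done` asks for with `2m`
bins. No test for termination is needed, as a finished placement is left unchanged. Eligibility does
not depend on the absence of full sets, so a wrong guess still produces a placement. -/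
theorem pushRelabel_spec (s : Store) {wmax : ℕ}
    (hex : ∀ j < s.var 1, ∃ u < 2 * s.var 0, s.arr 5 j u ≠ 0)
    (hwt : ∀ j < s.var 1, s.arr 6 j 0 ≤ wmax) :
    (∀ j < s.var 1, (pushRelabel.den s).arr 9 j 0 < 2 * s.var 0 ∧
      s.arr 5 j ((pushRelabel.den s).arr 9 j 0) ≠ 0) ∧
    ((∀ p S, ¬ FullSet (2 * s.var 0) (s.var 1) (rel s 5) (col s 6) (col s 7) wmax p S) →
      ∀ b < 2 * s.var 0, binLoad (s.var 1) (col s 6) (col (pushRelabel.den s) 9) b ≤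
        s.arr 7 b 0) := by
  set s1 := (lastMatch 9 bins (.arr 5 (.var 10) (.var 11))).den s with hs1
  have hf1 : Frame (lastMatch 9 bins (.arr 5 (.var 10) (.var 11))) s s1 := Code.frame _ s
  set s2 := (Code.loop 12 bins (setEntry 8 (.var 12) (.const 0))).den s1 with hs2
  have hf2 : Frame (.loop 12 bins (setEntry 8 (.var 12) (.const 0))) s1 s2 := Code.frame _ s1
  have hbins : ∀ t : Store, bins.val t = 2 * t.var 0 := fun t => by simp [Bound.val]; omega
  let Q : ℕ → Store → Prop := fun k t =>
    (t.var 0 = s.var 0 ∧ t.var 1 = s.var 1 ∧ t.arr 5 = s.arr 5 ∧ t.arr 6 = s.arr 6 ∧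
      t.arr 7 = s.arr 7) ∧
    Progress (2 * s.var 0) (s.var 1) (rel s 5) (col s 6) (col s 7) wmax (col t 9) (col t 8) k
  have hQset : ∀ x, x ≠ 0 → x ≠ 1 → ∀ k t v, Q k t → Q k (t.setVar x v) := by
    intro x h0 h1 k t v hQ
    simpa [Q, Store.setVar, Ne.symm h0, Ne.symm h1, col] using hQ
  have hlab : ∀ b < 2 * s.var 0, s2.arr 8 b 0 = 0 := by
    have := (loop_fill (x := 12) (a := 8) (b := bins)
      (c := setEntry 8 (.var 12) (.const 0)) (s := s1) (g := id) (f := fun _ => 0)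
      Function.injective_id (fun i t hi hx hf => by
        simp only [den, Expr.eval, hx, id, Store.setArr]
        simp +contextual)).1
    intro b hb
    exact this b (by rw [hbins, hf1.var 0 rfl]; exact hb)
  have h9 : ∀ j < s.var 1, s2.arr 9 j 0 < 2 * s.var 0 ∧ s.arr 5 j (s2.arr 9 j 0) ≠ 0 := by
    intro j hj
    rw [hf2.arr 9 rfl, ← hbins]
    exact lastMatch_spec s (f := fun j u => s.arr 5 j u ≠ 0)
      (fun t _ ha => by simp only [Expr.eval, ha 5 (by decide)]) hj
      (by simpa only [hbins] using hex j hj)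
  have hQ0 : Q 0 s2 := by
    refine ⟨⟨?_, ?_, ?_, ?_, ?_⟩,
      ⟨⟨fun j hj => (h9 j hj).1, fun j hj => (h9 j hj).2, ?_, ?_⟩, ?_, ?_⟩⟩
    · rw [hf2.var 0 rfl, hf1.var 0 rfl]
    · rw [hf2.var 1 rfl, hf1.var 1 rfl]
    · rw [hf2.arr 5 rfl, hf1.arr 5 rfl]
    · rw [hf2.arr 6 rfl, hf1.arr 6 rfl]
    · rw [hf2.arr 7 rfl, hf1.arr 7 rfl]
    · intro j hj u hu _
      rw [col, hlab _ (h9 j hj).1]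
      exact Nat.zero_le _
    · intro b hb h
      rw [col, hlab b hb] at h
      omega
    · intro _ b hb
      rw [col, hlab b hb]
      exact Nat.zero_le _
    · right
      rw [sum_eq_zero fun j hj => hlab _ (h9 j (mem_range.1 hj)).1]
      exact Nat.zero_le _
  have hstep : ∀ k t, Q k t → Q (k + 1) (pushStep.den t) := by
    rintro k t ⟨⟨h0, h1, h5, h6, h7⟩, hP⟩
    have hf : Frame pushStep t (pushStep.den t) := Code.frame _ t
    refine ⟨⟨?_, ?_, ?_, ?_, ?_⟩, hP.step hwt ?_⟩
    · rw [hf.var 0 rfl, h0]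
    · rw [hf.var 1 rfl, h1]
    · rw [hf.arr 5 rfl, h5]
    · rw [hf.arr 6 rfl, h6]
    · rw [hf.arr 7 rfl, h7]
    · have := pushStep_spec t
      have e5 : rel t 5 = rel s 5 := by funext i j; simp only [rel, h5]
      have e6 : col t 6 = col s 6 := by funext i; simp only [col, h6]
      have e7 : col t 7 = col s 7 := by funext i; simp only [col, h7]
      rwa [h0, h1, e5, e6, e7] at this
  have hval3 : ∀ k t, Q k t → (Bound.add .jobs (.const 2)).val t = s.var 1 + 2 := fun k t hQ => by
    simp [Bound.val, hQ.1.2.1]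
  have hval : ∀ k t, Q k t → bins.val t = 2 * s.var 0 := fun k t hQ => by rw [hbins, hQ.1.1]
  have h3 : ∀ k t, Q k t → Q (k + (s.var 1 + 2))
      ((Code.loop 19 (.add .jobs (.const 2)) pushStep).den t) := by
    intro k t hQ
    have := loop_repeat (b := .add .jobs (.const 2)) (hQset 19 (by decide) (by decide))
      (fun k t _ => hstep k t) hQ
    rwa [hval3 k t hQ, mul_one] at this
  have h2 : ∀ k t, Q k t → Q (k + 2 * s.var 0 * (s.var 1 + 2))
      ((Code.loop 18 bins (.loop 19 (.add .jobs (.const 2)) pushStep)).den t) := by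
    intro k t hQ
    have := loop_repeat (b := bins) (hQset 18 (by decide) (by decide))
      (fun k t _ => h3 k t) hQ
    rwa [hval k t hQ] at this
  have h1 := loop_repeat (b := bins) (hQset 17 (by decide) (by decide))
    (fun k t _ => h2 k t) hQ0
  rw [hval _ _ hQ0, zero_add] at h1
  have hfin : Q (2 * s.var 0 * (2 * s.var 0 * (s.var 1 + 2))) (pushRelabel.den s) := h1
  exact ⟨fun j hj => ⟨hfin.2.labelled.lt j hj, hfin.2.labelled.mem j hj⟩,
    fun hno => hfin.2.done hno le_rfl⟩

end GraphBalancing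

/-! ### The algorithm and its correctness -/

namespace GraphBalancing

open RAM Finset Code
open scoped Classical

/-! ### The algorithm -/

/-- The memory describes the instance, the components of the heavy graph and some numbers derived
from the instance. -/
structure Setup (I : Sched) (comp : ℕ → ℕ) (q x : ℕ) (s : Store) : Prop where
  m : s.var 0 = I.m
  n : s.var 1 = I.n
  W : s.var 2 = I.W
  w : s.var 3 = I.w
  x_var : s.var 4 = x
  dl : ∀ v < I.m, s.arr 0 v 0 = I.dl v
  hv : ∀ j < I.n, (s.arr 1 j 0 ≠ 0 ↔ I.hv j)
  el : ∀ j < I.n, ∀ v, (s.arr 2 j v ≠ 0 ↔ I.el j v)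
  comp_eq : ∀ v < I.m, s.arr 4 v 0 = comp v
  fst : ∀ j < I.n, I.el j (s.arr 14 j 0)
  wt : ∀ j < I.n, s.arr 15 j 0 = I.wt j
  isComp : I.IsComp comp
  x_eq : x = q * I.w
  x_le : x ≤ I.W / 2
  x_max : I.W / 2 < x + I.w ∨ q = I.n

section

variable {I : Sched} {comp : ℕ → ℕ} {q x : ℕ} {s t : Store}

theorem Setup.congr (h : Setup I comp q x s) (hv : ∀ y ∈ [0, 1, 2, 3, 4], t.var y = s.var y)
    (ha : ∀ a ∈ [0, 1, 2, 4, 14, 15], t.arr a = s.arr a) : Setup I comp q x t where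
  m := (hv 0 (by simp)).trans h.m
  n := (hv 1 (by simp)).trans h.n
  W := (hv 2 (by simp)).trans h.W
  w := (hv 3 (by simp)).trans h.w
  x_var := (hv 4 (by simp)).trans h.x_var
  dl := by rw [ha 0 (by simp)]; exact h.dl
  hv := by rw [ha 1 (by simp)]; exact h.hv
  el := by rw [ha 2 (by simp)]; exact h.el
  comp_eq := by rw [ha 4 (by simp)]; exact h.comp_eq
  fst := by rw [ha 14 (by simp)]; exact h.fst
  wt := by rw [ha 15 (by simp)]; exact h.wt
  isComp := h.isComp
  x_eq := h.x_eq
  x_le := h.x_le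
  x_max := h.x_max

theorem Setup.of_frame (h : Setup I comp q x s) {c : Code} (hf : Frame c s t)
    (hv : ∀ y ∈ [0, 1, 2, 3, 4], c.setsVar y = false)
    (ha : ∀ a ∈ [0, 1, 2, 4, 14, 15], c.setsArr a = false) : Setup I comp q x t :=
  h.congr (fun y hy => hf.var y (hv y hy)) fun a h => hf.arr a (ha a h)

end

/-! #### Eligibility matrices -/

/-- The bins are the machines. -/
def plainEl : Code :=
  .loop 10 .jobs (.loop 11 bins (.store 5 (.var 10) (.var 11) (.arr 2 (.var 10) (.var 11))))

/-- All `2 * m` columns are copied, which also erases pools left over from an earlier guess. -/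
theorem plainEl_spec (s : Store) {j b : ℕ} (hj : j < s.var 1) (hb : b < 2 * s.var 0) :
    (plainEl.den s).arr 5 j b = s.arr 2 j b := by
  have key := loop_induction (x := 10) (b := .jobs)
    (c := .loop 11 bins (.store 5 (.var 10) (.var 11) (.arr 2 (.var 10) (.var 11)))) (s := s)
    (P := fun r t => j < r → t.arr 5 j b = s.arr 2 j b) ?_ ?_
  · exact key hj
  · intro h; exact absurd h (by omega)
  · intro i t _ hxi hf hP
    have inner := loop_induction (x := 11) (b := bins)
      (c := .store 5 (.var 10) (.var 11) (.arr 2 (.var 10) (.var 11))) (s := t)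
      (P := fun r t' => (j ≠ i → t'.arr 5 j b = t.arr 5 j b) ∧
        (j = i → b < r → t'.arr 5 j b = s.arr 2 j b)) ?_ ?_
    · intro hji
      simp only [Store.setVar]
      by_cases hne : j = i
      · refine inner.2 hne ?_
        have := hf.var 0 rfl
        simp only [Bound.val]; omega
      · rw [inner.1 hne]; exact hP (by omega)
    · exact ⟨fun _ => rfl, fun _ h => absurd h (by omega)⟩
    · intro l t' hl hxl hf' hP'
      have h10 : t'.var 10 = i := by rw [hf'.var 10 rfl, hxi]
      have h2 : t'.arr 2 = s.arr 2 := by rw [hf'.arr 2 rfl, hf.arr 2 rfl]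
      simp only [Code.den, Expr.eval, h10, hxl, h2, Store.setVar, Store.setArr]
      refine ⟨fun hji => ?_, fun hji hbl => ?_⟩
      · simp [hji, hP'.1 hji]
      · subst hji
        by_cases hbl' : b = l
        · simp [hbl']
        · simp [hbl', hP'.2 rfl (by omega)]

/-- Every component gets a pool. -/
def addPools : Code :=
  .loop 10 .jobs (.loop 11 .machines (.ite (.arr 2 (.var 10) (.var 11))
    (.store 5 (.var 10) (.add (.var 0) (entry 4 (.var 11))) (.const 1)) .skip))

theorem addPools_spec (s : Store) {j b : ℕ} (hj : j < s.var 1) :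
    (addPools.den s).arr 5 j b ≠ 0 ↔
      s.arr 5 j b ≠ 0 ∨ ∃ v < s.var 0, s.arr 2 j v ≠ 0 ∧ s.var 0 + s.arr 4 v 0 = b := by
  have key := loop_induction (x := 10) (b := .jobs)
    (c := .loop 11 .machines (.ite (.arr 2 (.var 10) (.var 11))
      (.store 5 (.var 10) (.add (.var 0) (entry 4 (.var 11))) (.const 1)) .skip)) (s := s)
    (P := fun r t => t.arr 5 j b ≠ 0 ↔ s.arr 5 j b ≠ 0 ∨
      (j < r ∧ ∃ v < s.var 0, s.arr 2 j v ≠ 0 ∧ s.var 0 + s.arr 4 v 0 = b)) ?_ ?_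
  · have hj' : j < Bound.jobs.val s := hj
    simp only [hj', true_and] at key
    exact key
  · simp [Store.setVar]
  · intro i t _ hxi hf hP
    have h0 : t.var 0 = s.var 0 := hf.var 0 rfl
    have inner := loop_induction (x := 11) (b := .machines)
      (c := .ite (.arr 2 (.var 10) (.var 11))
        (.store 5 (.var 10) (.add (.var 0) (entry 4 (.var 11))) (.const 1)) .skip) (s := t)
      (P := fun r t' => t'.arr 5 j b ≠ 0 ↔ t.arr 5 j b ≠ 0 ∨
        (j = i ∧ ∃ v < r, s.arr 2 j v ≠ 0 ∧ s.var 0 + s.arr 4 v 0 = b)) ?_ ?_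
    · simp only [Store.setVar]
      rw [inner, hP]
      simp only [Bound.val, h0, Nat.lt_succ_iff_lt_or_eq]
      rw [or_assoc, ← or_and_right]
    · simp [Store.setVar]
    · intro l t' hl hxl hf' hP'
      have h10 : t'.var 10 = i := by rw [hf'.var 10 rfl, hxi]
      have h0' : t'.var 0 = s.var 0 := by rw [hf'.var 0 rfl, h0]
      have h2 : t'.arr 2 = s.arr 2 := by rw [hf'.arr 2 rfl, hf.arr 2 rfl]
      have h4 : t'.arr 4 = s.arr 4 := by rw [hf'.arr 4 rfl, hf.arr 4 rfl]
      have hex : (∃ v < l + 1, s.arr 2 j v ≠ 0 ∧ s.var 0 + s.arr 4 v 0 = b) ↔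
          (∃ v < l, s.arr 2 j v ≠ 0 ∧ s.var 0 + s.arr 4 v 0 = b) ∨
            (s.arr 2 j l ≠ 0 ∧ s.var 0 + s.arr 4 l 0 = b) := by
        constructor
        · rintro ⟨v, hv, h⟩
          rcases Nat.lt_succ_iff_lt_or_eq.1 hv with h' | rfl
          · exact Or.inl ⟨v, h', h⟩
          · exact Or.inr h
        · rintro (⟨v, hv, h⟩ | h)
          · exact ⟨v, by omega, h⟩
          · exact ⟨l, by omega, h⟩
      rw [hex]
      simp only [Code.den, Expr.eval, h10, hxl, h2, h4, h0']
      by_cases hz : s.arr 2 i l = 0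
      · simp only [hz, if_true, Store.setVar]
        rw [hP']
        constructor
        · rintro (h | ⟨h1, h⟩)
          · exact Or.inl h
          · exact Or.inr ⟨h1, Or.inl h⟩
        · rintro (h | ⟨rfl, h | h⟩)
          · exact Or.inl h
          · exact Or.inr ⟨rfl, h⟩
          · exact absurd hz h.1
      · rw [if_neg hz]
        simp only [Store.setVar, Store.setArr, true_and]
        by_cases hc : j = i ∧ b = s.var 0 + s.arr 4 l 0
        · obtain ⟨rfl, hb⟩ := hc
          simp [hb, hz]
        · rw [if_neg hc, hP']
          constructor
          · rintro (h | ⟨h1, h⟩)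
            · exact Or.inl h
            · exact Or.inr ⟨h1, Or.inl h⟩
          · rintro (h | ⟨h1, h | h⟩)
            · exact Or.inl h
            · exact Or.inr ⟨h1, h⟩
            · exact absurd ⟨h1, h.2.symm⟩ hc

/-! #### Capacities and weights -/

/-- Fill the entries of an array that belong to the jobs, depending on whether they are heavy. -/
def byKind (a : ℕ) (e f : Expr) : Code :=
  .loop 10 .jobs (.ite (entry 1 (.var 10)) (setEntry a (.var 10) e) (setEntry a (.var 10) f))

theorem byKind_spec {a : ℕ} {e f : Expr} (s : Store) {u v : ℕ} (h1 : a ≠ 1)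
    (he : ∀ t : Store, (∀ y, y ≠ 10 → t.var y = s.var y) → e.eval t = u)
    (hf : ∀ t : Store, (∀ y, y ≠ 10 → t.var y = s.var y) → f.eval t = v) {j : ℕ}
    (hj : j < s.var 1) :
    ((byKind a e f).den s).arr a j 0 = if s.arr 1 j 0 ≠ 0 then u else v := by
  refine (loop_fill (g := id) (f := fun j => if s.arr 1 j 0 ≠ 0 then u else v)
    Function.injective_id (fun i t hi hx hft => ?_)).1 j hj
  have hy : ∀ y, y ≠ 10 → t.var y = s.var y := fun y hy => by
    have h : (10 == y) = false := by simpa using Ne.symm hy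
    exact hft.var y (by simp [setsVar, h])
  have ha : t.arr 1 = s.arr 1 := hft.arr 1 (by simp [setsArr, h1])
  simp only [Code.den, Expr.eval, hx, ha, id]
  by_cases h : s.arr 1 i 0 = 0
  · rw [if_pos h, hf t hy, if_neg (not_not.2 h)]
    simp only [Store.setArr]
    simp +contextual
  · rw [if_neg h, he t hy, if_pos h]
    simp only [Store.setArr]
    simp +contextual

/-- The load of a machine if it gets a heavy job only. -/
def heavyOn (i : Expr) : Expr := .add (entry 0 i) (.var 2)

/-- The capacities of the machines for light jobs. -/
def ownCap : Code :=
  .loop 10 .machines (.ite (leTest (heavyOn (.var 10)) (.var 5))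
    (setEntry 7 (.var 10)
      (.sub (.add (.var 5) (.half (.var 2))) (.add (heavyOn (.var 10)) (.var 4))))
    (setEntry 7 (.var 10) (.sub (.var 5) (entry 0 (.var 10)))))

/-- The capacities of the pools for light jobs. -/
def poolCap : Code :=
  .loop 10 .machines (.seq (.assign 20 (.const 0)) (.seq (.assign 21 (.const 0))
    (.seq (count 20 11 .machines (andTest (eqTest (entry 4 (.var 11)) (.var 10))
      (leTest (heavyOn (.var 11)) (.var 5))))
    (.seq (count 21 12 .jobs (andTest (entry 1 (.var 12))
      (eqTest (entry 4 (entry 14 (.var 12))) (.var 10))))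
    (.ite (.sub (.var 20) (.var 21))
      (setEntry 7 (.add (.var 0) (.var 10)) (.add (.add (.var 4) (.var 4)) (.var 3)))
      (setEntry 7 (.add (.var 0) (.var 10)) (.const 0)))))))

section

variable {I : Sched} {comp : ℕ → ℕ} {q x : ℕ} {s : Store}

theorem ownCap_spec (h : Setup I comp q x s) {v : ℕ} (hv : v < I.m) :
    (ownCap.den s).arr 7 v 0 = if I.Able (s.var 5) v
      then s.var 5 + I.W / 2 - (I.dl v + I.W + x) else s.var 5 - I.dl v := by
  refine (loop_fill (g := id) (f := fun v => if I.Able (s.var 5) v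
      then s.var 5 + I.W / 2 - (I.dl v + I.W + x) else s.var 5 - I.dl v)
    Function.injective_id (fun i t hi hx hft => ?_)).1 v (by rw [Bound.val, h.m]; exact hv)
  have hi' : i < I.m := by rw [Bound.val, h.m] at hi; exact hi
  have h0 : t.arr 0 i 0 = I.dl i := by rw [hft.arr 0 rfl]; exact h.dl i hi'
  have h2 : t.var 2 = I.W := by rw [hft.var 2 rfl]; exact h.W
  have h4 : t.var 4 = x := by rw [hft.var 4 rfl]; exact h.x_var
  have h5 : t.var 5 = s.var 5 := hft.var 5 rfl
  have htest := leTest_eval (heavyOn (.var 10)) (.var 5) t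
  simp only [heavyOn, Expr.eval, hx, h0, h2, h5] at htest
  change _ ↔ ¬ I.Able (s.var 5) i at htest
  simp only [Code.den, Expr.eval, heavyOn, hx, h0, h2, h4, h5, htest, id]
  by_cases hA : I.Able (s.var 5) i
  · rw [if_neg (not_not.2 hA), if_pos hA]
    simp only [Store.setArr]
    simp +contextual
  · rw [if_pos hA, if_neg hA]
    simp only [Store.setArr]
    simp +contextual

theorem poolCap_spec (h : Setup I comp q x s) :
    (∀ r < I.m, (poolCap.den s).arr 7 (I.m + r) 0 =
      if (I.edges comp r).card < (I.ablePart (s.var 5) comp r).card then x + x + I.w else 0) ∧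
    ∀ v < I.m, (poolCap.den s).arr 7 v 0 = s.arr 7 v 0 := by
  have key := loop_fill (x := 10) (a := 7) (b := .machines) (s := s) (g := fun r => I.m + r)
    (f := fun r => if (I.edges comp r).card < (I.ablePart (s.var 5) comp r).card
      then x + x + I.w else 0) (c := .seq (.assign 20 (.const 0)) (.seq (.assign 21 (.const 0))
    (.seq (count 20 11 .machines (andTest (eqTest (entry 4 (.var 11)) (.var 10))
      (leTest (heavyOn (.var 11)) (.var 5))))
    (.seq (count 21 12 .jobs (andTest (entry 1 (.var 12))
      (eqTest (entry 4 (entry 14 (.var 12))) (.var 10))))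
    (.ite (.sub (.var 20) (.var 21))
      (setEntry 7 (.add (.var 0) (.var 10)) (.add (.add (.var 4) (.var 4)) (.var 3)))
      (setEntry 7 (.add (.var 0) (.var 10)) (.const 0))))))) (add_right_injective I.m) ?_
  · have hm : Bound.machines.val s = I.m := h.m
    rw [hm] at key
    exact ⟨key.1, fun v hv => key.2 v fun i _ => by omega⟩
  · intro i t hi hx hft
    have hi' : i < I.m := by rw [Bound.val, h.m] at hi; exact hi
    have ht : Setup I comp q x t := h.of_frame hft (by decide) (by decide)
    set t1 := (Code.assign 21 (.const 0)).den ((Code.assign 20 (.const 0)).den t) with ht1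
    have ht1v : ∀ y, y ≠ 20 → y ≠ 21 → t1.var y = t.var y := by
      intro y h1 h2; simp [ht1, Code.den, Store.setVar, h1, h2]
    have ht1a : t1.arr = t.arr := rfl
    have hs1 : Setup I comp q x t1 := ht.congr
      (fun y hy => ht1v y (by rintro rfl; simp at hy) (by rintro rfl; simp at hy))
      fun a _ => by rw [ht1a]
    set t2 := (count 20 11 .machines (andTest (eqTest (entry 4 (.var 11)) (.var 10))
      (leTest (heavyOn (.var 11)) (.var 5)))).den t1 with ht2
    have hf2 : Frame (count 20 11 .machines (andTest (eqTest (entry 4 (.var 11)) (.var 10))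
      (leTest (heavyOn (.var 11)) (.var 5)))) t1 t2 := Code.frame _ _
    have hs2 : Setup I comp q x t2 := hs1.of_frame hf2 (by decide) (by decide)
    set t3 := (count 21 12 .jobs (andTest (entry 1 (.var 12))
      (eqTest (entry 4 (entry 14 (.var 12))) (.var 10)))).den t2 with ht3
    have hf3 : Frame (count 21 12 .jobs (andTest (entry 1 (.var 12))
      (eqTest (entry 4 (entry 14 (.var 12))) (.var 10)))) t2 t3 := Code.frame _ _
    have hs3 : Setup I comp q x t3 := hs2.of_frame hf3 (by decide) (by decide)
    have e20 : t3.var 20 = (I.ablePart (s.var 5) comp i).card := by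
      rw [hf3.var 20 rfl, ht2, count_spec (by decide) t1
        (f := fun v => comp v = i ∧ I.Able (s.var 5) v)]
      · rw [show t1.var 20 = 0 from rfl, zero_add, show Bound.machines.val t1 = I.m from hs1.m,
          Sched.ablePart, Sched.part, filter_filter]
      · intro t' hv ha hlt
        rw [show Bound.machines.val t1 = I.m from hs1.m] at hlt
        rw [andTest_eval, eqTest_ne, leTest_ne]
        simp only [heavyOn, Expr.eval, ha]
        rw [hs1.comp_eq _ hlt, hs1.dl _ hlt, hv 10 (by decide) (by decide),
          hv 5 (by decide) (by decide), hv 2 (by decide) (by decide), hs1.W,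
          ht1v 10 (by decide) (by decide), hx, ht1v 5 (by decide) (by decide), hft.var 5 rfl]
        rfl
    have e21 : t3.var 21 = (I.edges comp i).card := by
      rw [ht3, count_spec (by decide) t2
        (f := fun j => I.hv j ∧ ∃ v, I.el j v ∧ comp v = i)]
      · rw [hf2.var 21 rfl, show t1.var 21 = 0 from rfl, zero_add,
          show Bound.jobs.val t2 = I.n from hs2.n, Sched.edges]
      · intro t' hv ha hlt
        rw [show Bound.jobs.val t2 = I.n from hs2.n] at hlt
        rw [andTest_eval, eqTest_ne]
        have hfst := hs2.fst _ hlt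
        simp only [Expr.eval, ha]
        rw [hs2.hv _ hlt, hs2.comp_eq _ (I.el_lt _ _ hfst), hv 10 (by decide) (by decide),
          hf2.var 10 rfl, ht1v 10 (by decide) (by decide), hx]
        -- One eligible machine per job, from array `14`, suffices to tell the component, since all
        -- machines of a heavy job share it.
        refine and_congr_right fun hjh => ⟨fun hc => ⟨_, hfst, hc⟩, ?_⟩
        rintro ⟨v, hv, hvc⟩
        rw [← hvc]
        exact h.isComp.edge _ hlt hjh _ _ hfst hv
    have e10 : t3.var 10 = i := by
      rw [hf3.var 10 rfl, hf2.var 10 rfl, ht1v 10 (by decide) (by decide), hx]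
    have e7 : t3.arr 7 = t.arr 7 := by rw [hf3.arr 7 rfl, hf2.arr 7 rfl, ht1a]
    change ((Code.ite (.sub (.var 20) (.var 21))
      (setEntry 7 (.add (.var 0) (.var 10)) (.add (.add (.var 4) (.var 4)) (.var 3)))
      (setEntry 7 (.add (.var 0) (.var 10)) (.const 0))).den t3).arr 7 (I.m + i) 0 = _ ∧
      ∀ k, k ≠ I.m + i → ((Code.ite (.sub (.var 20) (.var 21))
      (setEntry 7 (.add (.var 0) (.var 10)) (.add (.add (.var 4) (.var 4)) (.var 3)))
      (setEntry 7 (.add (.var 0) (.var 10)) (.const 0))).den t3).arr 7 k 0 = _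
    simp only [Code.den, Expr.eval, e20, e21, e10, hs3.m, hs3.x_var, hs3.w]
    by_cases hlt : (I.edges comp i).card < (I.ablePart (s.var 5) comp i).card
    · rw [if_neg (by omega), if_pos hlt]
      simp only [Store.setArr, e7]
      simp +contextual
    · rw [if_pos (by omega), if_neg hlt]
      simp only [Store.setArr, e7]
      simp +contextual

end

theorem binLoad_congr_of_ne {n : ℕ} {wt pos pos' : ℕ → ℕ}
    (h : ∀ j < n, wt j ≠ 0 → pos j = pos' j) (b : ℕ) :
    binLoad n wt pos b = binLoad n wt pos' b := by
  refine sum_congr rfl fun j hj => ?_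
  by_cases h0 : wt j = 0
  · simp [h0]
  · rw [h j (mem_range.1 hj) h0]

theorem den_seq (c d : Code) (s : Store) : (Code.seq c d).den s = d.den (c.den s) := rfl

/-! #### From bins to machines -/

/-- Array `11` receives machines that belong to the bins in array `9`. -/
def decode : Code :=
  lastMatch 11 .machines (andTest (.arr 2 (.var 10) (.var 11))
    (.add (eqTest (entry 9 (.var 10)) (.var 11))
      (eqTest (entry 9 (.var 10)) (.add (.var 0) (entry 4 (.var 11))))))

/-- Prepare the placement of the light jobs. -/
def lightSetup : Code :=
  .seq plainEl (.seq addPools (.seq ownCap (.seq poolCap (byKind 6 (.const 0) (.var 3)))))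

/-- Place the light jobs. -/
def lightPhase : Code := .seq lightSetup (.seq pushRelabel decode)

/-- The capacities of the machines for heavy jobs. -/
def heavyCap : Code :=
  .loop 10 .machines (.ite (leTest (.add (heavyOn (.var 10)) (entry 10 (.var 10)))
      (.add (.var 5) (.half (.var 2))))
    (setEntry 7 (.var 10) (.const 1)) (setEntry 7 (.var 10) (.const 0)))

/-- Prepare the placement of the heavy jobs. -/
def heavySetup : Code :=
  .seq (loads 11 6 10) (.seq heavyCap (.seq (byKind 6 (.const 1) (.const 0)) plainEl))

/-- Copy the machines of the heavy jobs. -/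
def mergeHeavy : Code :=
  .loop 10 .jobs (.ite (entry 1 (.var 10)) (setEntry 11 (.var 10) (entry 9 (.var 10))) .skip)

/-- Place the heavy jobs. -/
def heavyPhase : Code := .seq heavySetup (.seq pushRelabel mergeHeavy)

/-- The capacities of the machines if heavy jobs are small. -/
def largeCap : Code :=
  .loop 10 .machines (setEntry 7 (.var 10)
    (.sub (.sub (.add (.var 5) (.var 2)) (.const 1)) (entry 0 (.var 10))))

/-- Place all jobs at once. -/
def jointPhase : Code :=
  .seq plainEl (.seq (byKind 6 (.var 2) (.var 3)) (.seq largeCap (.seq pushRelabel decode)))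

/-! ### Correctness of the light, heavy and joint placements -/

section

variable {I : Sched} {comp : ℕ → ℕ} {q x : ℕ} {s : Store}

theorem decode_spec (h : Setup I comp q x s) {j : ℕ} (hj : j < I.n)
    (hex : ∃ v, I.el j v ∧ (s.arr 9 j 0 = v ∨ s.arr 9 j 0 = I.m + comp v)) :
    I.el j (col (decode.den s) 11 j) ∧
      (s.arr 9 j 0 = col (decode.den s) 11 j ∨
        s.arr 9 j 0 = I.m + comp (col (decode.den s) 11 j)) := by
  have hm : Bound.machines.val s = I.m := h.m
  have key := lastMatch_spec (p := 11) (b := .machines) s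
    (e := andTest (.arr 2 (.var 10) (.var 11)) (.add (eqTest (entry 9 (.var 10)) (.var 11))
      (eqTest (entry 9 (.var 10)) (.add (.var 0) (entry 4 (.var 11))))))
    (f := fun j v => s.arr 2 j v ≠ 0 ∧ (s.arr 9 j 0 = v ∨ s.arr 9 j 0 = s.var 0 + s.arr 4 v 0))
    (fun t hv ha => by
      have hadd : ∀ a b : Expr, (Expr.add a b).eval t ≠ 0 ↔ a.eval t ≠ 0 ∨ b.eval t ≠ 0 := by
        intro a b; simp only [Expr.eval]; omega
      rw [andTest_eval, hadd, eqTest_ne, eqTest_ne]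
      simp only [Expr.eval, ha 2 (by decide), ha 9 (by decide), ha 4 (by decide),
        hv 0 (by decide) (by decide)]) (j := j) (by rw [h.n]; exact hj) ?_
  · obtain ⟨h1, h2, h3⟩ : col (decode.den s) 11 j < Bound.machines.val s ∧
        s.arr 2 j (col (decode.den s) 11 j) ≠ 0 ∧ (s.arr 9 j 0 = col (decode.den s) 11 j ∨
          s.arr 9 j 0 = s.var 0 + s.arr 4 (col (decode.den s) 11 j) 0) := key
    rw [hm] at h1
    rw [h.m] at h3
    refine ⟨(h.el j hj _).1 h2, ?_⟩
    rw [← h.comp_eq _ h1]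
    exact h3
  · obtain ⟨v, hv, hpos⟩ := hex
    have hvm := I.el_lt _ _ hv
    refine ⟨v, hm ▸ hvm, (h.el j hj v).2 hv, ?_⟩
    rw [h.comp_eq v hvm, h.m]
    exact hpos

theorem plainEl_rel (h : Setup I comp q x s) : ∀ j < I.n, ∀ b < 2 * I.m,
    (rel (plainEl.den s) 5 j b ↔ I.el j b) := by
  intro j hj b hb
  rw [rel, plainEl_spec s (by rwa [h.n]) (by rwa [h.m])]
  exact h.el j hj b

theorem byKind_spec' (h : Setup I comp q x s) {e f : Expr} {u v : ℕ}
    (he : ∀ t : Store, (∀ y, y ≠ 10 → t.var y = s.var y) → e.eval t = u)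
    (hf : ∀ t : Store, (∀ y, y ≠ 10 → t.var y = s.var y) → f.eval t = v) {j : ℕ}
    (hj : j < I.n) : col ((byKind 6 e f).den s) 6 j = if I.hv j then u else v := by
  rw [col, byKind_spec s (by decide) he hf (by rwa [h.n])]
  simp only [h.hv j hj]

theorem lightSetup_spec (h : Setup I comp q x s) :
    (∀ j < I.n, ∀ b < 2 * I.m, (rel (lightSetup.den s) 5 j b ↔ I.PoolEl comp j b)) ∧
    I.PoolCap (s.var 5) comp q x (col (lightSetup.den s) 7) ∧
    ∀ j < I.n, col (lightSetup.den s) 6 j = I.w * I.light j := by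
  obtain ⟨s1, hs1⟩ : ∃ t, t = plainEl.den s := ⟨_, rfl⟩
  have f1 : Frame plainEl s s1 := hs1 ▸ Code.frame _ _
  have h1 : Setup I comp q x s1 := h.of_frame f1 (by decide) (by decide)
  obtain ⟨s2, hs2⟩ : ∃ t, t = addPools.den s1 := ⟨_, rfl⟩
  have f2 : Frame addPools s1 s2 := hs2 ▸ Code.frame _ _
  have h2 : Setup I comp q x s2 := h1.of_frame f2 (by decide) (by decide)
  obtain ⟨s3, hs3⟩ : ∃ t, t = ownCap.den s2 := ⟨_, rfl⟩
  have f3 : Frame ownCap s2 s3 := hs3 ▸ Code.frame _ _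
  have h3 : Setup I comp q x s3 := h2.of_frame f3 (by decide) (by decide)
  obtain ⟨s4, hs4⟩ : ∃ t, t = poolCap.den s3 := ⟨_, rfl⟩
  have f4 : Frame poolCap s3 s4 := hs4 ▸ Code.frame _ _
  have h4 : Setup I comp q x s4 := h3.of_frame f4 (by decide) (by decide)
  obtain ⟨s5, hs5⟩ : ∃ t, t = (byKind 6 (.const 0) (.var 3)).den s4 := ⟨_, rfl⟩
  have f5 : Frame (byKind 6 (.const 0) (.var 3)) s4 s5 := hs5 ▸ Code.frame _ _
  have hden : lightSetup.den s = s5 := by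
    simp only [lightSetup, den_seq, hs5, hs4, hs3, hs2, hs1]
  rw [hden]
  have t2 : s2.var 5 = s.var 5 := by rw [f2.var 5 rfl, f1.var 5 rfl]
  have t3 : s3.var 5 = s.var 5 := by rw [f3.var 5 rfl, t2]
  have hpool := poolCap_spec h3
  rw [← hs4, t3] at hpool
  refine ⟨fun j hj b hb => ?_, ⟨h.x_eq, h.x_le, h.x_max, ?_, ?_, ?_, ?_⟩, fun j hj => ?_⟩
  · rw [rel, f5.arr 5 rfl, f4.arr 5 rfl, f3.arr 5 rfl, hs2,
      addPools_spec s1 (by rwa [h1.n]), Sched.PoolEl, ← plainEl_rel h j hj b hb, ← hs1]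
    refine or_congr_right ?_
    rw [h1.m]
    constructor
    · rintro ⟨v, hv, h2, h3⟩
      exact ⟨v, (h1.el j hj v).1 h2, h1.comp_eq v hv ▸ h3⟩
    · rintro ⟨v, h2, h3⟩
      have hv := I.el_lt _ _ h2
      exact ⟨v, hv, (h1.el j hj v).2 h2, (h1.comp_eq v hv).symm ▸ h3⟩
  · intro v hv hA
    rw [col, f5.arr 7 rfl, hpool.2 v hv, hs3, ownCap_spec h2 hv, t2, if_pos hA]
  · intro v hv hA
    rw [col, f5.arr 7 rfl, hpool.2 v hv, hs3, ownCap_spec h2 hv, t2, if_neg hA]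
  · intro r hr hlt
    rw [col, f5.arr 7 rfl, hpool.1 r hr, if_pos hlt]
  · intro r hr hlt
    rw [col, f5.arr 7 rfl, hpool.1 r hr, if_neg hlt]
  · rw [hs5, byKind_spec' h4 (u := 0) (v := I.w) (fun _ _ => rfl)
      (fun t ht => by rw [Expr.eval, ht 3 (by decide), h4.w]) hj, Sched.light]
    split_ifs <;> simp

theorem pushRelabel_spec' (h : Setup I comp q x s) {wmax : ℕ} {E : ℕ → ℕ → Prop}
    (hE : ∀ j < I.n, ∀ b < 2 * I.m, (rel s 5 j b ↔ E j b)) (hex : ∀ j < I.n, ∀ v, I.el j v → E j v)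
    (hwt : ∀ j < I.n, col s 6 j ≤ wmax) :
    (∀ j < I.n, col (pushRelabel.den s) 9 j < 2 * I.m ∧ E j (col (pushRelabel.den s) 9 j)) ∧
    ((∀ p S, ¬ FullSet (2 * I.m) I.n (rel s 5) (col s 6) (col s 7) wmax p S) →
      ∀ b < 2 * I.m, binLoad I.n (col s 6) (col (pushRelabel.den s) 9) b ≤ col s 7 b) := by
  have key := pushRelabel_spec s (wmax := wmax) ?_ ?_
  · rw [h.m, h.n] at key
    refine ⟨fun j hj => ?_, key.2⟩
    obtain ⟨h1, h2⟩ := key.1 j hj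
    exact ⟨h1, (hE j hj _ h1).1 h2⟩
  · rw [h.m, h.n]
    intro j hj
    have h1 := h.fst j hj
    have h2 := I.el_lt _ _ h1
    exact ⟨_, by omega, (hE j hj _ (by omega)).2 (hex j hj _ h1)⟩
  · rwa [h.n]

/-- Heavy jobs take part with weight `0`: they do not affect the loads and get a provisional
eligible machine. Only the bounds on the loads depend on the guess being correct. -/
theorem lightPhase_spec (h : Setup I comp q x s) :
    (∀ j < I.n, I.el j (col (lightPhase.den s) 11 j)) ∧
    (∀ j < I.n, col (lightPhase.den s) 6 j = I.w * I.light j) ∧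
    ∀ σ, I.Fits (s.var 5) σ → s.var 5 < 2 * I.W → ∃ cap pos, I.PoolCap (s.var 5) comp q x cap ∧
      I.LightPlaced cap comp pos (col (lightPhase.den s) 11) := by
  obtain ⟨hE, hcap, hwt⟩ := lightSetup_spec h
  obtain ⟨s1, hs1⟩ : ∃ t, t = lightSetup.den s := ⟨_, rfl⟩
  rw [← hs1] at hE hcap hwt
  have f1 : Frame lightSetup s s1 := hs1 ▸ Code.frame _ _
  have h1 : Setup I comp q x s1 := h.of_frame f1 (by decide) (by decide)
  have hpr := pushRelabel_spec' (wmax := I.w) h1 hE (fun j _ v hv => Or.inl hv) (fun j hj => by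
    rw [hwt j hj, Sched.light]; split_ifs <;> simp)
  obtain ⟨s2, hs2⟩ : ∃ t, t = pushRelabel.den s1 := ⟨_, rfl⟩
  rw [← hs2] at hpr
  have f2 : Frame pushRelabel s1 s2 := hs2 ▸ Code.frame _ _
  have h2 : Setup I comp q x s2 := h1.of_frame f2 (by decide) (by decide)
  have hdec : ∀ j < I.n, I.el j (col (decode.den s2) 11 j) ∧
      (s2.arr 9 j 0 = col (decode.den s2) 11 j ∨
        s2.arr 9 j 0 = I.m + comp (col (decode.den s2) 11 j)) := by
    intro j hj
    refine decode_spec h2 hj ?_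
    obtain ⟨-, h3 | ⟨v, hv, h3⟩⟩ := hpr.1 j hj
    · exact ⟨_, h3, Or.inl rfl⟩
    · exact ⟨v, hv, Or.inr h3.symm⟩
  obtain ⟨s3, hs3⟩ : ∃ t, t = decode.den s2 := ⟨_, rfl⟩
  rw [← hs3] at hdec
  have f3 : Frame decode s2 s3 := hs3 ▸ Code.frame _ _
  have hden : lightPhase.den s = s3 := by simp only [lightPhase, den_seq, hs3, hs2, hs1]
  rw [hden]
  refine ⟨fun j hj => (hdec j hj).1, fun j hj => ?_, fun σ hσ hT => ?_⟩
  · rw [col, f3.arr 6 rfl, f2.arr 6 rfl]; exact hwt j hj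
  · refine ⟨col s1 7, col s2 9, hcap, fun b hb => ?_, fun j hj => I.el_lt _ _ (hdec j hj).1,
      fun j hj => (hdec j hj).2⟩
    have h4 := hpr.2 (Sched.not_fullSet_light h1.isComp hσ hT hE hcap hwt) b hb
    rwa [binLoad_linear (f := I.light) (g := I.light) (a := I.w) (b := 0)
      (fun j hj => by rw [hwt j hj]; simp), zero_mul, add_zero] at h4

theorem heavyCap_spec (h : Setup I comp q x s) {v : ℕ} (hv : v < I.m) :
    col (heavyCap.den s) 7 v =
      if I.dl v + I.W + s.arr 10 v 0 ≤ s.var 5 + I.W / 2 then 1 else 0 := by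
  refine (loop_fill (g := id) (f := fun v =>
      if I.dl v + I.W + s.arr 10 v 0 ≤ s.var 5 + I.W / 2 then 1 else 0)
    Function.injective_id (fun i t hi hx hft => ?_)).1 v (by rw [Bound.val, h.m]; exact hv)
  have hi' : i < I.m := by rw [Bound.val, h.m] at hi; exact hi
  have h0 : t.arr 0 i 0 = I.dl i := by rw [hft.arr 0 rfl]; exact h.dl i hi'
  have h2 : t.var 2 = I.W := by rw [hft.var 2 rfl]; exact h.W
  have h5 : t.var 5 = s.var 5 := hft.var 5 rfl
  have h10 : t.arr 10 = s.arr 10 := hft.arr 10 rfl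
  have htest := leTest_eval (.add (heavyOn (.var 10)) (entry 10 (.var 10)))
    (.add (.var 5) (.half (.var 2))) t
  simp only [heavyOn, Expr.eval, hx, h0, h2, h5, h10] at htest
  simp only [Code.den, Expr.eval, heavyOn, hx, htest, id]
  by_cases hA : I.dl i + I.W + s.arr 10 i 0 ≤ s.var 5 + I.W / 2
  · rw [if_neg (not_not.2 hA), if_pos hA]
    simp only [Store.setArr]
    simp +contextual
  · rw [if_pos hA, if_neg hA]
    simp only [Store.setArr]
    simp +contextual

theorem mergeHeavy_spec (h : Setup I comp q x s) {j : ℕ} (hj : j < I.n) :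
    col (mergeHeavy.den s) 11 j = if I.hv j then s.arr 9 j 0 else s.arr 11 j 0 := by
  have key := loop_induction (x := 10) (b := .jobs)
    (c := .ite (entry 1 (.var 10)) (setEntry 11 (.var 10) (entry 9 (.var 10))) .skip) (s := s)
    (P := fun r t => t.arr 11 j 0 = if j < r ∧ I.hv j then s.arr 9 j 0 else s.arr 11 j 0) ?_ ?_
  · rw [show Bound.jobs.val s = I.n from h.n] at key
    simp only [hj, true_and] at key
    exact key
  · simp [Store.setVar]
  · intro i t hi hx hft hP
    have hi' : i < I.n := by rw [Bound.val, h.n] at hi; exact hi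
    have h1 : t.arr 1 = s.arr 1 := hft.arr 1 rfl
    have h9 : t.arr 9 = s.arr 9 := hft.arr 9 rfl
    have h2 := h.hv i hi'
    simp only [Code.den, Expr.eval, hx, h1]
    by_cases hz : s.arr 1 i 0 = 0
    · have hni : ¬ I.hv i := fun hi => h2.2 hi hz
      rw [if_pos hz]
      simp only [Store.setVar]
      rw [hP]
      by_cases hji : j = i
      · subst hji; simp [hni]
      · simp only [show (j < i + 1) ↔ (j < i) by omega]
    · have hhi : I.hv i := h2.1 hz
      rw [if_neg hz]
      simp only [Store.setVar, Store.setArr, h9]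
      by_cases hji : j = i
      · subst hji; simp [hhi]
      · rw [if_neg (by simp [hji]), hP]
        simp only [show (j < i + 1) ↔ (j < i) by omega]

/-- The capacities are computed from the light loads after the pools have been emptied. Light jobs
take part with weight `0` and their new bins are ignored: only heavy jobs are copied into array
`11`. -/
theorem heavyPhase_spec (h : Setup I comp q x s)
    (hwt : ∀ j < I.n, col s 6 j = I.w * I.light j) (hel : ∀ j < I.n, I.el j (col s 11 j)) :
    (∀ j < I.n, I.el j (col (heavyPhase.den s) 11 j)) ∧
    ∀ σ cap pos, I.Fits (s.var 5) σ → s.var 5 < 2 * I.W → I.PoolCap (s.var 5) comp q x cap →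
      I.LightPlaced cap comp pos (col s 11) → ∀ v < I.m,
      I.W * (I.dl v + binLoad I.n I.wt (col (heavyPhase.den s) 11) v) ≤
        (I.W + I.W / 2) * s.var 5 := by
  obtain ⟨s1, hs1⟩ : ∃ t, t = (loads 11 6 10).den s := ⟨_, rfl⟩
  have f1 : Frame (loads 11 6 10) s s1 := hs1 ▸ Code.frame _ _
  have h1 : Setup I comp q x s1 := h.of_frame f1 (by decide) (by decide)
  have hload : ∀ v < I.m, s1.arr 10 v 0 = I.w * binLoad I.n I.light (col s 11) v := by
    intro v hv
    rw [hs1, loads_spec (by decide) (by decide) s (by rw [h.m]; omega), h.n,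
      binLoad_linear (f := I.light) (g := I.light) (a := I.w) (b := 0)
      (fun j hj => by rw [← col, hwt j hj]; simp), zero_mul, add_zero]
  obtain ⟨s2, hs2⟩ : ∃ t, t = heavyCap.den s1 := ⟨_, rfl⟩
  have f2 : Frame heavyCap s1 s2 := hs2 ▸ Code.frame _ _
  have h2 : Setup I comp q x s2 := h1.of_frame f2 (by decide) (by decide)
  obtain ⟨s3, hs3⟩ : ∃ t, t = (byKind 6 (.const 1) (.const 0)).den s2 := ⟨_, rfl⟩
  have f3 : Frame (byKind 6 (.const 1) (.const 0)) s2 s3 := hs3 ▸ Code.frame _ _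
  have h3 : Setup I comp q x s3 := h2.of_frame f3 (by decide) (by decide)
  obtain ⟨s4, hs4⟩ : ∃ t, t = plainEl.den s3 := ⟨_, rfl⟩
  have f4 : Frame plainEl s3 s4 := hs4 ▸ Code.frame _ _
  have h4 : Setup I comp q x s4 := h3.of_frame f4 (by decide) (by decide)
  have hE := plainEl_rel h3
  rw [← hs4] at hE
  have hwt4 : ∀ j < I.n, col s4 6 j = I.heavy j := by
    intro j hj
    rw [col, f4.arr 6 rfl, ← col, hs3,
      byKind_spec' h2 (u := 1) (v := 0) (fun _ _ => rfl) (fun _ _ => rfl) hj]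
    rfl
  have hcap4 : ∀ v < I.m, col s4 7 v =
      if I.dl v + I.w * binLoad I.n I.light (col s 11) v + I.W ≤ s.var 5 + I.W / 2
        then 1 else 0 := by
    intro v hv
    rw [col, f4.arr 7 rfl, f3.arr 7 rfl, ← col, hs2, heavyCap_spec h1 hv, f1.var 5 rfl, hload v hv,
      add_right_comm]
  have hpr := pushRelabel_spec' (wmax := 1) h4 hE (fun j _ v hv => hv) (fun j hj => by
    rw [hwt4 j hj, Sched.heavy]; split_ifs <;> simp)
  obtain ⟨s5, hs5⟩ : ∃ t, t = pushRelabel.den s4 := ⟨_, rfl⟩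
  rw [← hs5] at hpr
  have f5 : Frame pushRelabel s4 s5 := hs5 ▸ Code.frame _ _
  have h5 : Setup I comp q x s5 := h4.of_frame f5 (by decide) (by decide)
  have h11 : s5.arr 11 = s.arr 11 := by
    rw [f5.arr 11 rfl, f4.arr 11 rfl, f3.arr 11 rfl, f2.arr 11 rfl, f1.arr 11 rfl]
  have hmerge : ∀ j < I.n, col (heavyPhase.den s) 11 j =
      if I.hv j then col s5 9 j else col s 11 j := by
    intro j hj
    have : heavyPhase.den s = mergeHeavy.den s5 := by
      simp only [heavyPhase, heavySetup, den_seq, hs5, hs4, hs3, hs2, hs1]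
    rw [this, mergeHeavy_spec h5 hj, h11]
  refine ⟨fun j hj => ?_, fun σ cap pos hσ hT hcap hp v hv => ?_⟩
  · rw [hmerge j hj]
    split_ifs
    · exact (hpr.1 j hj).2
    · exact hel j hj
  · have h6 := hpr.2 (Sched.not_fullSet_heavy h.isComp hσ hT hcap hp hE hcap4 hwt4) v (by omega)
    rw [binLoad_congr hwt4 (fun _ _ => rfl), hcap4 v hv] at h6
    rw [I.binLoad_wt, binLoad_congr_of_ne (wt := I.light) (pos' := col s 11),
      binLoad_congr_of_ne (wt := I.heavy) (pos' := col s5 9)]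
    · exact Sched.load_le_of_placed h.isComp hσ hcap hp hv h6
    · intro j hj h0
      rw [hmerge j hj, if_pos]
      by_contra hcon
      exact h0 (if_neg hcon)
    · intro j hj h0
      rw [hmerge j hj, if_neg]
      intro hcon
      exact h0 (if_pos hcon)

theorem largeCap_spec (h : Setup I comp q x s) {v : ℕ} (hv : v < I.m) :
    col (largeCap.den s) 7 v = s.var 5 + I.W - 1 - I.dl v := by
  refine (loop_fill (g := id) (f := fun v => s.var 5 + I.W - 1 - I.dl v)
    Function.injective_id (fun i t hi hx hft => ?_)).1 v (by rw [Bound.val, h.m]; exact hv)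
  have hi' : i < I.m := by rw [Bound.val, h.m] at hi; exact hi
  have h0 : t.arr 0 i 0 = I.dl i := by rw [hft.arr 0 rfl]; exact h.dl i hi'
  have h2 : t.var 2 = I.W := by rw [hft.var 2 rfl]; exact h.W
  have h5 : t.var 5 = s.var 5 := hft.var 5 rfl
  simp only [Code.den, Expr.eval, hx, h0, h2, h5, id, Store.setArr]
  simp +contextual

theorem jointPhase_spec (h : Setup I comp q x s) :
    (∀ j < I.n, I.el j (col (jointPhase.den s) 11 j)) ∧
    ∀ σ, I.Fits (s.var 5) σ → 2 * I.W ≤ s.var 5 → ∀ v < I.m,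
      I.W * (I.dl v + binLoad I.n I.wt (col (jointPhase.den s) 11) v) ≤
        (I.W + I.W / 2) * s.var 5 := by
  obtain ⟨s1, hs1⟩ : ∃ t, t = plainEl.den s := ⟨_, rfl⟩
  have f1 : Frame plainEl s s1 := hs1 ▸ Code.frame _ _
  have h1 : Setup I comp q x s1 := h.of_frame f1 (by decide) (by decide)
  obtain ⟨s2, hs2⟩ : ∃ t, t = (byKind 6 (.var 2) (.var 3)).den s1 := ⟨_, rfl⟩
  have f2 : Frame (byKind 6 (.var 2) (.var 3)) s1 s2 := hs2 ▸ Code.frame _ _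
  have h2 : Setup I comp q x s2 := h1.of_frame f2 (by decide) (by decide)
  obtain ⟨s3, hs3⟩ : ∃ t, t = largeCap.den s2 := ⟨_, rfl⟩
  have f3 : Frame largeCap s2 s3 := hs3 ▸ Code.frame _ _
  have h3 : Setup I comp q x s3 := h2.of_frame f3 (by decide) (by decide)
  have hE : ∀ j < I.n, ∀ b < 2 * I.m, (rel s3 5 j b ↔ I.el j b) := by
    intro j hj b hb
    rw [rel, f3.arr 5 rfl, f2.arr 5 rfl, hs1]
    exact plainEl_rel h j hj b hb
  have hwt3 : ∀ j < I.n, col s3 6 j = I.wt j := by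
    intro j hj
    rw [col, f3.arr 6 rfl, ← col, hs2, byKind_spec' h1 (u := I.W) (v := I.w)
      (fun t ht => by rw [Expr.eval, ht 2 (by decide), h1.W])
      (fun t ht => by rw [Expr.eval, ht 3 (by decide), h1.w]) hj]
    rfl
  have hcap3 : ∀ v < I.m, col s3 7 v = s.var 5 + I.W - 1 - I.dl v := by
    intro v hv
    rw [hs3, largeCap_spec h2 hv, f2.var 5 rfl, f1.var 5 rfl]
  have hpr := pushRelabel_spec' (wmax := I.W) h3 hE (fun j _ v hv => hv) (fun j hj => by
    have := I.two_w
    rw [hwt3 j hj, Sched.wt]; split_ifs <;> omega)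
  obtain ⟨s4, hs4⟩ : ∃ t, t = pushRelabel.den s3 := ⟨_, rfl⟩
  rw [← hs4] at hpr
  have f4 : Frame pushRelabel s3 s4 := hs4 ▸ Code.frame _ _
  have h4 : Setup I comp q x s4 := h3.of_frame f4 (by decide) (by decide)
  have hdec : ∀ j < I.n, I.el j (col (decode.den s4) 11 j) ∧
      (s4.arr 9 j 0 = col (decode.den s4) 11 j ∨
        s4.arr 9 j 0 = I.m + comp (col (decode.den s4) 11 j)) := fun j hj =>
    decode_spec h4 hj ⟨_, (hpr.1 j hj).2, Or.inl rfl⟩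
  have hden : jointPhase.den s = decode.den s4 := by
    simp only [jointPhase, den_seq, hs4, hs3, hs2, hs1]
  rw [hden]
  refine ⟨fun j hj => (hdec j hj).1, fun σ hσ hT v hv => ?_⟩
  have h5 := hpr.2 (Sched.not_fullSet_of_two_mul_le hσ hE hcap3 hwt3) v (by omega)
  -- Without pools the bin of a job is a machine, hence below `m`, and decoding does not change it.
  rw [binLoad_congr hwt3 (pos' := col (decode.den s4) 11) (fun j hj => by
    obtain h6 | h6 := (hdec j hj).2
    · exact h6
    · have := I.el_lt _ _ (hpr.1 j hj).2
      rw [col] at this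
      omega), hcap3 v hv] at h5
  refine Sched.load_le_of_two_mul_le hT ?_
  have := hσ.le v hv
  have := I.w_pos
  have := I.two_w
  omega

end

/-! #### Preparations -/

/-- The memory describes the instance. -/
structure Base (I : Sched) (s : Store) : Prop where
  m : s.var 0 = I.m
  n : s.var 1 = I.n
  W : s.var 2 = I.W
  w : s.var 3 = I.w
  dl : ∀ v < I.m, s.arr 0 v 0 = I.dl v
  hv : ∀ j < I.n, (s.arr 1 j 0 ≠ 0 ↔ I.hv j)
  el : ∀ j < I.n, ∀ v, (s.arr 2 j v ≠ 0 ↔ I.el j v)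

theorem Base.of_frame {I : Sched} {s t : Store} (h : Base I s) {c : Code} (hf : Frame c s t)
    (hv : ∀ y ∈ [0, 1, 2, 3], c.setsVar y = false)
    (ha : ∀ a ∈ [0, 1, 2], c.setsArr a = false) : Base I t where
  m := (hf.var 0 (hv 0 (by simp))).trans h.m
  n := (hf.var 1 (hv 1 (by simp))).trans h.n
  W := (hf.var 2 (hv 2 (by simp))).trans h.W
  w := (hf.var 3 (hv 3 (by simp))).trans h.w
  dl := by rw [hf.arr 0 (ha 0 (by simp))]; exact h.dl
  hv := by rw [hf.arr 1 (ha 1 (by simp))]; exact h.hv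
  el := by rw [hf.arr 2 (ha 2 (by simp))]; exact h.el

/-- Merge two components. -/
def mergeComp : Code :=
  .seq (.assign 20 (entry 4 (.var 12))) (.seq (.assign 21 (entry 4 (.var 13)))
    (.loop 14 .machines (.ite (eqTest (entry 4 (.var 14)) (.var 21))
      (setEntry 4 (.var 14) (.var 20)) .skip)))

/-- Compute the components of the heavy graph. -/
def components : Code :=
  .seq (.loop 10 .machines (setEntry 4 (.var 10) (.var 10)))
    (.loop 11 .jobs (.ite (entry 1 (.var 11))
      (.loop 12 .machines (.ite (.arr 2 (.var 11) (.var 12))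
        (.loop 13 .machines (.ite (.arr 2 (.var 11) (.var 13)) mergeComp .skip)) .skip)) .skip))

/-- Compute the largest multiple of the weight of a light job that is needed. -/
def slack : Code :=
  .seq (.assign 4 (.const 0)) (.loop 10 .jobs
    (.ite (leTest (.add (.var 4) (.var 3)) (.half (.var 2))) (.assign 4 (.add (.var 4) (.var 3)))
      .skip))

/-- Everything that does not depend on the makespan. -/
def prelim : Code :=
  .seq components (.seq (lastMatch 14 .machines (.arr 2 (.var 10) (.var 11)))
    (.seq (byKind 15 (.var 2) (.var 3)) slack))

/-- Both names are saved in variables before the loop, because the loop itself overwrites array `4`.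
-/
theorem mergeComp_spec (s : Store) {y : ℕ} (hy : y < s.var 0) :
    col (mergeComp.den s) 4 y =
      if col s 4 y = col s 4 (s.var 13) then col s 4 (s.var 12) else col s 4 y := by
  obtain ⟨t, ht⟩ : ∃ t, t = (Code.assign 21 (entry 4 (.var 13))).den
    ((Code.assign 20 (entry 4 (.var 12))).den s) := ⟨_, rfl⟩
  have h20 : t.var 20 = col s 4 (s.var 12) := by
    simp [ht, Code.den, Store.setVar, Expr.eval]
  have h21 : t.var 21 = col s 4 (s.var 13) := by
    simp [ht, Code.den, Store.setVar, Expr.eval]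
  have h0 : t.var 0 = s.var 0 := by
    simp [ht, Code.den, Store.setVar]
  have ha : t.arr = s.arr := by rw [ht]; rfl
  have key := loop_induction (x := 14) (b := .machines)
    (c := .ite (eqTest (entry 4 (.var 14)) (.var 21)) (setEntry 4 (.var 14) (.var 20)) .skip)
    (s := t) (P := fun r t' => ∀ y, t'.arr 4 y 0 =
      if y < r ∧ col s 4 y = col s 4 (s.var 13) then col s 4 (s.var 12) else col s 4 y) ?_ ?_
  · have hden : mergeComp.den s = (Code.loop 14 .machines
      (.ite (eqTest (entry 4 (.var 14)) (.var 21)) (setEntry 4 (.var 14) (.var 20))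
        .skip)).den t := by
      rw [ht]; rfl
    rw [hden, col, key y, show Bound.machines.val t = s.var 0 from h0]
    simp only [hy, true_and]
  · intro y
    simp [Store.setVar, ha, col]
  · intro i t' _ hx hf hP y
    have e20 : t'.var 20 = col s 4 (s.var 12) := (hf.var 20 rfl).trans h20
    have e21 : t'.var 21 = col s 4 (s.var 13) := (hf.var 21 rfl).trans h21
    have hi : t'.arr 4 i 0 = col s 4 i := by rw [hP i, if_neg (by omega)]
    have htest := eqTest_eval (entry 4 (.var 14)) (.var 21) t'
    simp only [Expr.eval, hx, hi, e21] at htest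
    simp only [Code.den, Expr.eval, hx, htest, e20]
    by_cases hc : col s 4 i = col s 4 (s.var 13)
    · rw [if_neg (not_not.2 hc)]
      simp only [Store.setVar, Store.setArr]
      by_cases hyi : y = i
      · subst hyi; simp [hc]
      · rw [if_neg (by simp [hyi]), hP y]
        simp only [show (y < i + 1) ↔ (y < i) by omega]
    · rw [if_pos hc]
      simp only [Store.setVar]
      rw [hP y]
      by_cases hyi : y = i
      · subst hyi; simp [hc]
      · simp only [show (y < i + 1) ↔ (y < i) by omega]

/-- Some pairs of adjacent machines have been merged. -/
structure Merged (I : Sched) (D : Set (ℕ × ℕ)) (t : Store) : Prop where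
  base : Base I t
  lt : ∀ v < I.m, col t 4 v < I.m
  conn : ∀ S : Set ℕ, (∀ j < I.n, I.hv j → ∀ u v, I.el j u → I.el j v → (u ∈ S ↔ v ∈ S)) →
    ∀ x < I.m, ∀ y < I.m, col t 4 x = col t 4 y → (x ∈ S ↔ y ∈ S)
  pairs : ∀ p ∈ D, p.1 < I.m → p.2 < I.m → col t 4 p.1 = col t 4 p.2

section

variable {I : Sched} {s t : Store} {D D' : Set (ℕ × ℕ)}

theorem Merged.mono (h : Merged I D t) (hD : D' ⊆ D) : Merged I D' t :=
  ⟨h.base, h.lt, h.conn, fun p hp => h.pairs p (hD hp)⟩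

theorem Merged.setVar (h : Merged I D t) {x : ℕ} (hx : 4 ≤ x) (v : ℕ) :
    Merged I D (t.setVar x v) := by
  refine ⟨?_, h.lt, h.conn, h.pairs⟩
  have hv : ∀ y < 4, (t.setVar x v).var y = t.var y := fun y hy => by
    simp [Store.setVar, show y ≠ x by omega]
  exact ⟨(hv 0 (by decide)).trans h.base.m, (hv 1 (by decide)).trans h.base.n,
    (hv 2 (by decide)).trans h.base.W, (hv 3 (by decide)).trans h.base.w, h.base.dl, h.base.hv,
    h.base.el⟩

/-- A set that respects all heavy jobs contains both or none of the merged machines, so membership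
can be traced through them and `conn` survives. A whole class is renamed at once, so pairs merged
earlier stay together. -/
theorem Merged.mergeComp (h : Merged I D t) {j : ℕ} (hj : j < I.n) (hv : I.hv j)
    (h12 : I.el j (t.var 12)) (h13 : I.el j (t.var 13)) :
    Merged I (D ∪ {(t.var 12, t.var 13)}) (mergeComp.den t) := by
  have hspec : ∀ y < I.m, col (GraphBalancing.mergeComp.den t) 4 y =
      if col t 4 y = col t 4 (t.var 13) then col t 4 (t.var 12) else col t 4 y :=
    fun y hy => mergeComp_spec t (by rwa [h.base.m])
  have hu := I.el_lt _ _ h12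
  have hw := I.el_lt _ _ h13
  refine ⟨h.base.of_frame (Code.frame _ _) (by decide) (by decide), fun y hy => ?_,
    fun S hS x hx y hy hxy => ?_, fun p hp h1 h2 => ?_⟩
  · rw [hspec y hy]
    split_ifs
    · exact h.lt _ hu
    · exact h.lt _ hy
  · rw [hspec x hx, hspec y hy] at hxy
    have huv := hS j hj hv _ _ h12 h13
    have hc := h.conn S hS
    split_ifs at hxy with h1 h2 h2
    · rw [hc x hx _ hw h1, hc y hy _ hw h2]
    · rw [hc x hx _ hw h1, ← huv, hc _ hu y hy hxy]
    · rw [hc y hy _ hw h2, ← huv, hc x hx _ hu hxy]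
    · exact hc x hx y hy hxy
  · rw [hspec _ h1, hspec _ h2]
    rcases hp with hp | rfl
    · rw [h.pairs p hp h1 h2]
    · simp

/-- Starting from singletons, every pair of machines of a heavy job is merged. The set `D` of
treated pairs turns into `edge` at the end, and `conn` holds throughout. -/
theorem components_spec (h : Base I s) : I.IsComp (col (components.den s) 4) := by
  obtain ⟨s1, hs1⟩ : ∃ t, t = (Code.loop 10 .machines (setEntry 4 (.var 10) (.var 10))).den s :=
    ⟨_, rfl⟩
  have f1 : Frame (.loop 10 .machines (setEntry 4 (.var 10) (.var 10))) s s1 :=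
    hs1 ▸ Code.frame _ _
  have h1 : Base I s1 := h.of_frame f1 (by decide) (by decide)
  have hid : ∀ v < I.m, col s1 4 v = v := by
    intro v hv
    rw [hs1]
    refine (loop_fill (g := id) (f := id) Function.injective_id (fun i t hi hx hft => ?_)).1 v
      (by rw [Bound.val, h.m]; exact hv)
    simp only [Code.den, Expr.eval, hx, id, Store.setArr]
    simp +contextual
  have hM : Merged I ∅ s1 := by
    refine ⟨h1, fun v hv => by rwa [hid v hv], fun S _ x hx y hy hxy => ?_, fun p hp => ?_⟩
    · rw [hid x hx, hid y hy] at hxy; rw [hxy]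
    · exact absurd hp (Set.notMem_empty p)
  have key := loop_collect (x := 11) (b := .jobs) (s := s1) (c := .ite (entry 1 (.var 11))
      (.loop 12 .machines (.ite (.arr 2 (.var 11) (.var 12))
        (.loop 13 .machines (.ite (.arr 2 (.var 11) (.var 13)) mergeComp .skip)) .skip)) .skip)
    (G := Merged I) (F := fun j => {p | I.hv j ∧ I.el j p.1 ∧ I.el j p.2})
    (fun D t v hG => hG.setVar (by decide) v) ?_ hM
  · have hden : components.den s = (Code.loop 11 .jobs (.ite (entry 1 (.var 11))
      (.loop 12 .machines (.ite (.arr 2 (.var 11) (.var 12))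
        (.loop 13 .machines (.ite (.arr 2 (.var 11) (.var 13)) GraphBalancing.mergeComp .skip))
          .skip)) .skip)).den s1 := by simp only [components, den_seq, hs1]
    rw [show Bound.jobs.val s1 = I.n from h1.n, ← hden] at key
    refine ⟨key.lt, fun j hj hjh u v hu hv => ?_, key.conn⟩
    exact key.pairs (u, v) (Or.inr ⟨j, hj, hjh, hu, hv⟩) (I.el_lt _ _ hu) (I.el_lt _ _ hv)
  · intro j t D hj hx _ hG
    rw [Bound.val, h1.n] at hj
    have hjv := hG.base.hv j hj
    simp only [Code.den, Expr.eval, hx]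
    by_cases hz : t.arr 1 j 0 = 0
    · rw [if_pos hz]
      refine hG.mono ?_
      rintro p (hp | ⟨hp, -⟩)
      · exact hp
      · exact absurd hz (hjv.2 hp)
    · rw [if_neg hz]
      have hjh := hjv.1 hz
      have key2 := loop_collect (x := 12) (b := .machines) (s := t)
        (c := .ite (.arr 2 (.var 11) (.var 12))
          (.loop 13 .machines (.ite (.arr 2 (.var 11) (.var 13)) mergeComp .skip)) .skip)
        (G := Merged I) (F := fun u => {p | p.1 = u ∧ I.el j p.1 ∧ I.el j p.2})
        (fun D t v hG => hG.setVar (by decide) v) ?_ hG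
      · refine key2.mono ?_
        rintro p (hp | ⟨-, hp1, hp2⟩)
        · exact Or.inl hp
        · exact Or.inr ⟨p.1, by rw [Bound.val, hG.base.m]; exact I.el_lt _ _ hp1, rfl, hp1, hp2⟩
      · intro u t2 D2 hu hx2 hf2 hG2
        have e11 : t2.var 11 = j := (hf2.var 11 rfl).trans hx
        have hju := hG2.base.el j hj u
        simp only [Code.den, Expr.eval, hx2, e11]
        by_cases hz2 : t2.arr 2 j u = 0
        · rw [if_pos hz2]
          refine hG2.mono ?_
          rintro p (hp | ⟨rfl, hp, -⟩)
          · exact hp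
          · exact absurd hz2 (hju.2 hp)
        · rw [if_neg hz2]
          have hju' := hju.1 hz2
          have key3 := loop_collect (x := 13) (b := .machines) (s := t2)
            (c := .ite (.arr 2 (.var 11) (.var 13)) mergeComp .skip)
            (G := Merged I) (F := fun v => {p | p.1 = u ∧ p.2 = v ∧ I.el j p.2})
            (fun D t v hG => hG.setVar (by decide) v) ?_ hG2
          · refine key3.mono ?_
            rintro p (hp | ⟨hp1, -, hp2⟩)
            · exact Or.inl hp
            · exact Or.inr ⟨p.2, by rw [Bound.val, hG2.base.m]; exact I.el_lt _ _ hp2,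
                hp1, rfl, hp2⟩
          · intro v t3 D3 hv hx3 hf3 hG3
            have e11' : t3.var 11 = j := (hf3.var 11 rfl).trans e11
            have e12 : t3.var 12 = u := (hf3.var 12 rfl).trans hx2
            have hjv' := hG3.base.el j hj v
            rw [Code.den]
            simp only [Expr.eval, hx3, e11']
            by_cases hz3 : t3.arr 2 j v = 0
            · rw [if_pos hz3]
              refine hG3.mono ?_
              rintro p (hp | ⟨-, rfl, hp⟩)
              · exact hp
              · exact absurd hz3 (hjv'.2 hp)
            · rw [if_neg hz3]
              refine (hG3.mergeComp hj hjh (e12.symm ▸ hju') (hx3.symm ▸ hjv'.1 hz3)).mono ?_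
              rintro p (hp | ⟨hp1, hp2, -⟩)
              · exact Or.inl hp
              · right
                rw [e12, hx3]
                exact Prod.ext hp1 hp2

/-- The machine cannot divide by `w`, so `x` is built by at most `n` additions. Stopping at `q = n`
does no harm, since no machine has more than `n` light jobs. -/
theorem slack_spec (h : Base I s) : ∃ q, (slack.den s).var 4 = q * I.w ∧
    (slack.den s).var 4 ≤ I.W / 2 ∧ (I.W / 2 < (slack.den s).var 4 + I.w ∨ q = I.n) := by
  obtain ⟨t, ht⟩ : ∃ t, t = (Code.assign 4 (.const 0)).den s := ⟨_, rfl⟩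
  have f : Frame (.assign 4 (.const 0)) s t := ht ▸ Code.frame _ _
  have hb : Base I t := h.of_frame f (by decide) (by decide)
  have h4 : t.var 4 = 0 := by simp [ht, Code.den, Store.setVar, Expr.eval]
  have key := loop_induction (x := 10) (b := .jobs) (s := t)
    (c := .ite (leTest (.add (.var 4) (.var 3)) (.half (.var 2)))
      (.assign 4 (.add (.var 4) (.var 3))) .skip)
    (P := fun r t' => ∃ q, t'.var 4 = q * I.w ∧ t'.var 4 ≤ I.W / 2 ∧
      (I.W / 2 < t'.var 4 + I.w ∨ q = r)) ?_ ?_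
  · rw [show Bound.jobs.val t = I.n from hb.n] at key
    rwa [slack, den_seq, ← ht]
  · exact ⟨0, by simp [Store.setVar, h4]⟩
  · rintro i t' _ _ hf ⟨q, h1, h2, h3⟩
    have e3 : t'.var 3 = I.w := (hf.var 3 rfl).trans hb.w
    have e2 : t'.var 2 = I.W := (hf.var 2 rfl).trans hb.W
    have htest := leTest_eval (.add (.var 4) (.var 3)) (.half (.var 2)) t'
    simp only [Expr.eval, e2, e3] at htest
    simp only [Code.den, htest]
    by_cases hle : t'.var 4 + I.w ≤ I.W / 2
    · rw [if_neg (not_not.2 hle)]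
      refine ⟨q + 1, ?_⟩
      -- If there is still room, no earlier round has skipped its addition.
      have hq : q = i := h3.resolve_left (by omega)
      simp [Store.setVar, Expr.eval, e3, add_mul, h1, hq]
      rw [h1, hq] at hle
      exact hle
    · rw [if_pos hle]
      refine ⟨q, ?_⟩
      simp only [Store.setVar]
      exact ⟨h1, h2, Or.inl (by simpa using hle)⟩

theorem prelim_spec (h : Base I s) (hex : ∀ j < I.n, ∃ v, I.el j v) :
    ∃ comp q x, Setup I comp q x (prelim.den s) := by
  obtain ⟨s1, hs1⟩ : ∃ t, t = components.den s := ⟨_, rfl⟩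
  have f1 : Frame components s s1 := hs1 ▸ Code.frame _ _
  have h1 : Base I s1 := h.of_frame f1 (by decide) (by decide)
  obtain ⟨s2, hs2⟩ : ∃ t, t = (lastMatch 14 .machines (.arr 2 (.var 10) (.var 11))).den s1 :=
    ⟨_, rfl⟩
  have f2 : Frame (lastMatch 14 .machines (.arr 2 (.var 10) (.var 11))) s1 s2 :=
    hs2 ▸ Code.frame _ _
  have h2 : Base I s2 := h1.of_frame f2 (by decide) (by decide)
  obtain ⟨s3, hs3⟩ : ∃ t, t = (byKind 15 (.var 2) (.var 3)).den s2 := ⟨_, rfl⟩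
  have f3 : Frame (byKind 15 (.var 2) (.var 3)) s2 s3 := hs3 ▸ Code.frame _ _
  have h3 : Base I s3 := h2.of_frame f3 (by decide) (by decide)
  obtain ⟨s4, hs4⟩ : ∃ t, t = slack.den s3 := ⟨_, rfl⟩
  have f4 : Frame slack s3 s4 := hs4 ▸ Code.frame _ _
  have h4 : Base I s4 := h3.of_frame f4 (by decide) (by decide)
  have hden : prelim.den s = s4 := by simp only [prelim, den_seq, hs4, hs3, hs2, hs1]
  obtain ⟨q, hq, hx, hmax⟩ := slack_spec h3
  rw [← hs4] at hq hx hmax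
  refine ⟨col s1 4, q, s4.var 4, ?_⟩
  rw [hden]
  refine ⟨h4.m, h4.n, h4.W, h4.w, rfl, h4.dl, h4.hv, h4.el, fun v _ => ?_, fun j hj => ?_,
    fun j hj => ?_, hs1 ▸ components_spec h, hq, hx, hmax⟩
  · rw [f4.arr 4 rfl, f3.arr 4 rfl, f2.arr 4 rfl]
  · rw [f4.arr 14 rfl, f3.arr 14 rfl, ← h1.el j hj, hs2]
    obtain ⟨v, hv⟩ := hex j hj
    exact (lastMatch_spec s1 (f := fun j u => s1.arr 2 j u ≠ 0)
      (fun t _ ha => by simp only [Expr.eval, ha 2 (by decide)]) (by rwa [h1.n])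
      ⟨v, by rw [Bound.val, h1.m]; exact I.el_lt _ _ hv, (h1.el j hj v).2 hv⟩).2
  · rw [f4.arr 15 rfl, hs3, byKind_spec s2 (by decide) (u := I.W) (v := I.w)
      (fun t ht => by rw [Expr.eval, ht 2 (by decide), h2.W])
      (fun t ht => by rw [Expr.eval, ht 3 (by decide), h2.w]) (by rwa [h2.n]), Sched.wt]
    simp only [h2.hv j hj]

end

/-! #### Keeping the best assignment

Array `3` holds the best assignment so far, variable `7` its makespan. Variable `8` tells whether
there is one. -/

/-- Store the largest load in variable `20`. -/
def maxLoad : Code :=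
  .seq (.assign 20 (.const 0)) (.loop 10 .machines
    (.ite (.sub (.add (entry 0 (.var 10)) (entry 10 (.var 10))) (.var 20))
      (.assign 20 (.add (entry 0 (.var 10)) (entry 10 (.var 10)))) .skip))

/-- Store the assignment in array `11`. -/
def copySol : Code := .loop 10 .jobs (setEntry 3 (.var 10) (entry 11 (.var 10)))

/-- Store the assignment in array `11` if it is better than the best one so far. -/
def record : Code :=
  .seq (loads 11 15 10) (.seq maxLoad
    (.ite (.add (.sub (.const 1) (.var 8)) (.sub (.var 7) (.var 20)))
      (.seq copySol (.seq (.assign 7 (.var 20)) (.assign 8 (.const 1)))) .skip))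

theorem maxLoad_spec (s : Store) :
    (∀ v < s.var 0, s.arr 0 v 0 + s.arr 10 v 0 ≤ (maxLoad.den s).var 20) ∧
    ((maxLoad.den s).var 20 = 0 ∨
      ∃ v < s.var 0, (maxLoad.den s).var 20 = s.arr 0 v 0 + s.arr 10 v 0) := by
  obtain ⟨t, ht⟩ : ∃ t, t = (Code.assign 20 (.const 0)).den s := ⟨_, rfl⟩
  have f : Frame (.assign 20 (.const 0)) s t := ht ▸ Code.frame _ _
  have h20 : t.var 20 = 0 := by simp [ht, Code.den, Store.setVar, Expr.eval]
  have key := loop_induction (x := 10) (b := .machines) (s := t)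
    (c := .ite (.sub (.add (entry 0 (.var 10)) (entry 10 (.var 10))) (.var 20))
      (.assign 20 (.add (entry 0 (.var 10)) (entry 10 (.var 10)))) .skip)
    (P := fun r t' => (∀ v < r, s.arr 0 v 0 + s.arr 10 v 0 ≤ t'.var 20) ∧
      (t'.var 20 = 0 ∨ ∃ v < r, t'.var 20 = s.arr 0 v 0 + s.arr 10 v 0)) ?_ ?_
  · rw [show Bound.machines.val t = s.var 0 from f.var 0 rfl] at key
    rwa [maxLoad, den_seq, ← ht]
  · exact ⟨fun v hv => absurd hv (by omega), Or.inl (by simpa [Store.setVar] using h20)⟩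
  · rintro i t' _ hx hf ⟨h1, h2⟩
    have e0 : t'.arr 0 = s.arr 0 := (hf.arr 0 rfl).trans (f.arr 0 rfl)
    have e10 : t'.arr 10 = s.arr 10 := (hf.arr 10 rfl).trans (f.arr 10 rfl)
    simp only [Code.den, Expr.eval, hx, e0, e10]
    split_ifs with hz
    · simp only [Store.setVar]
      refine ⟨fun v hv => ?_, h2.imp id fun ⟨v, hv, h⟩ => ⟨v, by omega, h⟩⟩
      rcases Nat.lt_succ_iff_lt_or_eq.1 hv with h | rfl
      · exact h1 v h
      · exact Nat.sub_eq_zero_iff_le.1 hz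
    · simp only [Store.setVar]
      refine ⟨fun v hv => ?_, Or.inr ⟨i, by omega, by simp⟩⟩
      rcases Nat.lt_succ_iff_lt_or_eq.1 hv with h | rfl
      · have := h1 v h
        simp only [if_neg (show ¬ (20 : ℕ) = 10 by decide), if_true]
        omega
      · simp

theorem copySol_spec (s : Store) {j : ℕ} (hj : j < s.var 1) :
    col (copySol.den s) 3 j = col s 11 j := by
  refine (loop_fill (g := id) (f := col s 11) Function.injective_id
    (fun i t hi hx hft => ?_)).1 j hj
  have h11 : t.arr 11 = s.arr 11 := hft.arr 11 rfl
  simp only [Code.den, Expr.eval, hx, id, Store.setArr, h11]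
  simp +contextual

/-- If there is a best assignment, then it is an assignment and its makespan is known. -/
def Best (I : Sched) (t : Store) : Prop :=
  t.var 8 ≠ 0 → (∀ j < I.n, I.el j (col t 3 j)) ∧
    ∀ v < I.m, I.dl v + binLoad I.n I.wt (col t 3) v ≤ t.var 7

section

variable {I : Sched} {comp : ℕ → ℕ} {q x : ℕ} {s t : Store}

theorem Best.of_frame (h : Best I s) {c : Code} (hf : Frame c s t)
    (hv : ∀ y ∈ [7, 8], c.setsVar y = false) (ha : c.setsArr 3 = false) : Best I t := by
  have h7 := hf.var 7 (hv 7 (by simp))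
  have h8 := hf.var 8 (hv 8 (by simp))
  have h3 : ∀ j, col t 3 j = col s 3 j := fun j => by rw [col, hf.arr 3 ha]
  simpa only [Best, h7, h8, h3, funext h3] using h

/-- The recorded makespan never increases and never exceeds that of the current assignment, so what
a correct guess achieves survives all later guesses. The factor `W` avoids fractions. -/
theorem record_spec (h : Setup I comp q x s) (hb : Best I s)
    (hel : ∀ j < I.n, I.el j (col s 11 j)) :
    Best I (record.den s) ∧ (record.den s).var 8 ≠ 0 ∧
    (s.var 8 ≠ 0 → (record.den s).var 7 ≤ s.var 7) ∧
    ∀ B, (∀ v < I.m, I.W * (I.dl v + binLoad I.n I.wt (col s 11) v) ≤ B) →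
      I.W * (record.den s).var 7 ≤ B := by
  obtain ⟨s1, hs1⟩ : ∃ t, t = (loads 11 15 10).den s := ⟨_, rfl⟩
  have f1 : Frame (loads 11 15 10) s s1 := hs1 ▸ Code.frame _ _
  have h1 : Setup I comp q x s1 := h.of_frame f1 (by decide) (by decide)
  have hload : ∀ v < I.m, s1.arr 10 v 0 = binLoad I.n I.wt (col s 11) v := by
    intro v hv
    rw [hs1, loads_spec (by decide) (by decide) s (by rw [h.m]; omega), h.n]
    exact binLoad_congr (pos' := col s 11) h.wt (fun _ _ => rfl) v
  obtain ⟨s2, hs2⟩ : ∃ t, t = maxLoad.den s1 := ⟨_, rfl⟩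
  have f2 : Frame maxLoad s1 s2 := hs2 ▸ Code.frame _ _
  have h2 : Setup I comp q x s2 := h1.of_frame f2 (by decide) (by decide)
  have b2 : Best I s2 :=
    (hb.of_frame f1 (by decide) (by decide)).of_frame f2 (by decide) (by decide)
  obtain ⟨hmax, hatt⟩ := maxLoad_spec s1
  rw [← hs2, h1.m] at hmax hatt
  have hmax' : ∀ v < I.m, I.dl v + binLoad I.n I.wt (col s 11) v ≤ s2.var 20 := by
    intro v hv
    rw [← hload v hv, ← h1.dl v hv]
    exact hmax v hv
  have hatt' : ∀ B, (∀ v < I.m, I.W * (I.dl v + binLoad I.n I.wt (col s 11) v) ≤ B) →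
      I.W * s2.var 20 ≤ B := by
    intro B hB
    rcases hatt with h0 | ⟨v, hv, h0⟩
    · rw [h0]; exact Nat.zero_le _
    · rw [h0, hload v hv, h1.dl v hv]
      exact hB v hv
  have e7 : s2.var 7 = s.var 7 := (f2.var 7 rfl).trans (f1.var 7 rfl)
  have e8 : s2.var 8 = s.var 8 := (f2.var 8 rfl).trans (f1.var 8 rfl)
  have hden : record.den s = (Code.ite (.add (.sub (.const 1) (.var 8)) (.sub (.var 7) (.var 20)))
      (.seq copySol (.seq (.assign 7 (.var 20)) (.assign 8 (.const 1)))) .skip).den s2 := by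
    simp only [record, den_seq, hs2, hs1]
  rw [hden, Code.den]
  split_ifs with hz
  · simp only [Expr.eval] at hz
    rw [Code.den]
    refine ⟨b2, by omega, fun _ => e7.le, fun B hB => ?_⟩
    exact (Nat.mul_le_mul_left _ (by omega)).trans (hatt' B hB)
  · simp only [Expr.eval] at hz
    obtain ⟨s3, hs3⟩ : ∃ t, t = copySol.den s2 := ⟨_, rfl⟩
    have f3 : Frame copySol s2 s3 := hs3 ▸ Code.frame _ _
    have e20 : s3.var 20 = s2.var 20 := f3.var 20 rfl
    have e11 : s2.arr 11 = s.arr 11 := (f2.arr 11 rfl).trans (f1.arr 11 rfl)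
    have hcopy : ∀ j < I.n, s3.arr 3 j 0 = col s 11 j := by
      intro j hj
      have := copySol_spec s2 (j := j) (by rwa [h2.n])
      rw [← hs3, col, col, e11] at this
      exact this
    rw [den_seq, ← hs3]
    simp only [Code.den, Expr.eval, e20]
    refine ⟨fun _ => ⟨fun j hj => ?_, fun v hv => ?_⟩, by simp [Store.setVar], fun h8 => ?_,
      fun B hB => ?_⟩
    · simp only [col, Store.setVar, hcopy j hj]
      exact hel j hj
    · simp only [Store.setVar]
      rw [binLoad_congr (wt' := I.wt) (pos' := col s 11) (fun _ _ => rfl) hcopy]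
      exact hmax' v hv
    · simp [Store.setVar]
      omega
    · simpa [Store.setVar] using hatt' B hB

/-- Try one makespan. -/
def attempt : Code := .seq (.seq lightPhase heavyPhase) (.seq record (.seq jointPhase record))

/-- The best assignment is good enough for the makespan `T`. -/
def Won (I : Sched) (T : ℕ) (t : Store) : Prop :=
  t.var 8 ≠ 0 ∧ I.W * t.var 7 ≤ (I.W + I.W / 2) * T

theorem Won.of_frame {T : ℕ} (h : Won I T s) {c : Code} (hf : Frame c s t)
    (hv : ∀ y ∈ [7, 8], c.setsVar y = false) : Won I T t := by
  have h7 := hf.var 7 (hv 7 (by simp))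
  have h8 := hf.var 8 (hv 8 (by simp))
  simpa only [Won, h7, h8] using h

theorem Won.record {T : ℕ} (hw : Won I T s) (h : Setup I comp q x s) (hb : Best I s)
    (hel : ∀ j < I.n, I.el j (col s 11 j)) : Won I T (record.den s) := by
  have key := record_spec h hb hel
  exact ⟨key.2.1, (Nat.mul_le_mul_left _ (key.2.2.1 hw.1)).trans hw.2⟩

/-- Both methods are run for every guess without testing whether `T < 2 * W`; the one that applies
to the true `T` yields the bound. Here `T` is fixed, while variable `5` holds the current guess,
which may be wrong. -/
theorem attempt_spec (h : Setup I comp q x s) (hb : Best I s) {T : ℕ} {σ : ℕ → ℕ}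
    (hσ : I.Fits T σ) :
    Setup I comp q x (attempt.den s) ∧ Best I (attempt.den s) ∧
    (Won I T s ∨ s.var 5 = T → Won I T (attempt.den s)) := by
  obtain ⟨s1, hs1⟩ : ∃ t, t = lightPhase.den s := ⟨_, rfl⟩
  have f1 : Frame lightPhase s s1 := hs1 ▸ Code.frame _ _
  have h1 : Setup I comp q x s1 := h.of_frame f1 (by decide) (by decide)
  obtain ⟨hel1, hwt1, hpl⟩ := lightPhase_spec h
  rw [← hs1] at hel1 hwt1 hpl
  obtain ⟨s2, hs2⟩ : ∃ t, t = heavyPhase.den s1 := ⟨_, rfl⟩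
  have f2 : Frame heavyPhase s1 s2 := hs2 ▸ Code.frame _ _
  have h2 : Setup I comp q x s2 := h1.of_frame f2 (by decide) (by decide)
  have b2 : Best I s2 :=
    (hb.of_frame f1 (by decide) (by decide)).of_frame f2 (by decide) (by decide)
  obtain ⟨hel2, hle2⟩ := heavyPhase_spec h1 hwt1 hel1
  rw [← hs2] at hel2 hle2
  obtain ⟨s3, hs3⟩ : ∃ t, t = record.den s2 := ⟨_, rfl⟩
  have f3 : Frame record s2 s3 := hs3 ▸ Code.frame _ _
  have h3 : Setup I comp q x s3 := h2.of_frame f3 (by decide) (by decide)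
  have r3 := record_spec h2 b2 hel2
  have w3 : Won I T s2 → Won I T s3 := fun hw => hs3 ▸ hw.record h2 b2 hel2
  rw [← hs3] at r3
  obtain ⟨s4, hs4⟩ : ∃ t, t = jointPhase.den s3 := ⟨_, rfl⟩
  have f4 : Frame jointPhase s3 s4 := hs4 ▸ Code.frame _ _
  have h4 : Setup I comp q x s4 := h3.of_frame f4 (by decide) (by decide)
  have b4 : Best I s4 := r3.1.of_frame f4 (by decide) (by decide)
  obtain ⟨hel4, hle4⟩ := jointPhase_spec h3
  rw [← hs4] at hel4 hle4
  have w5 : Won I T s4 → Won I T (record.den s4) := fun hw => hw.record h4 b4 hel4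
  obtain ⟨s5, hs5⟩ : ∃ t, t = record.den s4 := ⟨_, rfl⟩
  have f5 : Frame record s4 s5 := hs5 ▸ Code.frame _ _
  have h5 : Setup I comp q x s5 := h4.of_frame f5 (by decide) (by decide)
  have r5 := record_spec h4 b4 hel4
  rw [← hs5] at w5 r5
  have hden : attempt.den s = s5 := by simp only [attempt, den_seq, hs5, hs4, hs3, hs2, hs1]
  rw [hden]
  have w43 : Won I T s3 → Won I T s5 := fun hw => w5 (hw.of_frame f4 (by decide))
  refine ⟨h5, r5.1, ?_⟩
  rintro (hw | hT)
  · exact w43 (w3 ((hw.of_frame f1 (by decide)).of_frame f2 (by decide)))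
  · have t1 : s1.var 5 = T := (f1.var 5 rfl).trans hT
    have t3 : s3.var 5 = T := by rw [f3.var 5 rfl, f2.var 5 rfl, t1]
    rw [hT] at hpl
    rw [t1] at hle2
    rw [t3] at hle4
    by_cases h2W : T < 2 * I.W
    · obtain ⟨cap, pos, hcap, hlp⟩ := hpl σ hσ h2W
      exact w43 ⟨r3.2.1, r3.2.2.2 _ (hle2 σ cap pos hσ h2W hcap hlp)⟩
    · exact ⟨r5.2.1, r5.2.2.2 _ (hle4 σ hσ (not_lt.1 h2W))⟩

end

/-! #### Trying all makespans -/

/-- Try the makespans `t + b * w`, where variable `6` holds `t`. -/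
def tryLight : Code :=
  .seq (.assign 5 (.var 6)) (.loop 25 (.add .jobs (.const 1))
    (.seq attempt (.assign 5 (.add (.var 5) (.var 3)))))

/-- Try the makespans `t + a * W + b * w`, where `t` is the dedicated load of the machine in
variable `23`. -/
def tryHeavy : Code :=
  .seq (.assign 6 (entry 0 (.var 23))) (.loop 24 (.add .jobs (.const 1))
    (.seq tryLight (.assign 6 (.add (.var 6) (.var 2)))))

/-- The algorithm. -/
def main : Code := .seq prelim (.loop 23 .machines tryHeavy)

section

variable {I : Sched} {comp : ℕ → ℕ} {q x T : ℕ} {σ : ℕ → ℕ} {s t : Store}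

/-- What all loops maintain; `P` tells whether the makespan `T` has been tried. -/
structure Tried (I : Sched) (comp : ℕ → ℕ) (q x T : ℕ) (P : Prop) (t : Store) : Prop where
  setup : Setup I comp q x t
  best : Best I t
  won : P → Won I T t

theorem Tried.mono {P P' : Prop} (h : Tried I comp q x T P t) (hP : P' → P) :
    Tried I comp q x T P' t := ⟨h.setup, h.best, h.won ∘ hP⟩

theorem Tried.of_frame {P : Prop} (h : Tried I comp q x T P s) {c : Code} (hf : Frame c s t)
    (hv : ∀ y ∈ [0, 1, 2, 3, 4, 7, 8], c.setsVar y = false)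
    (ha : ∀ a ∈ [0, 1, 2, 3, 4, 14, 15], c.setsArr a = false) : Tried I comp q x T P t where
  setup := h.setup.of_frame hf (fun y hy => hv y (by simp at hy ⊢; tauto))
    (fun a hy => ha a (by simp at hy ⊢; tauto))
  best := h.best.of_frame hf (fun y hy => hv y (by simp at hy ⊢; tauto)) (ha 3 (by simp))
  won hP := (h.won hP).of_frame hf (fun y hy => hv y (by simp at hy ⊢; tauto))

theorem Tried.setVar {P : Prop} (h : Tried I comp q x T P t) {y : ℕ} (hy : 9 ≤ y) (v : ℕ) :
    Tried I comp q x T P (t.setVar y v) := by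
  have key : ∀ z ∈ [0, 1, 2, 3, 4, 7, 8], (Code.assign y (.const v)).setsVar z = false := by
    intro z hz
    simp only [List.mem_cons, List.not_mem_nil, or_false] at hz
    simp only [setsVar, beq_eq_false_iff_ne]
    omega
  exact h.of_frame (Code.frame (.assign y (.const v)) t) key (fun _ _ => rfl)

theorem Tried.attempt {P : Prop} (h : Tried I comp q x T P t) (hσ : I.Fits T σ) :
    Tried I comp q x T (P ∨ t.var 5 = T) (attempt.den t) := by
  obtain ⟨h1, h2, h3⟩ := attempt_spec h.setup h.best hσ
  exact ⟨h1, h2, fun hP => h3 (hP.imp_left h.won)⟩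

theorem Tried.tryLight {P : Prop} (h : Tried I comp q x T P s) (hσ : I.Fits T σ) :
    Tried I comp q x T (P ∨ ∃ b < I.n + 1, s.var 6 + b * I.w = T) (tryLight.den s) := by
  obtain ⟨t, ht⟩ : ∃ t, t = (Code.assign 5 (.var 6)).den s := ⟨_, rfl⟩
  have f : Frame (.assign 5 (.var 6)) s t := ht ▸ Code.frame _ _
  have h5 : t.var 5 = s.var 6 := by simp [ht, Code.den, Store.setVar, Expr.eval]
  have h1 : Tried I comp q x T P t := h.of_frame f (by decide) (by decide)
  have key := loop_induction (x := 25) (b := .add .jobs (.const 1)) (s := t)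
    (c := .seq GraphBalancing.attempt (.assign 5 (.add (.var 5) (.var 3))))
    (P := fun r t' => Tried I comp q x T (P ∨ ∃ b < r, s.var 6 + b * I.w = T) t' ∧
      t'.var 5 = s.var 6 + r * I.w) ?_ ?_
  · rw [show (Bound.add .jobs (.const 1)).val t = I.n + 1 by simp [Bound.val, h1.setup.n]] at key
    rw [GraphBalancing.tryLight, den_seq, ← ht]
    exact key.1
  · refine ⟨(h1.setVar (by decide) _).mono ?_, by simpa [Store.setVar] using h5⟩
    rintro (hP | ⟨b, hb, -⟩)
    · exact hP
    · omega
  · rintro i t' _ _ _ ⟨hT, e5⟩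
    have a1 := hT.attempt hσ
    obtain ⟨u, hu⟩ : ∃ u, u = GraphBalancing.attempt.den t' := ⟨_, rfl⟩
    have fu : Frame GraphBalancing.attempt t' u := hu ▸ Code.frame _ _
    rw [← hu] at a1
    have u5 : u.var 5 = s.var 6 + i * I.w := (fu.var 5 rfl).trans e5
    obtain ⟨v, hv⟩ : ∃ v, v = (Code.assign 5 (.add (.var 5) (.var 3))).den u := ⟨_, rfl⟩
    have fv : Frame (.assign 5 (.add (.var 5) (.var 3))) u v := hv ▸ Code.frame _ _
    have v5 : v.var 5 = s.var 6 + (i + 1) * I.w := by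
      simp [hv, Code.den, Store.setVar, Expr.eval, u5, a1.setup.w]
      ring
    rw [den_seq, ← hu, ← hv]
    refine ⟨((a1.of_frame fv (by decide) (by decide)).setVar (by decide) _).mono ?_, ?_⟩
    · rintro (hP | ⟨b, hb, hbT⟩)
      · exact Or.inl (Or.inl hP)
      · rcases Nat.lt_succ_iff_lt_or_eq.1 hb with hlt | rfl
        · exact Or.inl (Or.inr ⟨b, hlt, hbT⟩)
        · exact Or.inr (e5.trans hbT)
    · simpa [Store.setVar] using v5

theorem Tried.tryHeavy {P : Prop} (h : Tried I comp q x T P s) (hσ : I.Fits T σ)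
    (h23 : s.var 23 < I.m) :
    Tried I comp q x T
      (P ∨ ∃ a < I.n + 1, ∃ b < I.n + 1, I.dl (s.var 23) + a * I.W + b * I.w = T)
      (tryHeavy.den s) := by
  obtain ⟨t, ht⟩ : ∃ t, t = (Code.assign 6 (entry 0 (.var 23))).den s := ⟨_, rfl⟩
  have f : Frame (.assign 6 (entry 0 (.var 23))) s t := ht ▸ Code.frame _ _
  have h6 : t.var 6 = I.dl (s.var 23) := by
    rw [← h.setup.dl _ h23, ht]
    simp [Code.den, Store.setVar, Expr.eval]
  have h1 : Tried I comp q x T P t := h.of_frame f (by decide) (by decide)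
  have key := loop_induction (x := 24) (b := .add .jobs (.const 1)) (s := t)
    (c := .seq GraphBalancing.tryLight (.assign 6 (.add (.var 6) (.var 2))))
    (P := fun r t' => Tried I comp q x T
        (P ∨ ∃ a < r, ∃ b < I.n + 1, I.dl (s.var 23) + a * I.W + b * I.w = T) t' ∧
      t'.var 6 = I.dl (s.var 23) + r * I.W) ?_ ?_
  · rw [show (Bound.add .jobs (.const 1)).val t = I.n + 1 by simp [Bound.val, h1.setup.n]] at key
    rw [GraphBalancing.tryHeavy, den_seq, ← ht]
    exact key.1
  · refine ⟨(h1.setVar (by decide) _).mono ?_, by simpa [Store.setVar] using h6⟩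
    rintro (hP | ⟨a, ha, -⟩)
    · exact hP
    · omega
  · rintro i t' _ _ _ ⟨hT, e6⟩
    have a1 := hT.tryLight hσ
    obtain ⟨u, hu⟩ : ∃ u, u = GraphBalancing.tryLight.den t' := ⟨_, rfl⟩
    have fu : Frame GraphBalancing.tryLight t' u := hu ▸ Code.frame _ _
    rw [← hu] at a1
    have u6 : u.var 6 = I.dl (s.var 23) + i * I.W := (fu.var 6 rfl).trans e6
    obtain ⟨v, hv⟩ : ∃ v, v = (Code.assign 6 (.add (.var 6) (.var 2))).den u := ⟨_, rfl⟩
    have fv : Frame (.assign 6 (.add (.var 6) (.var 2))) u v := hv ▸ Code.frame _ _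
    have v6 : v.var 6 = I.dl (s.var 23) + (i + 1) * I.W := by
      simp [hv, Code.den, Store.setVar, Expr.eval, u6, a1.setup.W]
      ring
    rw [den_seq, ← hu, ← hv]
    refine ⟨((a1.of_frame fv (by decide) (by decide)).setVar (by decide) _).mono ?_, ?_⟩
    · rintro (hP | ⟨a, ha, hab⟩)
      · exact Or.inl (Or.inl hP)
      · rcases Nat.lt_succ_iff_lt_or_eq.1 ha with hlt | rfl
        · exact Or.inl (Or.inr ⟨a, hlt, hab⟩)
        · exact Or.inr (by rwa [e6])
    · simpa [Store.setVar] using v6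

theorem main_spec (h : Base I s) (h8 : s.var 8 = 0) (hσ : I.Fits T σ)
    (hT : ∃ v < I.m, ∃ a < I.n + 1, ∃ b < I.n + 1, I.dl v + a * I.W + b * I.w = T) :
    (∀ j < I.n, I.el j (col (main.den s) 3 j)) ∧
    ∀ v < I.m, I.W * (I.dl v + binLoad I.n I.wt (col (main.den s) 3) v) ≤
      (I.W + I.W / 2) * T := by
  obtain ⟨comp, q, x, h1⟩ := prelim_spec h fun j hj => ⟨_, hσ.el j hj⟩
  obtain ⟨t, ht⟩ : ∃ t, t = prelim.den s := ⟨_, rfl⟩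
  have f : Frame prelim s t := ht ▸ Code.frame _ _
  rw [← ht] at h1
  have t8 : t.var 8 = 0 := (f.var 8 rfl).trans h8
  have key := loop_induction (x := 23) (b := .machines) (s := t) (c := tryHeavy)
    (P := fun r t' => Tried I comp q x T
        (∃ v < r, ∃ a < I.n + 1, ∃ b < I.n + 1, I.dl v + a * I.W + b * I.w = T) t') ?_ ?_
  · rw [show Bound.machines.val t = I.m from h1.m] at key
    rw [main, den_seq, ← ht]
    have hwon := key.won hT
    obtain ⟨hel, hle⟩ := key.best hwon.1
    exact ⟨hel, fun v hv => (Nat.mul_le_mul_left _ (hle v hv)).trans hwon.2⟩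
  -- Nothing has been recorded yet, so `Best` holds vacuously.
  · have h0 : Tried I comp q x T False t := ⟨h1, fun h => absurd t8 h, False.elim⟩
    exact (h0.setVar (by decide) _).mono fun ⟨v, hv, _⟩ => absurd hv (by omega)
  · intro i t' hi hx _ hP
    rw [Bound.val, h1.m] at hi
    have a1 := hP.tryHeavy hσ (hx.symm ▸ hi)
    refine (a1.setVar (by decide) _).mono ?_
    rintro ⟨v, hv, hab⟩
    rcases Nat.lt_succ_iff_lt_or_eq.1 hv with hlt | rfl
    · exact Or.inl ⟨v, hlt, hab⟩
    · exact Or.inr (by rwa [hx])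

end

/-! ### The instance -/

theorem Sched.heavy_le (I : Sched) (pos : ℕ → ℕ) (b : ℕ) :
    binLoad I.n I.heavy pos b ≤ I.n := by
  calc binLoad I.n I.heavy pos b ≤ ∑ j ∈ range I.n, 1 := by
        refine sum_le_sum fun j _ => ?_
        unfold heavy; split_ifs <;> simp
    _ = I.n := by simp

variable (I : TwoSizeInstance)

/-- The instance with jobs and machines named by natural numbers. -/
noncomputable def sched (h2 : 2 * I.w ≤ I.W) : Sched where
  m := I.machines
  n := I.jobs
  W := I.W
  w := I.w
  dl v := if h : v < I.machines then I.dedicated ⟨v, h⟩ else 0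
  hv j := ∃ h : j < I.jobs, I.heavy ⟨j, h⟩ = true
  el j v := ∃ (h : j < I.jobs) (h' : v < I.machines),
    (⟨v, h'⟩ : Fin I.machines) ∈ I.eligible ⟨j, h⟩
  w_pos := I.w_pos
  two_w := h2
  el_lt := fun _ _ ⟨_, h, _⟩ => h
  card_le := by
    rintro j ⟨hj, hh⟩ a b c ⟨_, ha, ha'⟩ ⟨_, hb, hb'⟩ ⟨_, hc, hc'⟩ hab
    by_contra! hcon
    have hsub : ({⟨a, ha⟩, ⟨b, hb⟩, ⟨c, hc⟩} : Finset (Fin I.machines)) ⊆ I.eligible ⟨j, hj⟩ := by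
      simp [insert_subset_iff, ha', hb', hc']
    have h3 : ({⟨a, ha⟩, ⟨b, hb⟩, ⟨c, hc⟩} : Finset (Fin I.machines)).card = 3 :=
      card_eq_three.2 ⟨_, _, _, by simpa using hab, by simpa using hcon.1.symm,
        by simpa using hcon.2.symm, rfl⟩
    have := card_le_card hsub
    have := I.heavy_card_le ⟨j, hj⟩ hh
    omega

variable {I} {h2 : 2 * I.w ≤ I.W}

theorem dl_sched (i : Fin I.machines) : (sched I h2).dl i = I.dedicated i := by
  simp [sched]

theorem wt_sched (j : Fin I.jobs) : (sched I h2).wt j = I.weight j := by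
  simp [sched, Sched.wt, TwoSizeInstance.weight]

theorem load_eq {σ : Fin I.jobs → Fin I.machines} {pos : ℕ → ℕ}
    (hpos : ∀ j : Fin I.jobs, pos j = σ j) (i : Fin I.machines) :
    I.load σ i = (sched I h2).dl i + binLoad (sched I h2).n (sched I h2).wt pos i := by
  rw [TwoSizeInstance.load, dl_sched, binLoad, sum_filter]
  congr 1
  rw [show (sched I h2).n = I.jobs from rfl, Finset.sum_range]
  refine sum_congr rfl fun j _ => ?_
  rw [hpos, wt_sched]
  simp only [Fin.ext_iff]

theorem base_input : Base (sched I h2) I.input where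
  m := rfl
  n := rfl
  W := rfl
  w := rfl
  dl v hv := by
    simp only [TwoSizeInstance.input, sched]
    simp
  hv j hj := by
    have hj' : j < I.jobs := hj
    simp [TwoSizeInstance.input, sched, hj']
  el j hj v := by
    have hj' : j < I.jobs := hj
    simp only [TwoSizeInstance.input, sched]
    by_cases hv : v < I.machines <;> simp [hj', hv]

theorem opt_attained (I : TwoSizeInstance) : ∃ σ, I.IsAssignment σ ∧ I.makespan σ = I.opt := by
  refine Nat.sInf_mem (s := {t | ∃ σ, I.IsAssignment σ ∧ I.makespan σ = t}) ?_
  choose σ hσ using I.eligible_nonempty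
  exact ⟨_, σ, hσ, rfl⟩

theorem fits_of_assignment {σ : Fin I.jobs → Fin I.machines} (hσ : I.IsAssignment σ)
    {pos : ℕ → ℕ} (hpos : ∀ j : Fin I.jobs, pos j = σ j) :
    (sched I h2).Fits (I.makespan σ) pos where
  el j hj := by
    have h := hpos ⟨j, hj⟩
    simp only at h
    rw [h]
    exact ⟨hj, (σ ⟨j, hj⟩).2, hσ _⟩
  le v hv := by
    rw [← load_eq hpos ⟨v, hv⟩]
    exact le_sup (f := I.load σ) (mem_univ _)

/-- The makespan is one of those that the algorithm tries. -/
theorem makespan_mem {σ : Fin I.jobs → Fin I.machines} {pos : ℕ → ℕ}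
    (hpos : ∀ j : Fin I.jobs, pos j = σ j) (hm : 0 < I.machines) :
    ∃ v < (sched I h2).m, ∃ a < (sched I h2).n + 1, ∃ b < (sched I h2).n + 1,
      (sched I h2).dl v + a * (sched I h2).W + b * (sched I h2).w = I.makespan σ := by
  obtain ⟨i, -, hi⟩ := exists_mem_eq_sup (univ : Finset (Fin I.machines))
    ⟨⟨0, hm⟩, mem_univ _⟩ (I.load σ)
  refine ⟨i, i.2, _, Nat.lt_succ_of_le ((sched I h2).heavy_le pos i), _,
    Nat.lt_succ_of_le ((sched I h2).light_le pos i), ?_⟩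
  rw [TwoSizeInstance.makespan, hi, load_eq (h2 := h2) hpos, Sched.binLoad_wt]
  ring

theorem exec_main (I : TwoSizeInstance) (h2 : 2 * I.w ≤ I.W) :
    ∃ (s : Store) (k : ℕ), Exec main.compile I.input s k ∧ k ≤ main.poly.eval I.size ∧
      ∃ σ : Fin I.jobs → Fin I.machines, I.IsOutput s σ ∧ I.IsAssignment σ ∧
        I.W * I.makespan σ ≤ (I.W + I.W / 2) * I.opt := by
  -- Evaluation of `ok` on the concrete program confirms that loops keep their counters and that
  -- variables `0` and `1` never change.
  obtain ⟨k, hk, hkp⟩ := exec_compile (c := main) (by decide) (N := I.size) I.input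
    (show I.machines ≤ I.size by unfold TwoSizeInstance.size; omega)
    (show I.jobs ≤ I.size by unfold TwoSizeInstance.size; omega)
  refine ⟨_, k, hk, hkp, ?_⟩
  obtain ⟨τ, hτ, hopt⟩ := opt_attained I
  -- Without machines no guess is tried; but then there are no jobs, and any memory describes the
  -- empty assignment.
  rcases Nat.eq_zero_or_pos I.machines with hm | hm
  · refine ⟨τ, fun j => absurd (τ j).2 (by omega), hτ, ?_⟩
    have : I.makespan τ = 0 := by
      refine Nat.eq_zero_of_le_zero (Finset.sup_le fun i _ => absurd i.2 (by omega))
    rw [this, mul_zero]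
    exact Nat.zero_le _
  · let pos : ℕ → ℕ := fun j => if h : j < I.jobs then τ ⟨j, h⟩ else 0
    have hpos : ∀ j : Fin I.jobs, pos j = τ j := fun j => by simp [pos]
    have key := main_spec (base_input (h2 := h2)) rfl (fits_of_assignment hτ hpos)
      (makespan_mem hpos hm)
    rw [hopt] at key
    obtain ⟨hel, hle⟩ := key
    choose hj hv hmem using hel
    refine ⟨fun j => ⟨_, hv j j.2⟩, fun j => rfl, fun j => hmem j j.2, ?_⟩
    obtain ⟨i, -, hi⟩ := exists_mem_eq_sup (univ : Finset (Fin I.machines))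
      ⟨⟨0, hm⟩, mem_univ _⟩ (I.load fun j => ⟨_, hv j j.2⟩)
    rw [TwoSizeInstance.makespan, hi, load_eq (h2 := h2)
      (pos := col (main.den I.input) 3) (fun j => rfl)]
    exact hle i i.2

theorem ratio_lt_of_odd {W : ℕ} (hW : Odd W) : 1 + ((W / 2 : ℕ) : ℚ) / (W : ℚ) < 3 / 2 := by
  obtain ⟨k, rfl⟩ := hW
  rw [show (2 * k + 1) / 2 = k by omega]
  have hpos : (0 : ℚ) < ((2 * k + 1 : ℕ) : ℚ) := by positivity
  have : (k : ℚ) / ((2 * k + 1 : ℕ) : ℚ) < 1 / 2 := by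
    rw [div_lt_div_iff₀ hpos two_pos]
    push_cast
    linarith
  linarith

end GraphBalancing

theorem theorem3 :
    (∃ (c : RAM.Program) (p : Polynomial ℕ),
      ∀ I : TwoSizeInstance, 2 * I.w ≤ I.W →
        ∃ (s : RAM.Store) (k : ℕ), RAM.Exec c I.input s k ∧ k ≤ p.eval I.size ∧
          ∃ σ : Fin I.jobs → Fin I.machines, I.IsOutput s σ ∧ I.IsAssignment σ ∧
            (I.makespan σ : ℚ) ≤ (1 + ((I.W / 2 : ℕ) : ℚ) / (I.W : ℚ)) * (I.opt : ℚ)) ∧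
    (∀ W : ℕ, Odd W → 1 + ((W / 2 : ℕ) : ℚ) / (W : ℚ) < 3 / 2) := by
  refine ⟨⟨GraphBalancing.main.compile, GraphBalancing.main.poly, fun I h2 => ?_⟩,
    fun W hW => GraphBalancing.ratio_lt_of_odd hW⟩
  obtain ⟨s, k, hk, hkp, σ, hout, hσ, hle⟩ := GraphBalancing.exec_main I h2
  refine ⟨s, k, hk, hkp, σ, hout, hσ, ?_⟩
  have hW : (0 : ℚ) < I.W := by exact_mod_cast I.w_pos.trans I.w_lt_W
  have hle' : (I.W : ℚ) * I.makespan σ ≤ (I.W + (I.W / 2 : ℕ)) * I.opt := by exact_mod_cast hle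
  rw [one_add_div hW.ne', div_mul_eq_mul_div, le_div_iff₀ hW, mul_comm]
  exact hle'
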